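/- Let $\Omega\subset\mathbb{R}^3$ be a domain, $\mu>0$, $\eta\ge 0$, and $\mathbb{S}(\nabla\mathbf{u})=\mu\bigl(\nabla\mathbf{u}+\nabla^t\mathbf{u}-\tfrac23\operatorname{div}\mathbf{u}\,\mathbb{I}\bigr)+\eta\operatorname{div}\mathbf{u}\,\mathbb{I}$. For $1\le q<\infty$ let $D^{1,q}_0(\Omega)$ be the completion of $C_c^\infty(\Omega)$ in the norm $\|\nabla\varphi\|_{L^q(\Omega)}$. For the velocity ($q=2$) this is a space of functions; for the potential $G$ membership is understood modulo additive constants, i.e. $G\in L^1_{loc}(\Omega)$ and its weak gradient is the limit in $L^q(\Omega)$ of gradients of functions in $C_c^\infty(\Omega)$. Let $p\in C[0,\infty)\cap C^1(0,\infty)$ with $p(0)=0$, $p\ge 0$ and $p'\ge 0$ on $(0,\infty)$. Let $P$ be its pressure potential: $P(0)=0$ and $P'(s)s-P(s)=p(s)$ for $s>0$, where the free linear term is fixed by $P'(0)=0$ unless $P'(0)=-\infty$. Assume that for some $\gamma>1$ $$\liminf_{s\to0^+}\frac{P(s)}{p(s)}>0,\qquad \liminf_{s\to0^+}\frac{p(s)}{s^\gamma}>0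 .$$ Let $(\rho,\mathbf{u})$ be a weak solution of the steady barotropic Navier–Stokes system $\operatorname{div}(\rho\mathbf{u})=0$, $\operatorname{div}(\rho\mathbf{u}\otimes\mathbf{u})+\nabla p(\rho)-\operatorname{div}\mathbb{S}(\nabla\mathbf{u})=\rho\nabla G$ in $\Omega$, $\mathbf{u}|_{\partial\Omega}=0$. That is: $\rho,\mathbf{u}$ are measurable in $\Omega$, $\rho\ge0$ a.e.; $\rho\mathbf{u}\in L^1_{loc}(\overline\Omega;\mathbb{R}^3)$ and $\int_\Omega\rho\mathbf{u}\cdot\nabla\phi\,dx=0$ for all $\phi\in C_c^\infty(\mathbb{R}^3)$; $\rho,\ \rho|\mathbf{u}|^2,\ p(\rho),\ \rho\nabla G\in L^1_{loc}(\Omega)$, $\mathbf{u}\in D^{1,2}_0(\Omega;\mathbb{R}^3)$, and for all $\boldsymbol\varphi\in C^1_c(\Omega;\mathbb{R}^3)$ $$\int_\Omega[\rho\mathbf{u}\otimes\mathbf{u}:\nabla\boldsymbol\varphi+p(\rho)\operatorname{div}\boldsymbol\varphi]\,dx=\int_\Omega\mathbb{S}(\nabla\mathbf{u}):\nabla\boldsymbol\varphi\,dx-\int_\Omega\rho\nabla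 G\cdot\boldsymbol\varphi\,dx .$$ Suppose that $\rho\in L^\infty(\Omega)$, that the total energy $\int_\Omega\bigl(\tfrac12\rho|\mathbf{u}|^2+P(\rho)\bigr)dx$ is finite, and that - if $\gamma>\frac65$: $G\in D^{1,q}_0(\Omega)$ for some $\frac65\le q\le\frac{6\gamma}{5\gamma-6}$; - if $1<\gamma\le\frac65$: $G\in D^{1,q}_0(\Omega)$ for some $\frac65\le q<\infty$, or $G\in W^{1,\infty}(\Omega)$. Then $\mathbf{u}=0$ a.e. in $\Omega$. -/

import Mathlib

open MeasureTheory Filter Topology Set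
open scoped ENNReal ContDiff

namespace BarotropicNS

/-- Physical space `ℝ³` with the Euclidean norm. -/
abbrev R3 : Type := EuclideanSpace ℝ (Fin 3)

/-- `φ ∈ C_c^k(Ω; F)`. -/
structure IsTestFun {F : Type*} [NormedAddCommGroup F] [NormedSpace ℝ F]
    (k : WithTop ℕ∞) (Ω : Set R3) (φ : R3 → F) : Prop where
  contDiff : ContDiff ℝ k φ
  hasCompactSupport : HasCompactSupport φ
  tsupport_subset : tsupport φ ⊆ Ω

/-- `g` is a weak (distributional) derivative of `f` in the open set `Ω`: both are in `L¹_loc(Ω)`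
and `∫_Ω f ∂_v φ = - ∫_Ω φ (g v)` for every `φ ∈ C_c^∞(Ω)` and every direction `v`. -/
structure IsWeakGradient {F : Type*} [NormedAddCommGroup F] [NormedSpace ℝ F]
    (Ω : Set R3) (f : R3 → F) (g : R3 → R3 →L[ℝ] F) : Prop where
  locallyIntegrableOn : LocallyIntegrableOn f Ω
  locallyIntegrableOn_grad : LocallyIntegrableOn g Ω
  integral_eq : ∀ φ : R3 → ℝ, IsTestFun ∞ Ω φ → ∀ v : R3,
    ∫ x in Ω, (fderiv ℝ φ x v) • f x = - ∫ x in Ω, φ x • g x v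

/-- `f ∈ L¹_loc(Ω)` has a weak gradient in `L¹_loc(Ω)`. -/
def HasWeakGradient {F : Type*} [NormedAddCommGroup F] [NormedSpace ℝ F]
    (Ω : Set R3) (f : R3 → F) : Prop :=
  ∃ g : R3 → R3 →L[ℝ] F, IsWeakGradient Ω f g

open Classical in
/-- The weak gradient of `f` in `Ω` (unique up to a null set of `Ω`; it is only used for functions
that have one). -/
noncomputable def weakGrad {F : Type*} [NormedAddCommGroup F] [NormedSpace ℝ F]
    (Ω : Set R3) (f : R3 → F) : R3 → R3 →L[ℝ] F :=
  if h : HasWeakGradient Ω f then h.choose else 0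

/-- The homogeneous Sobolev space `D^{1,q}(Ω; F)`. -/
structure MemD {F : Type*} [NormedAddCommGroup F] [NormedSpace ℝ F]
    (Ω : Set R3) (q : ℝ≥0∞) (f : R3 → F) : Prop where
  hasWeakGradient : HasWeakGradient Ω f
  memLp_grad : MemLp (weakGrad Ω f) q (volume.restrict Ω)

/-- The class of `f` modulo constants belongs to the completion `D₀^{1,q}(Ω; F)` of `C_c^∞(Ω; F)`
in the norm `‖∇φ‖_{L^q(Ω)}`, seen as a closed subspace of `D^{1,q}(Ω; F)` modulo constants. -/
def MemD0ModConst {F : Type*} [NormedAddCommGroup F] [NormedSpace ℝ F]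
    (Ω : Set R3) (q : ℝ≥0∞) (f : R3 → F) : Prop :=
  MemD Ω q f ∧ ∃ φ : ℕ → R3 → F, (∀ n, IsTestFun ∞ Ω (φ n)) ∧
    Tendsto (fun n => eLpNorm (fun x => fderiv ℝ (φ n) x - weakGrad Ω f x) q (volume.restrict Ω))
      atTop (𝓝 0)

/-- The completion `D₀^{1,q}(Ω; F)` of `C_c^∞(Ω; F)` in the norm `‖∇φ‖_{L^q(Ω)}`, realized as a
space of functions (no constants are factored out): the approximating test functions
converge to `f` itself in `L¹_loc(Ω)`, and their gradients to `∇f` in `L^q(Ω)`. -/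
def MemD0 {F : Type*} [NormedAddCommGroup F] [NormedSpace ℝ F]
    (Ω : Set R3) (q : ℝ≥0∞) (f : R3 → F) : Prop :=
  MemD Ω q f ∧ ∃ φ : ℕ → R3 → F, (∀ n, IsTestFun ∞ Ω (φ n)) ∧
    (∀ K : Set R3, IsCompact K → K ⊆ Ω →
      Tendsto (fun n => eLpNorm (fun x => φ n x - f x) 1 (volume.restrict K)) atTop (𝓝 0)) ∧
    Tendsto (fun n => eLpNorm (fun x => fderiv ℝ (φ n) x - weakGrad Ω f x) q (volume.restrict Ω))
      atTop (𝓝 0)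

/-- The Sobolev space `W^{1,∞}(Ω)`. -/
structure MemW1Infty (Ω : Set R3) (f : R3 → ℝ) : Prop where
  hasWeakGradient : HasWeakGradient Ω f
  memLp : MemLp f ∞ (volume.restrict Ω)
  memLp_grad : MemLp (weakGrad Ω f) ∞ (volume.restrict Ω)

/-- The matrix `(∂_j u_i)_{ij}` of the derivative of a vector field at a point. -/
noncomputable def jac (A : R3 →L[ℝ] R3) : Matrix (Fin 3) (Fin 3) ℝ :=
  Matrix.of fun i j => A (EuclideanSpace.single j 1) i

/-- `A : B = ∑_{i,j} A_ij B_ij`. -/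
def contract (A B : Matrix (Fin 3) (Fin 3) ℝ) : ℝ :=
  ∑ i, ∑ j, A i j * B i j

/-- `(a ⊗ b)_ij = a_i b_j`. -/
def tensor (a b : R3) : Matrix (Fin 3) (Fin 3) ℝ :=
  Matrix.of fun i j => a i * b j

/-- Newton's viscous stress `𝕊(M) = μ (M + Mᵗ - (2/3) tr(M) 𝕀) + η tr(M) 𝕀`, `M = ∇u`. -/
noncomputable def stress (μ η : ℝ) (M : Matrix (Fin 3) (Fin 3) ℝ) : Matrix (Fin 3) (Fin 3) ℝ :=
  μ • (M + M.transpose - ((2 / 3 : ℝ) * M.trace) • (1 : Matrix (Fin 3) (Fin 3) ℝ))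
    + (η * M.trace) • (1 : Matrix (Fin 3) (Fin 3) ℝ)

/-- `(ρ, u)` is a weak solution in `Ω` of the steady barotropic Navier–Stokes system
`div(ρu) = 0`, `div(ρ u ⊗ u) + ∇p(ρ) - div 𝕊(∇u) = ρ∇G`, `u = 0` on `∂Ω`. -/
structure IsWeakSolution (Ω : Set R3) (p : ℝ → ℝ) (μ η : ℝ) (G : R3 → ℝ)
    (ρ : R3 → ℝ) (u : R3 → R3) : Prop where
  aemeasurable_density : AEMeasurable ρ (volume.restrict Ω)
  aemeasurable_velocity : AEMeasurable u (volume.restrict Ω)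
  density_nonneg : ∀ᵐ x ∂(volume.restrict Ω), 0 ≤ ρ x
  /-- `ρu ∈ L¹_loc(closure Ω)` -/
  integrable_flux : ∀ K : Set R3, IsCompact K → IntegrableOn (fun x => ρ x • u x) (Ω ∩ K)
  /-- weak form of `div(ρu) = 0`, with test functions on the whole space -/
  mass : ∀ φ : R3 → ℝ, IsTestFun ∞ univ φ → ∫ x in Ω, ρ x * fderiv ℝ φ x (u x) = 0
  locInt_density : LocallyIntegrableOn ρ Ω
  locInt_kinetic : LocallyIntegrableOn (fun x => ρ x * ‖u x‖ ^ 2) Ω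
  locInt_pressure : LocallyIntegrableOn (fun x => p (ρ x)) Ω
  hasWeakGradient_potential : HasWeakGradient Ω G
  locInt_force : LocallyIntegrableOn (fun x => ρ x • weakGrad Ω G x) Ω
  memD0_velocity : MemD0 Ω 2 u
  /-- weak form of the momentum balance -/
  momentum : ∀ φ : R3 → R3, IsTestFun 1 Ω φ →
    ∫ x in Ω, (ρ x * contract (tensor (u x) (u x)) (jac (fderiv ℝ φ x))
        + p (ρ x) * (jac (fderiv ℝ φ x)).trace)
      = (∫ x in Ω, contract (stress μ η (jac (weakGrad Ω u x))) (jac (fderiv ℝ φ x)))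
        - ∫ x in Ω, ρ x * weakGrad Ω G x (φ x)

/-- `P` is the pressure potential of `p`: `P(0) = 0`, `P'(s) s - P(s) = p(s)` for `s > 0`, with the
free linear term fixed by `P'(0) = 0` unless `P'(0) = -∞`. -/
structure IsPressurePotential (p P : ℝ → ℝ) : Prop where
  map_zero : P 0 = 0
  differentiableAt : ∀ s : ℝ, 0 < s → DifferentiableAt ℝ P s
  ode : ∀ s : ℝ, 0 < s → deriv P s * s - P s = p s
  normalized : Tendsto (fun s => P s / s) (𝓝[>] 0) (𝓝 0) ∨
    Tendsto (fun s => P s / s) (𝓝[>] 0) atBot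

/-- The total energy density `E(ρ, u) = ½ ρ |u|² + P(ρ)`. -/
noncomputable def energy (P : ℝ → ℝ) (r : ℝ) (v : R3) : ℝ :=
  1 / 2 * r * ‖v‖ ^ 2 + P r

end BarotropicNS

open BarotropicNS

/-!
Testing the momentum balance with the velocity itself would give `∫ 𝕊(∇u) : ∇u = 0` provided the
convective term, the pressure and the force do no work on `u`; Korn's and Sobolev's inequalities
then force `u = 0`. The velocity is not an admissible test field, so test fields `w n` with
`w n → u` in `L⁶` and `∇(w n) → ∇u` in `L²` are used (`MemD0.exists_approx`, by Sobolev's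
inequality), and each term is shown to converge to zero.

Finite energy together with the behaviour of `P` and `p` near the vacuum gives `ρ ∈ L^γ ∩ L^∞`,
`ρ|u|² ∈ L¹` and `p(ρ), ρu ∈ L²`.

* Convective term (`tendsto_convective_zero`). The mass balance with `|w n|² / 2` gives
  `∫ ρ w·(∇w u) = 0`, and `∫ ρ (u - w)·(∇w u)` is small since `ρu ∈ L³`.
* Pressure (`integral_pressure_work_eq_zero`). Formally `p(ρ) div u = -div(P(ρ) u)` by the mass
  balance. This is a renormalization in the sense of DiPerna and Lions: the density, extended by zero
  outside `Ω`, is mollified, the commutator converges to zero because `∇u ∈ L²` and `ρ` is bounded,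
  and the remaining divergence is removed by cutoffs at infinity because `P(ρ) u ∈ L¹`. The
  renormalizing function has to be `C¹` up to the vacuum; the normalization of `P` and the positive
  lower limit of `P / p` provide this (`IsPressurePotential.exists_extension`).
* Force. If `∇G` is the `L^q` limit of gradients of test functions `φ`, then
  `∫ ρ ∇φ·u = 0` passes to the limit: the range of `q` is what makes `ρ ∇G ∈ L^{6/5}` follow from
  `ρ ∈ L^γ ∩ L^∞` (`force_of_memD0ModConst`). If `G ∈ W^{1,∞}` it need not vanish on the
  boundary, but `u` does: the mass balance is tested with mollifications of `G |w|² / (|w|² + ε)`,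
  and the terms with derivatives of the cutoff vanish as `ε → 0`
  (`integral_force_eq_zero_of_bounded`).

Finally `∫ |∇w n|²` is controlled by the dissipation of `w n` (`integral_norm_fderiv_sq_le`, Korn's
inequality for test fields), hence tends to zero, and so does `‖w n‖_{L⁶}`.
-/

namespace BarotropicNS

/-! ### The pressure potential -/

section Pressure

variable {p P : ℝ → ℝ}

theorem IsPressurePotential.monotoneOn_div (hP : IsPressurePotential p P)
    (hp : ∀ s : ℝ, 0 ≤ s → 0 ≤ p s) : MonotoneOn (fun s => P s / s) (Ioi 0) := by
  have hd : ∀ s : ℝ, 0 < s → HasDerivAt (fun s => P s / s) (p s / s ^ 2) s := fun s hs => by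
    have h := (hP.differentiableAt s hs).hasDerivAt.div (hasDerivAt_id s) hs.ne'
    refine h.congr_deriv ?_
    rw [← hP.ode s hs]
    simp
  refine monotoneOn_of_deriv_nonneg (convex_Ioi 0)
    (fun s hs => (hd s hs).continuousAt.continuousWithinAt)
    (fun s hs => (hd s (by simpa using hs)).differentiableAt.differentiableWithinAt) ?_
  intro s hs
  rw [interior_Ioi, mem_Ioi] at hs
  rw [(hd s hs).deriv]
  exact div_nonneg (hp s hs.le) (by positivity)

/-- A positive lower limit yields a uniform positive lower bound near `0`. -/
theorem exists_pos_lt_of_liminf_pos {f : ℝ → ℝ}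
    (h : 0 < liminf (fun s : ℝ => (f s : EReal)) (𝓝[>] 0)) :
    ∃ c : ℝ, 0 < c ∧ ∃ δ : ℝ, 0 < δ ∧ ∀ s, 0 < s → s < δ → c < f s := by
  obtain ⟨c, hc0, hc⟩ := EReal.lt_iff_exists_real_btwn.1 h
  have h1 := eventually_lt_of_lt_liminf hc
  obtain ⟨δ, hδ, hs⟩ := mem_nhdsGT_iff_exists_Ioo_subset.1 h1
  exact ⟨c, by exact_mod_cast hc0, δ, hδ, fun s h0 h1 => by
    have : (c : EReal) < (f s : EReal) := hs ⟨h0, h1⟩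
    exact_mod_cast this⟩

/-- Near the vacuum, the two lower limits bound `p` and `s ^ γ` by the pressure potential. -/
theorem exists_local_bounds {γ : ℝ}
    (hPp : 0 < liminf (fun s : ℝ => ((P s / p s : ℝ) : EReal)) (𝓝[>] 0))
    (hpγ : 0 < liminf (fun s : ℝ => ((p s / s ^ γ : ℝ) : EReal)) (𝓝[>] 0)) :
    ∃ C : ℝ, 0 < C ∧ ∃ δ : ℝ, 0 < δ ∧ ∀ s, 0 < s → s < δ →
      0 < P s ∧ p s ≤ C * P s ∧ s ^ γ ≤ C * P s := by
  obtain ⟨c, hc, δ, hδ, h⟩ := exists_pos_lt_of_liminf_pos hPp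
  obtain ⟨c', hc', δ', hδ', h'⟩ := exists_pos_lt_of_liminf_pos hpγ
  refine ⟨max c⁻¹ (c⁻¹ * c'⁻¹), by positivity, min δ δ', lt_min hδ hδ', fun s hs0 hs => ?_⟩
  have hγ : (0 : ℝ) < s ^ γ := Real.rpow_pos_of_pos hs0 _
  have h1 := h s hs0 (hs.trans_le (min_le_left _ _))
  have h2 := h' s hs0 (hs.trans_le (min_le_right _ _))
  rw [lt_div_iff₀ hγ] at h2
  have hp : 0 < p s := lt_trans (by positivity) h2
  rw [lt_div_iff₀ hp] at h1
  have hPs : 0 < P s := lt_trans (by positivity) h1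
  have h3 : p s ≤ c⁻¹ * P s := by
    rw [inv_mul_eq_div, le_div_iff₀ hc]; linarith
  have h4 : s ^ γ ≤ c⁻¹ * c'⁻¹ * P s := by
    have : s ^ γ ≤ c'⁻¹ * p s := by rw [inv_mul_eq_div, le_div_iff₀ hc']; linarith
    calc s ^ γ ≤ c'⁻¹ * p s := this
      _ ≤ c'⁻¹ * (c⁻¹ * P s) := by gcongr
      _ = _ := by ring
  exact ⟨hPs, h3.trans (by gcongr; exact le_max_left _ _),
    h4.trans (by gcongr; exact le_max_right _ _)⟩

/-- On bounded sets of densities, `p`, `s ^ γ` and `P` are controlled by `P`, `P` and `s`. -/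
theorem IsPressurePotential.exists_bounds (hP : IsPressurePotential p P)
    (hp_cont : ContinuousOn p (Ici 0)) (hp_zero : p 0 = 0) (hp : ∀ s : ℝ, 0 ≤ s → 0 ≤ p s)
    {γ : ℝ} (hγ : 1 < γ)
    (hPp : 0 < liminf (fun s : ℝ => ((P s / p s : ℝ) : EReal)) (𝓝[>] 0))
    (hpγ : 0 < liminf (fun s : ℝ => ((p s / s ^ γ : ℝ) : EReal)) (𝓝[>] 0)) (M : ℝ) :
    ∃ C : ℝ, ∀ s, 0 ≤ s → s ≤ M →
      0 ≤ P s ∧ p s ≤ C * P s ∧ s ^ γ ≤ C * P s ∧ P s ≤ C * s ∧ p s ≤ C := by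
  obtain ⟨C₀, hC₀, δ, hδ, h⟩ := exists_local_bounds hPp hpγ
  have hmono := hP.monotoneOn_div hp
  obtain ⟨m, hm⟩ : ∃ m, ∀ s ∈ Icc 0 M, p s ≤ m := by
    obtain ⟨m, hm⟩ := (isCompact_Icc (a := (0 : ℝ)) (b := M)).bddAbove_image
      (hp_cont.mono (fun s hs => hs.1))
    exact ⟨m, fun s hs => hm ⟨s, hs, rfl⟩⟩
  set κ := P (δ / 2) with hκ
  have hκ0 : 0 < κ := (h (δ / 2) (by linarith) (by linarith)).1
  -- for `s ≥ δ / 2` the potential is at least `κ`, because `P s / s` is nondecreasing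
  have hlow : ∀ s, δ / 2 ≤ s → κ ≤ P s := fun s hs => by
    have h0 : 0 < s := by linarith
    have h1 := hmono (show δ / 2 ∈ Ioi (0 : ℝ) by simp [hδ]) (show s ∈ Ioi (0 : ℝ) from h0) hs
    simp only at h1
    rw [div_le_div_iff₀ (by linarith) h0] at h1
    nlinarith
  set Q := max 1 (P (max M 1) / max M 1)
  refine ⟨max (max C₀ (m / κ)) (max (max (M ^ γ / κ) Q) m), fun s hs0 hsM => ?_⟩
  set C := max (max C₀ (m / κ)) (max (max (M ^ γ / κ) Q) m)
  have c1 : C₀ ≤ C := (le_max_left _ _).trans (le_max_left _ _)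
  have c2 : m / κ ≤ C := (le_max_right _ _).trans (le_max_left _ _)
  have c3 : M ^ γ / κ ≤ C := ((le_max_left _ _).trans (le_max_left _ _)).trans (le_max_right _ _)
  have c4 : Q ≤ C := ((le_max_right _ _).trans (le_max_left _ _)).trans (le_max_right _ _)
  have c5 : m ≤ C := (le_max_right _ _).trans (le_max_right _ _)
  have hpC : p s ≤ C := (hm s ⟨hs0, hsM⟩).trans c5
  rcases hs0.eq_or_lt with rfl | hs
  · simp only [hP.map_zero, hp_zero, mul_zero, le_refl, true_and]
    rw [Real.zero_rpow (by linarith)]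
    simpa [hp_zero] using hpC
  have hPs : P s ≤ C * s := by
    have h1 := hmono (show s ∈ Ioi (0 : ℝ) from hs)
      (show max M 1 ∈ Ioi (0 : ℝ) from lt_of_lt_of_le one_pos (le_max_right M 1)) (hsM.trans (le_max_left _ _))
    simp only at h1
    rw [div_le_iff₀ hs] at h1
    exact h1.trans (by gcongr; exact (le_max_right _ _).trans c4)
  rcases lt_or_ge s δ with h1 | h1
  · obtain ⟨a, b, c⟩ := h s hs h1
    exact ⟨a.le, b.trans (by gcongr), c.trans (by gcongr), hPs, hpC⟩
  · have h2 := hlow s (by linarith)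
    have hC : 0 ≤ C := hC₀.le.trans c1
    refine ⟨hκ0.le.trans h2, ?_, ?_, hPs, hpC⟩
    · calc p s ≤ m := hm s ⟨hs0, hsM⟩
        _ = m / κ * κ := by field_simp
        _ ≤ C * κ := by gcongr
        _ ≤ C * P s := by gcongr
    · calc s ^ γ ≤ M ^ γ := Real.rpow_le_rpow hs0 hsM (by linarith)
        _ = M ^ γ / κ * κ := by field_simp
        _ ≤ C * κ := by gcongr
        _ ≤ C * P s := by gcongr

/-- The pressure potential extends to a `C¹` function on the whole line, vanishing for negative
arguments: since `P ≥ 0`, the normalization forces `P s / s → 0`, and `p ≤ C P` near `0` then gives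
`P' s = (p s + P s) / s → 0`. -/
theorem IsPressurePotential.exists_extension (hP : IsPressurePotential p P)
    (hp_cont : ContinuousOn p (Ici 0)) (hp_zero : p 0 = 0) (hp : ∀ s : ℝ, 0 ≤ s → 0 ≤ p s)
    {γ : ℝ}
    (hPp : 0 < liminf (fun s : ℝ => ((P s / p s : ℝ) : EReal)) (𝓝[>] 0))
    (hpγ : 0 < liminf (fun s : ℝ => ((p s / s ^ γ : ℝ) : EReal)) (𝓝[>] 0)) :
    ∃ b b' : ℝ → ℝ, Continuous b' ∧ (∀ s, HasDerivAt b (b' s) s) ∧ (∀ s, 0 ≤ s → b s = P s) ∧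
      ∀ s, 0 ≤ s → b' s * s - b s = p s := by
  obtain ⟨C, hC, δ, hδ, h⟩ := exists_local_bounds hPp hpγ
  have hev : ∀ᶠ s : ℝ in 𝓝[>] 0, 0 < s ∧ s < δ := Ioo_mem_nhdsGT hδ
  have hlim : Tendsto (fun s => P s / s) (𝓝[>] 0) (𝓝 0) := by
    refine hP.normalized.resolve_right fun hbot => ?_
    obtain ⟨s, h1, h2⟩ := ((hbot.eventually (eventually_lt_atBot 0)).and hev).exists
    have := (h s h2.1 h2.2).1
    exact absurd h1 (not_lt.2 (div_nonneg this.le h2.1.le))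
  have hlim' : Tendsto (fun s => (p s + P s) / s) (𝓝[>] 0) (𝓝 0) := by
    refine squeeze_zero' (g := fun s => (C + 1) * (P s / s)) ?_ ?_ (by simpa using hlim.const_mul (C + 1))
    · filter_upwards [hev] with s hs
      exact div_nonneg (add_nonneg (hp s hs.1.le) (h s hs.1 hs.2).1.le) hs.1.le
    · filter_upwards [hev] with s hs
      rw [← mul_div_assoc]
      have := (h s hs.1 hs.2).2.1
      have := hs.1
      gcongr
      linarith
  set b : ℝ → ℝ := fun s => if 0 < s then P s else 0 with hb
  set b' : ℝ → ℝ := fun s => if 0 < s then (p s + P s) / s else 0 with hb'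
  have hpos : ∀ s, 0 < s → b =ᶠ[𝓝 s] P := fun s hs => by
    filter_upwards [Ioi_mem_nhds hs] with t ht
    simp [hb, mem_Ioi.1 ht]
  have hpos' : ∀ s, 0 < s → b' =ᶠ[𝓝 s] fun s => (p s + P s) / s := fun s hs => by
    filter_upwards [Ioi_mem_nhds hs] with t ht
    simp [hb', mem_Ioi.1 ht]
  have hneg : ∀ s, s ≤ 0 → b s = 0 := fun s hs => by simp [hb, not_lt.2 hs]
  have hneg' : ∀ s, s ≤ 0 → b' s = 0 := fun s hs => by simp [hb', not_lt.2 hs]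
  refine ⟨b, b', ?_, ?_, ?_, ?_⟩
  · rw [continuous_iff_continuousAt]
    intro s
    rcases lt_trichotomy s 0 with hs | rfl | hs
    · have : b' =ᶠ[𝓝 s] fun _ => 0 := by
        filter_upwards [Iio_mem_nhds hs] with t ht using hneg' t (mem_Iio.1 ht).le
      exact continuousAt_const.congr this.symm
    · rw [continuousAt_iff_continuous_left'_right']
      constructor
      · have : b' =ᶠ[𝓝[<] 0] fun _ => 0 := by
          filter_upwards [self_mem_nhdsWithin] with t ht using hneg' t (mem_Iio.1 ht).le
        rw [ContinuousWithinAt, hneg' 0 le_rfl]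
        exact tendsto_const_nhds.congr' this.symm
      · rw [ContinuousWithinAt, hneg' 0 le_rfl]
        refine hlim'.congr' ?_
        filter_upwards [self_mem_nhdsWithin] with t ht
        simp [hb', mem_Ioi.1 ht]
    · refine ContinuousAt.congr ?_ (hpos' s hs).symm
      have h1 : ContinuousAt p s := hp_cont.continuousAt (Ici_mem_nhds hs)
      exact (h1.add (hP.differentiableAt s hs).continuousAt).div continuousAt_id hs.ne'
  · intro s
    rcases lt_trichotomy s 0 with hs | rfl | hs
    · have : b =ᶠ[𝓝 s] fun _ => 0 := by
        filter_upwards [Iio_mem_nhds hs] with t ht using hneg t (mem_Iio.1 ht).le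
      rw [hneg' s hs.le]
      exact (hasDerivAt_const s 0).congr_of_eventuallyEq this
    · rw [hneg' 0 le_rfl, hasDerivAt_iff_tendsto_slope, ← nhdsLT_sup_nhdsGT, tendsto_sup]
      constructor
      · refine tendsto_const_nhds.congr' ?_
        filter_upwards [self_mem_nhdsWithin] with t ht
        simp [slope_def_field, hneg t (mem_Iio.1 ht).le, hneg 0 le_rfl]
      · refine hlim.congr' ?_
        filter_upwards [self_mem_nhdsWithin] with t ht
        simp [slope_def_field, hb, mem_Ioi.1 ht]
    · refine ((hP.differentiableAt s hs).hasDerivAt.congr_of_eventuallyEq (hpos s hs)).congr_deriv ?_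
      rw [(hpos' s hs).eq_of_nhds, eq_div_iff hs.ne', ← hP.ode s hs]
      ring
  · intro s hs
    rcases hs.eq_or_lt with rfl | hs
    · rw [hneg 0 le_rfl, hP.map_zero]
    · exact (hpos s hs).eq_of_nhds
  · intro s hs
    rcases hs.eq_or_lt with rfl | hs
    · simp [hneg 0 le_rfl, hp_zero]
    · rw [(hpos s hs).eq_of_nhds, (hpos' s hs).eq_of_nhds]
      field_simp
      ring

end Pressure

/-! ### Integral inequalities and integration by parts -/

section Tools

/-- Hölder's inequality for the product of two norms. -/
theorem lintegral_enorm_mul_enorm_le {α E F : Type*} [MeasurableSpace α] {ν : Measure α}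
    [NormedAddCommGroup E] [NormedAddCommGroup F] (p q : ℝ≥0∞) [ENNReal.HolderConjugate p q]
    {f : α → E} {g : α → F} (hf : AEStronglyMeasurable f ν) (hg : AEStronglyMeasurable g ν) :
    ∫⁻ x, ‖f x‖ₑ * ‖g x‖ₑ ∂ν ≤ eLpNorm f p ν * eLpNorm g q ν := by
  have h := eLpNorm_smul_le_mul_eLpNorm (p := p) (q := q) (r := 1) hg.norm hf.norm
  rw [eLpNorm_one_eq_lintegral_enorm, eLpNorm_norm, eLpNorm_norm] at h
  refine le_trans (le_of_eq ?_) h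
  refine lintegral_congr fun x => ?_
  simp [enorm_mul]

theorem abs_trace_jac_le (A : R3 →L[ℝ] R3) : |(jac A).trace| ≤ 3 * ‖A‖ := by
  have h : ∀ i : Fin 3, |(A (EuclideanSpace.single i 1)) i| ≤ ‖A‖ := fun i => by
    have h1 := PiLp.norm_apply_le (A (EuclideanSpace.single i (1 : ℝ))) i
    have h2 := A.le_opNorm (EuclideanSpace.single i (1 : ℝ))
    simp at h1 h2
    exact h1.trans h2
  simp only [Matrix.trace, Fin.sum_univ_three, Matrix.diag, jac, Matrix.of_apply]
  have := h 0; have := h 1; have := h 2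
  rw [abs_le] at *
  constructor <;> linarith

theorem trace_jac_add (A B : R3 →L[ℝ] R3) :
    (jac (A + B)).trace = (jac A).trace + (jac B).trace := by
  simp [jac, Matrix.trace, Finset.sum_add_distrib]

theorem trace_jac_sub (A B : R3 →L[ℝ] R3) :
    (jac (A - B)).trace = (jac A).trace - (jac B).trace := by
  simp [jac, Matrix.trace, Finset.sum_sub_distrib]

/-- The trace of the Jacobian as a continuous linear functional. -/
noncomputable def traceCLM : (R3 →L[ℝ] R3) →L[ℝ] ℝ :=
  LinearMap.mkContinuous
    { toFun := fun A => (jac A).trace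
      map_add' := trace_jac_add
      map_smul' := fun c A => by simp [jac, Matrix.trace, Finset.mul_sum] } 3
    (fun A => by simpa using abs_trace_jac_le A)

theorem apply_eq_sum (L : R3 →L[ℝ] ℝ) (w : R3) :
    L w = ∑ i, w i * L (EuclideanSpace.single i 1) := by
  conv_lhs => rw [← (EuclideanSpace.basisFun (Fin 3) ℝ).sum_repr w]
  simp

theorem ContDiff.coord {k : WithTop ℕ∞} {w : R3 → R3} (hw : ContDiff ℝ k w) (i : Fin 3) :
    ContDiff ℝ k (fun x => w x i) :=
  (EuclideanSpace.proj (𝕜 := ℝ) i).contDiff.comp hw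

theorem fderiv_coord {w : R3 → R3} {x : R3} (hw : DifferentiableAt ℝ w x) (i : Fin 3) (v : R3) :
    fderiv ℝ (fun x => w x i) x v = (fderiv ℝ w x v) i := by
  have := ((EuclideanSpace.proj (𝕜 := ℝ) i).hasFDerivAt.comp x hw.hasFDerivAt).fderiv
  have h2 : (fun x => w x i) = (EuclideanSpace.proj (𝕜 := ℝ) i) ∘ w := rfl
  rw [h2, this]
  rfl

/-- Integration by parts: `∫ ∇h · w = - ∫ h div w`. -/
theorem integral_fderiv_apply_eq_neg {h : R3 → ℝ} {w : R3 → R3} (hh : ContDiff ℝ 1 h)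
    (hw : ContDiff ℝ 1 w) (hc : HasCompactSupport h ∨ HasCompactSupport w) :
    ∫ x, fderiv ℝ h x (w x) = - ∫ x, h x * (jac (fderiv ℝ w x)).trace := by
  have hwi := fun i => ContDiff.coord hw i
  have hdh : ∀ v, Continuous fun x => fderiv ℝ h x v := fun v =>
    (hh.continuous_fderiv one_ne_zero).clm_apply continuous_const
  have hdw : ∀ i v, Continuous fun x => fderiv ℝ (fun x => w x i) x v := fun i v =>
    ((hwi i).continuous_fderiv one_ne_zero).clm_apply continuous_const
  have hci : ∀ i, HasCompactSupport h ∨ HasCompactSupport (fun x => w x i) := fun i =>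
    hc.imp_right fun h => h.comp_left (g := fun y : R3 => y i) rfl
  have i1 : ∀ i, Integrable fun x => w x i * fderiv ℝ h x (EuclideanSpace.single i 1) := fun i => by
    refine ((hwi i).continuous.mul (hdh _)).integrable_of_hasCompactSupport ?_
    rcases hci i with h | h
    · exact (h.fderiv_apply ℝ _).mul_left
    · exact h.mul_right
  have i2 : ∀ i, Integrable fun x =>
      fderiv ℝ (fun x => w x i) x (EuclideanSpace.single i 1) * h x := fun i => by
    refine ((hdw i _).mul hh.continuous).integrable_of_hasCompactSupport ?_
    rcases hci i with h | h
    · exact h.mul_left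
    · exact (h.fderiv_apply ℝ _).mul_right
  have i3 : ∀ i, Integrable fun x => w x i * h x := fun i => by
    refine ((hwi i).continuous.mul hh.continuous).integrable_of_hasCompactSupport ?_
    rcases hci i with h | h
    · exact h.mul_left
    · exact h.mul_right
  calc ∫ x, fderiv ℝ h x (w x)
      = ∫ x, ∑ i, w x i * fderiv ℝ h x (EuclideanSpace.single i 1) := by
        simp_rw [← apply_eq_sum]
    _ = ∑ i, ∫ x, w x i * fderiv ℝ h x (EuclideanSpace.single i 1) :=
        integral_finsetSum _ fun i _ => i1 i
    _ = ∑ i, - ∫ x, fderiv ℝ (fun x => w x i) x (EuclideanSpace.single i 1) * h x := by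
        refine Finset.sum_congr rfl fun i _ => ?_
        exact integral_mul_fderiv_eq_neg_fderiv_mul_of_integrable (i2 i) (i1 i) (i3 i)
          (fun x _ => ((hwi i).differentiable one_ne_zero) x)
          (fun x _ => (hh.differentiable one_ne_zero) x)
    _ = - ∫ x, ∑ i, fderiv ℝ (fun x => w x i) x (EuclideanSpace.single i 1) * h x := by
        rw [integral_finsetSum _ fun i _ => i2 i, Finset.sum_neg_distrib]
    _ = _ := by
        congr 1
        refine integral_congr_ae (Eventually.of_forall fun x => ?_)
        simp only [Matrix.trace, Matrix.diag, jac, Matrix.of_apply, Finset.mul_sum]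
        refine Finset.sum_congr rfl fun i _ => ?_
        rw [fderiv_coord (hw.differentiable one_ne_zero x), mul_comm]

/-- Lebesgue points, in the form used for rescaled kernels on `ℝ³`. -/
theorem ae_tendsto_inv_cube_mul_integral {f : R3 → ℝ} (hf : LocallyIntegrable f) :
    ∀ᵐ x, ∀ ε : ℕ → ℝ, Tendsto ε atTop (𝓝[>] 0) →
      Tendsto (fun j => ((ε j) ^ 3)⁻¹ * ∫ y in Metric.closedBall x (ε j), |f y - f x|)
        atTop (𝓝 0) := by
  filter_upwards [IsUnifLocDoublingMeasure.ae_tendsto_average_norm_sub volume hf 1] with x hx ε hε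
  have hpos : ∀ᶠ j in atTop, 0 < ε j := hε.eventually self_mem_nhdsWithin
  have h := hx (fun _ => x) ε hε (by
    filter_upwards [hpos] with j hj
    simpa using hj.le)
  have h2 := h.const_mul (volume.real (Metric.ball (0 : R3) 1))
  rw [mul_zero] at h2
  refine h2.congr' ?_
  filter_upwards [hpos] with j hj
  have hV : volume.real (Metric.ball (0 : R3) 1) ≠ 0 :=
    (ENNReal.toReal_pos (Metric.measure_ball_pos _ _ one_pos).ne' measure_ball_lt_top.ne).ne'
  rw [setAverage_eq, Measure.addHaar_real_closedBall _ _ hj.le]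
  simp only [finrank_euclideanSpace, Fintype.card_fin, Real.norm_eq_abs, smul_eq_mul]
  field_simp

/-- The `L²` estimate for difference quotients, tested against a function `β`. -/
theorem lintegral_mul_enorm_sub_le {v : R3 → R3} (hv : ContDiff ℝ 1 v) {β : R3 → ℝ}
    (hβ : Measurable β) (z : R3) :
    ∫⁻ x, ‖β x‖ₑ * ‖v (x + z) - v x‖ₑ ≤
      ‖z‖ₑ * (eLpNorm β 2 volume * eLpNorm (fderiv ℝ v) 2 volume) := by
  have hcont := hv.continuous_fderiv one_ne_zero
  have h1 : ∀ x, ‖v (x + z) - v x‖ₑ ≤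
      ∫⁻ t in Ioc (0 : ℝ) 1, ‖fderiv ℝ v (x + t • z)‖ₑ * ‖z‖ₑ := fun x => by
    have hd : ∀ t ∈ uIcc (0 : ℝ) 1,
        HasDerivAt (fun t : ℝ => v (x + t • z)) (fderiv ℝ v (x + t • z) z) t := fun t _ => by
      have ha : HasDerivAt (fun t : ℝ => x + t • z) z t := by
        simpa using ((hasDerivAt_id t).smul_const z).const_add x
      exact ((hv.differentiable one_ne_zero _).hasFDerivAt).comp_hasDerivAt t ha
    have hi := intervalIntegral.integral_eq_sub_of_hasDerivAt hd
      (Continuous.intervalIntegrable (by fun_prop) _ _)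
    simp only [one_smul, zero_smul, add_zero] at hi
    rw [← hi, intervalIntegral.integral_of_le zero_le_one]
    refine (enorm_integral_le_lintegral_enorm _).trans ?_
    exact lintegral_mono fun t => ContinuousLinearMap.le_opENorm _ _
  calc ∫⁻ x, ‖β x‖ₑ * ‖v (x + z) - v x‖ₑ
      ≤ ∫⁻ x, ∫⁻ t in Ioc (0 : ℝ) 1, ‖z‖ₑ * (‖β x‖ₑ * ‖fderiv ℝ v (x + t • z)‖ₑ) := by
        refine lintegral_mono fun x => ?_
        refine (mul_le_mul_right (h1 x) _).trans (le_of_eq ?_)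
        rw [← lintegral_const_mul' _ _ enorm_ne_top]
        refine lintegral_congr fun t => ?_
        ring
    _ = ∫⁻ t in Ioc (0 : ℝ) 1, ∫⁻ x, ‖z‖ₑ * (‖β x‖ₑ * ‖fderiv ℝ v (x + t • z)‖ₑ) := by
        refine lintegral_lintegral_swap (Measurable.aemeasurable ?_)
        refine measurable_const.mul ((hβ.comp measurable_fst).enorm.mul ?_)
        exact (Continuous.measurable (by fun_prop)).enorm
    _ ≤ ∫⁻ _ in Ioc (0 : ℝ) 1, ‖z‖ₑ * (eLpNorm β 2 volume * eLpNorm (fderiv ℝ v) 2 volume) := by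
        refine lintegral_mono fun t => ?_
        rw [lintegral_const_mul' _ _ enorm_ne_top]
        refine mul_le_mul_right ?_ _
        have hmp := measurePreserving_add_right (volume : Measure R3) (t • z)
        have := eLpNorm_comp_measurePreserving (p := 2) hcont.aestronglyMeasurable hmp
        rw [← this]
        exact lintegral_enorm_mul_enorm_le 2 2 hβ.aestronglyMeasurable
          (Continuous.aestronglyMeasurable (by fun_prop))
    _ = _ := by simp

end Tools

/-! ### Mollification -/

section Mollifier

/-- `η` is an even mollifier at scale `ε`: a smooth probability density supported in the closed
ball of radius `ε`, whose size and gradient obey the scaling bounds with constant `K`. -/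
structure IsMollifier (K ε : ℝ) (η : R3 → ℝ) : Prop where
  contDiff : ContDiff ℝ ∞ η
  eq_zero : ∀ z, ε < ‖z‖ → η z = 0
  nonneg : ∀ z, 0 ≤ η z
  even : ∀ z, η (-z) = η z
  integral_eq_one : ∫ z, η z = 1
  le : ∀ z, η z ≤ K / ε ^ 3
  norm_fderiv_le : ∀ z, ‖fderiv ℝ η z‖ ≤ K / ε ^ 4

theorem exists_isMollifier : ∃ K : ℝ, 0 ≤ K ∧ ∀ ε : ℝ, 0 < ε → ∃ η, IsMollifier K ε η := by
  let f : ContDiffBump (0 : R3) := ⟨1 / 2, 1, by norm_num, by norm_num⟩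
  set η := f.normed volume with hη
  have hsm : ContDiff ℝ ∞ η := f.contDiff_normed
  have hcs : HasCompactSupport η := f.hasCompactSupport_normed
  obtain ⟨K₁, hK₁⟩ := hsm.continuous.bounded_above_of_compact_support hcs
  obtain ⟨K₂, hK₂⟩ := (hsm.continuous_fderiv (by simp)).bounded_above_of_compact_support
    (hcs.fderiv ℝ)
  refine ⟨max K₁ K₂, (norm_nonneg _).trans ((hK₁ 0).trans (le_max_left _ _)), fun ε hε => ?_⟩
  have hsm' : ContDiff ℝ ∞ fun z : R3 => (ε ^ 3)⁻¹ * η (ε⁻¹ • z) := by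
    exact contDiff_const.mul (hsm.comp (contDiff_const_smul _))
  refine ⟨fun z => (ε ^ 3)⁻¹ * η (ε⁻¹ • z), hsm', ?_, ?_, ?_, ?_, ?_, ?_⟩
  · intro z hz
    have : ε⁻¹ • z ∉ Function.support η := by
      rw [hη, f.support_normed_eq]
      simp only [Metric.mem_ball, dist_zero_right, norm_smul, norm_inv, Real.norm_eq_abs,
        abs_of_pos hε, not_lt]
      change 1 ≤ ε⁻¹ * ‖z‖
      rw [inv_mul_eq_div, le_div_iff₀ hε]
      linarith
    rw [Function.notMem_support.1 this, mul_zero]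
  · intro z
    exact mul_nonneg (by positivity) (f.nonneg_normed _)
  · intro z
    rw [smul_neg, hη, f.normed_neg]
  · rw [integral_const_mul, Measure.integral_comp_inv_smul]
    simp only [finrank_euclideanSpace, Fintype.card_fin, smul_eq_mul]
    rw [hη, f.integral_normed, abs_of_pos (by positivity), mul_one]
    exact inv_mul_cancel₀ (by positivity)
  · intro z
    have := (le_abs_self _).trans ((hK₁ (ε⁻¹ • z)).trans (le_max_left K₁ K₂))
    rw [div_eq_inv_mul]
    gcongr
  · intro z
    have hd : HasFDerivAt (fun z : R3 => (ε ^ 3)⁻¹ * η (ε⁻¹ • z))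
        ((ε ^ 3)⁻¹ • (fderiv ℝ η (ε⁻¹ • z)).comp (ε⁻¹ • ContinuousLinearMap.id ℝ R3)) z := by
      have h1 := (hsm.differentiable (by simp) (ε⁻¹ • z)).hasFDerivAt
      have h2 : HasFDerivAt (fun z : R3 => ε⁻¹ • z) (ε⁻¹ • ContinuousLinearMap.id ℝ R3) z :=
        (hasFDerivAt_id z).const_smul ε⁻¹
      exact (h1.comp z h2).const_mul _
    rw [hd.fderiv, ContinuousLinearMap.comp_smul, ContinuousLinearMap.comp_id, smul_smul, norm_smul]
    rw [Real.norm_of_nonneg (by positivity), div_eq_inv_mul]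
    have h3 := (hK₂ (ε⁻¹ • z)).trans (le_max_right K₁ K₂)
    have h4 : (ε ^ 3)⁻¹ * ε⁻¹ = (ε ^ 4)⁻¹ := by rw [← mul_inv]; ring
    rw [h4]
    gcongr

variable {K ε : ℝ} {η : R3 → ℝ}

namespace IsMollifier

theorem contDiff_one (hη : IsMollifier K ε η) : ContDiff ℝ 1 η := hη.contDiff.of_le (by simp)

theorem tsupport_subset (hη : IsMollifier K ε η) : tsupport η ⊆ Metric.closedBall 0 ε := by
  refine closure_minimal (fun z hz => ?_) Metric.isClosed_closedBall
  by_contra h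
  exact hz (hη.eq_zero z (by simpa using h))

theorem hasCompactSupport (hη : IsMollifier K ε η) : HasCompactSupport η :=
  (isCompact_closedBall _ _).of_isClosed_subset (isClosed_tsupport _) hη.tsupport_subset

theorem continuous_fderiv (hη : IsMollifier K ε η) : Continuous (fderiv ℝ η) :=
  hη.contDiff.continuous_fderiv (by simp)

theorem fderiv_eq_zero (hη : IsMollifier K ε η) {z : R3} (hz : ε < ‖z‖) : fderiv ℝ η z = 0 := by
  by_contra h
  have := hη.tsupport_subset (support_fderiv_subset ℝ (Function.mem_support.2 h))
  simp at this
  linarith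

theorem fderiv_neg (hη : IsMollifier K ε η) (z : R3) : fderiv ℝ η (-z) = - fderiv ℝ η z := by
  have h1 : HasFDerivAt η (fderiv ℝ η (-z)) (-z) :=
    (hη.contDiff.differentiable (by simp) (-z)).hasFDerivAt
  have h2 : HasFDerivAt (fun z => η (-z)) (-fderiv ℝ η (-z)) z := by
    have := h1.comp z (hasFDerivAt_id z).neg
    refine this.congr_fderiv ?_
    ext v
    simp
  rw [show (fun z => η (-z)) = η from funext hη.even] at h2
  rw [h2.fderiv, neg_neg]

end IsMollifier

/-- The mollification `η * f` of a locally integrable function. -/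
noncomputable def mollify (η f : R3 → ℝ) (x : R3) : ℝ := ∫ y, f y * η (x - y)

theorem mollify_eq_convolution (η f : R3 → ℝ) :
    mollify η f = convolution f η (ContinuousLinearMap.lsmul ℝ ℝ) volume := rfl

theorem contDiff_mollify (hη : IsMollifier K ε η) {f : R3 → ℝ} (hf : LocallyIntegrable f) :
    ContDiff ℝ ∞ (mollify η f) := by
  rw [mollify_eq_convolution]
  exact hη.hasCompactSupport.contDiff_convolution_right _ hf hη.contDiff

theorem fderiv_mollify (hη : IsMollifier K ε η) {f : R3 → ℝ} (hf : LocallyIntegrable f)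
    (x w : R3) : fderiv ℝ (mollify η f) x w = ∫ y, f y * fderiv ℝ η (x - y) w := by
  have h := hη.hasCompactSupport.hasFDerivAt_convolution_right (ContinuousLinearMap.lsmul ℝ ℝ) hf
    hη.contDiff_one x
  rw [mollify_eq_convolution, h.fderiv, convolution_precompR_apply _ hf
    (hη.hasCompactSupport.fderiv ℝ) hη.continuous_fderiv]
  rfl

theorem hasCompactSupport_mollify (hη : IsMollifier K ε η) {f : R3 → ℝ}
    (hf : HasCompactSupport f) : HasCompactSupport (mollify η f) := by
  rw [mollify_eq_convolution]
  exact HasCompactSupport.convolution _ hf hη.hasCompactSupport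

/-- A bounded measurable function times a compactly supported continuous one is integrable. -/
theorem integrable_bdd_mul_of_hasCompactSupport {f g : R3 → ℝ} {M : ℝ} (hf : Measurable f)
    (hM : ∀ x, |f x| ≤ M) (hg : Continuous g) (hc : HasCompactSupport g) :
    Integrable fun x => f x * g x :=
  (hg.integrable_of_hasCompactSupport hc).bdd_mul hf.aestronglyMeasurable
    (Eventually.of_forall fun x => by simpa using hM x)

theorem locallyIntegrable_of_bdd {f : R3 → ℝ} {M : ℝ} (hf : Measurable f)
    (hM : ∀ x, |f x| ≤ M) : LocallyIntegrable f := by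
  refine (locallyIntegrable_const (M : ℝ)).mono hf.aestronglyMeasurable
    (Eventually.of_forall fun x => ?_)
  exact (hM x).trans (le_abs_self M)

theorem HasCompactSupport.comp_sub_right {F : Type*} [Zero F] {g : R3 → F}
    (hg : HasCompactSupport g) (x : R3) : HasCompactSupport fun y => g (y - x) :=
  hg.comp_homeomorph (Homeomorph.subRight x)

theorem HasCompactSupport.comp_sub_left {F : Type*} [Zero F] {g : R3 → F}
    (hg : HasCompactSupport g) (x : R3) : HasCompactSupport fun y => g (x - y) :=
  hg.comp_homeomorph (Homeomorph.subLeft x)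

/-- Mollification preserves two-sided bounds `0 ≤ f ≤ M`. -/
theorem mollify_mem_Icc (hη : IsMollifier K ε η) {f : R3 → ℝ} {M : ℝ} (hf : Measurable f)
    (h0 : ∀ x, 0 ≤ f x) (hM : ∀ x, f x ≤ M) (x : R3) : mollify η f x ∈ Icc 0 M := by
  have hi : Integrable fun y => η (x - y) :=
    (hη.contDiff.continuous.comp (by fun_prop)).integrable_of_hasCompactSupport
      (HasCompactSupport.comp_sub_left hη.hasCompactSupport x)
  refine ⟨integral_nonneg fun y => mul_nonneg (h0 y) (hη.nonneg _), ?_⟩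
  calc mollify η f x ≤ ∫ y, M * η (x - y) := by
        refine integral_mono (integrable_bdd_mul_of_hasCompactSupport hf (M := M) ?_ ?_ ?_)
          (hi.const_mul M) fun y => ?_
        · exact fun y => abs_le.2 ⟨by linarith [h0 y, hM y], hM y⟩
        · exact hη.contDiff.continuous.comp (by fun_prop)
        · exact HasCompactSupport.comp_sub_left hη.hasCompactSupport x
        · exact mul_le_mul_of_nonneg_right (hM y) (hη.nonneg _)
    _ = M := by
        rw [integral_const_mul, integral_sub_left_eq_self (fun y => η y) volume x,
          hη.integral_eq_one, mul_one]

/-- At a Lebesgue point, kernels of size `ε⁻³` supported in balls of radius `ε` see only the value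
at the point. -/
theorem ae_tendsto_integral_mul_sub {f : R3 → ℝ} (hf : LocallyIntegrable f) :
    ∀ᵐ x, ∀ (ε : ℕ → ℝ) (k : ℕ → R3 → ℝ) (C : ℝ), Tendsto ε atTop (𝓝[>] 0) →
      (∀ j y, ε j < ‖y - x‖ → k j y = 0) → (∀ j y, |k j y| ≤ C / ε j ^ 3) →
      Tendsto (fun j => ∫ y, k j y * (f y - f x)) atTop (𝓝 0) := by
  filter_upwards [ae_tendsto_inv_cube_mul_integral hf] with x hx ε k C hε hk hC
  have h := (hx ε hε).const_mul C
  rw [mul_zero] at h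
  refine squeeze_zero_norm (fun j => ?_) h
  have h1 : ∫ y, k j y * (f y - f x) =
      ∫ y in Metric.closedBall x (ε j), k j y * (f y - f x) := by
    refine (setIntegral_eq_integral_of_forall_compl_eq_zero fun y hy => ?_).symm
    rw [hk j y (by rw [Metric.mem_closedBall, dist_eq_norm] at hy; linarith), zero_mul]
  have hint : IntegrableOn (fun y => f y - f x) (Metric.closedBall x (ε j)) :=
    (hf.integrableOn_isCompact (isCompact_closedBall _ _)).sub
      (integrableOn_const measure_closedBall_lt_top.ne)
  rw [h1, ← mul_assoc, ← div_eq_mul_inv, ← integral_const_mul]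
  refine norm_integral_le_of_norm_le (hint.abs.const_mul _) (Eventually.of_forall fun y => ?_)
  rw [norm_mul, Real.norm_eq_abs, Real.norm_eq_abs]
  exact mul_le_mul_of_nonneg_right (hC j y) (abs_nonneg _)

/-- Mollifications converge at almost every point. -/
theorem ae_tendsto_mollify {f : R3 → ℝ} (hf : LocallyIntegrable f) {ε : ℕ → ℝ} {η : ℕ → R3 → ℝ}
    (hη : ∀ j, IsMollifier K (ε j) (η j)) (hε : Tendsto ε atTop (𝓝[>] 0)) :
    ∀ᵐ x, Tendsto (fun j => mollify (η j) f x) atTop (𝓝 (f x)) := by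
  filter_upwards [ae_tendsto_integral_mul_sub hf] with x hx
  have h := hx ε (fun j y => η j (x - y)) K hε
    (fun j y hy => (hη j).eq_zero _ (by rwa [norm_sub_rev]))
    (fun j y => by rw [abs_of_nonneg ((hη j).nonneg _)]; exact (hη j).le _)
  have h2 : ∀ j, ∫ y, η j (x - y) * (f y - f x) = mollify (η j) f x - f x := fun j => by
    have hc : Continuous fun y => η j (x - y) := (hη j).contDiff.continuous.comp (by fun_prop)
    have hs := HasCompactSupport.comp_sub_left (hη j).hasCompactSupport x
    have i1 : Integrable fun y => f y * η j (x - y) :=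
      hf.integrable_smul_right_of_hasCompactSupport hc hs
    have i2 : Integrable fun y => f x * η j (x - y) :=
      (hc.integrable_of_hasCompactSupport hs).const_mul _
    calc ∫ y, η j (x - y) * (f y - f x) = ∫ y, (f y * η j (x - y) - f x * η j (x - y)) := by
          refine integral_congr_ae (Eventually.of_forall fun y => ?_)
          simp only
          ring
      _ = _ := by
          rw [integral_sub i1 i2, integral_const_mul, integral_sub_left_eq_self (η j) volume x,
            (hη j).integral_eq_one, mul_one]
          rfl
  simp_rw [h2] at h
  simpa using h.add_const (f x)

end Mollifier

/-! ### The commutator of mollification and transport -/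

section Commutator

variable {K ε M : ℝ} {η ρ β : R3 → ℝ} {v : R3 → R3}

/-- The commutator `v · ∇(η * ρ) - η * div(ρ v)`, up to sign, written as a singular integral of the
increments of `v`. -/
noncomputable def commutator (η ρ : R3 → ℝ) (v : R3 → R3) (x : R3) : ℝ :=
  ∫ y, ρ y * fderiv ℝ η (y - x) (v y - v x)

theorem integrable_mul_fderiv_sub (hη : IsMollifier K ε η) (hρ : Measurable ρ)
    (hM : ∀ x, |ρ x| ≤ M) {w : R3 → R3} (hw : Continuous w) (x : R3) :
    Integrable fun y => ρ y * fderiv ℝ η (y - x) (w y) := by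
  refine integrable_bdd_mul_of_hasCompactSupport hρ hM ?_ ?_
  · exact (hη.continuous_fderiv.comp (by fun_prop)).clm_apply hw
  · refine (HasCompactSupport.comp_sub_right (hη.hasCompactSupport.fderiv ℝ) x).mono fun y hy => ?_
    intro h
    apply hy
    simp only at h
    simp [h]

/-- Testing the flux `ρ v` with the gradient of a mollified function produces the commutator and
the gradient of the mollified density. -/
theorem integral_mul_fderiv_mollify (hη : IsMollifier K ε η) (hρ : Measurable ρ)
    (hM : ∀ x, |ρ x| ≤ M) (hβ : Continuous β) (hβc : HasCompactSupport β)
    (hv : Continuous v) (hvc : HasCompactSupport v) :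
    ∫ y, ρ y * fderiv ℝ (mollify η β) y (v y) =
      (∫ x, β x * commutator η ρ v x) - ∫ x, β x * fderiv ℝ (mollify η ρ) x (v x) := by
  have hρl := locallyIntegrable_of_bdd hρ hM
  have hbd : Integrable (fun z : R3 × R3 => ρ z.1 * (β z.2 * fderiv ℝ η (z.1 - z.2) (v z.1)))
      (volume.prod volume) := by
    have h1 : Integrable (fun z : R3 × R3 => ‖v z.1‖ * ‖β z.2‖) (volume.prod volume) :=
      (hv.integrable_of_hasCompactSupport hvc).norm.mul_prod
        (hβ.integrable_of_hasCompactSupport hβc).norm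
    refine (h1.const_mul (M * (K / ε ^ 4))).mono' ?_ (Eventually.of_forall fun z => ?_)
    · refine ((hρ.comp measurable_fst).mul (Continuous.measurable ?_)).aestronglyMeasurable
      exact (hβ.comp continuous_snd).mul
        ((hη.continuous_fderiv.comp (by fun_prop)).clm_apply (hv.comp continuous_fst))
    · rw [norm_mul, norm_mul]
      have h2 : ‖fderiv ℝ η (z.1 - z.2) (v z.1)‖ ≤ K / ε ^ 4 * ‖v z.1‖ :=
        (ContinuousLinearMap.le_opNorm _ _).trans
          (mul_le_mul_of_nonneg_right (hη.norm_fderiv_le _) (norm_nonneg _))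
      calc ‖ρ z.1‖ * (‖β z.2‖ * ‖fderiv ℝ η (z.1 - z.2) (v z.1)‖)
          ≤ M * (‖β z.2‖ * (K / ε ^ 4 * ‖v z.1‖)) := by
            gcongr
            · exact (norm_nonneg (ρ 0)).trans (hM 0)
            · exact hM _
        _ = _ := by ring
  have hinner : ∀ x, ∫ y, ρ y * (β x * fderiv ℝ η (y - x) (v y)) =
      β x * commutator η ρ v x - β x * fderiv ℝ (mollify η ρ) x (v x) := fun x => by
    have h1 : ∀ y, ρ y * (β x * fderiv ℝ η (y - x) (v y)) =
        β x * (ρ y * fderiv ℝ η (y - x) (v y - v x) - ρ y * fderiv ℝ η (x - y) (v x)) := fun y => by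
      rw [← neg_sub y x, hη.fderiv_neg, map_sub]
      simp only [neg_apply]
      ring
    simp_rw [h1]
    rw [integral_const_mul, integral_sub, ← fderiv_mollify hη hρl, commutator, mul_sub]
    · exact integrable_mul_fderiv_sub hη hρ hM (hv.sub continuous_const) x
    · have h2 := (integrable_mul_fderiv_sub hη hρ hM (continuous_const (y := v x)) x).neg
      refine h2.congr (Eventually.of_forall fun y => ?_)
      simp only [Pi.neg_apply]
      rw [← neg_sub y x, hη.fderiv_neg]
      simp
  have h3 : Integrable fun x => β x * fderiv ℝ (mollify η ρ) x (v x) := by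
    refine Continuous.integrable_of_hasCompactSupport ?_ hβc.mul_right
    exact hβ.mul (((contDiff_mollify hη hρl).continuous_fderiv (by simp)).clm_apply hv)
  have h4 : Integrable fun x => β x * commutator η ρ v x := by
    have := hbd.swap.integral_prod_left.add h3
    refine this.congr (Eventually.of_forall fun x => ?_)
    have := hinner x
    simp only [Pi.add_apply, Function.comp_apply, Prod.swap_prod_mk] at this ⊢
    rw [this]
    ring
  calc ∫ y, ρ y * fderiv ℝ (mollify η β) y (v y)
      = ∫ y, ∫ x, ρ y * (β x * fderiv ℝ η (y - x) (v y)) := by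
        refine integral_congr_ae (Eventually.of_forall fun y => ?_)
        simp only
        rw [fderiv_mollify hη (hβ.locallyIntegrable), integral_const_mul]
    _ = ∫ x, ∫ y, ρ y * (β x * fderiv ℝ η (y - x) (v y)) := integral_integral_swap hbd
    _ = _ := by
        simp_rw [hinner]
        rw [integral_sub h4 h3]

/-- The commutator is bounded in `L²` by the gradient of the velocity, uniformly in the scale of
mollification: the factor `ε⁻⁴` of `∇η` is compensated by the volume `ε³` and by the size `ε` of
the increments. -/
theorem enorm_integral_mul_commutator_le (hε : 0 < ε) (hK : 0 ≤ K) (hη : IsMollifier K ε η)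
    (hM : ∀ x, |ρ x| ≤ M) (hβ : Continuous β)
    (hv : ContDiff ℝ 1 v) :
    ‖∫ x, β x * commutator η ρ v x‖ₑ ≤
      ENNReal.ofReal (M * K) * volume (Metric.ball (0 : R3) 1) *
        (eLpNorm β 2 volume * eLpNorm (fderiv ℝ v) 2 volume) := by
  set N := eLpNorm β 2 volume * eLpNorm (fderiv ℝ v) 2 volume
  have hM0 : 0 ≤ M := (abs_nonneg _).trans (hM 0)
  have h1 : ∀ x, ‖commutator η ρ v x‖ₑ ≤
      ∫⁻ z in Metric.closedBall (0 : R3) ε, ENNReal.ofReal (M * (K / ε ^ 4)) * ‖v (x + z) - v x‖ₑ :=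
      fun x => by
    refine (enorm_integral_le_lintegral_enorm _).trans ?_
    rw [← lintegral_add_left_eq_self _ x, ← lintegral_indicator Metric.isClosed_closedBall.measurableSet]
    refine lintegral_mono fun z => ?_
    simp only [add_sub_cancel_left]
    by_cases hz : z ∈ Metric.closedBall (0 : R3) ε
    · rw [indicator_of_mem hz, ENNReal.ofReal_mul hM0, enorm_mul, mul_assoc]
      refine mul_le_mul' ?_ ?_
      · rw [Real.enorm_eq_ofReal_abs]
        exact ENNReal.ofReal_le_ofReal (hM _)
      · refine (ContinuousLinearMap.le_opENorm _ _).trans ?_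
        refine mul_le_mul' ?_ le_rfl
        rw [← ofReal_norm]
        exact ENNReal.ofReal_le_ofReal (hη.norm_fderiv_le _)
    · rw [hη.fderiv_eq_zero (by simpa using hz)]
      simp
  have hvm := hv.continuous
  calc ‖∫ x, β x * commutator η ρ v x‖ₑ
      ≤ ∫⁻ x, ‖β x * commutator η ρ v x‖ₑ := enorm_integral_le_lintegral_enorm _
    _ ≤ ∫⁻ x, ∫⁻ z in Metric.closedBall (0 : R3) ε,
          ENNReal.ofReal (M * (K / ε ^ 4)) * (‖β x‖ₑ * ‖v (x + z) - v x‖ₑ) := by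
        refine lintegral_mono fun x => ?_
        rw [enorm_mul]
        refine (mul_le_mul' le_rfl (h1 x)).trans (le_of_eq ?_)
        rw [← lintegral_const_mul' _ _ enorm_ne_top]
        refine lintegral_congr fun z => ?_
        ring
    _ = ∫⁻ z in Metric.closedBall (0 : R3) ε, ∫⁻ x,
          ENNReal.ofReal (M * (K / ε ^ 4)) * (‖β x‖ₑ * ‖v (x + z) - v x‖ₑ) := by
        refine lintegral_lintegral_swap (Measurable.aemeasurable ?_)
        refine measurable_const.mul ((hβ.measurable.comp measurable_fst).enorm.mul ?_)
        exact (Continuous.measurable (by fun_prop)).enorm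
    _ ≤ ∫⁻ z in Metric.closedBall (0 : R3) ε,
          ENNReal.ofReal (M * (K / ε ^ 4)) * (ENNReal.ofReal ε * N) := by
        refine setLIntegral_mono' Metric.isClosed_closedBall.measurableSet fun z hz => ?_
        rw [lintegral_const_mul' _ _ ENNReal.ofReal_ne_top]
        refine mul_le_mul' le_rfl ((lintegral_mul_enorm_sub_le hv hβ.measurable z).trans ?_)
        refine mul_le_mul' ?_ le_rfl
        rw [← ofReal_norm]
        exact ENNReal.ofReal_le_ofReal (by simpa using hz)
    _ = _ := by
        rw [setLIntegral_const, Measure.addHaar_closedBall _ _ hε.le]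
        simp only [finrank_euclideanSpace, Fintype.card_fin]
        have : ENNReal.ofReal (M * K) = ENNReal.ofReal (M * (K / ε ^ 4)) * ENNReal.ofReal ε *
            ENNReal.ofReal (ε ^ 3) := by
          rw [← ENNReal.ofReal_mul (by positivity), ← ENNReal.ofReal_mul (by positivity)]
          congr 1
          field_simp
        rw [this]
        ring

theorem abs_commutator_le (hε : 0 < ε) (hK : 0 ≤ K) (hη : IsMollifier K ε η)
    (hM : ∀ x, |ρ x| ≤ M) {L : NNReal} (hv : LipschitzWith L v) (x : R3) :
    |commutator η ρ v x| ≤ M * K * L * volume.real (Metric.ball (0 : R3) 1) := by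
  have hM0 : 0 ≤ M := (abs_nonneg _).trans (hM 0)
  have h1 : commutator η ρ v x =
      ∫ y in Metric.closedBall x ε, ρ y * fderiv ℝ η (y - x) (v y - v x) := by
    refine (setIntegral_eq_integral_of_forall_compl_eq_zero fun y hy => ?_).symm
    rw [hη.fderiv_eq_zero (by simpa [dist_eq_norm] using hy)]
    simp
  have h2 := norm_setIntegral_le_of_norm_le_const (μ := volume) (s := Metric.closedBall x ε)
    (f := fun y => ρ y * fderiv ℝ η (y - x) (v y - v x)) (C := M * (K / ε ^ 4 * (L * ε)))
    measure_closedBall_lt_top (fun y hy => by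
      rw [norm_mul]
      refine mul_le_mul (hM y) ?_ (norm_nonneg _) hM0
      refine (ContinuousLinearMap.le_opNorm _ _).trans ?_
      refine mul_le_mul (hη.norm_fderiv_le _) ?_ (norm_nonneg _) (by positivity)
      refine (hv.norm_sub_le y x).trans ?_
      rw [Metric.mem_closedBall, dist_eq_norm] at hy
      gcongr)
  rw [← h1, Measure.addHaar_real_closedBall _ _ hε.le] at h2
  refine h2.trans (le_of_eq ?_)
  simp only [finrank_euclideanSpace, Fintype.card_fin]
  field_simp

/-- For a smooth velocity the commutator converges to `-ρ div v` almost everywhere. -/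
theorem ae_tendsto_commutator (hK : 0 ≤ K) {e : ℕ → ℝ} {η : ℕ → R3 → ℝ} (he : ∀ j, 0 < e j)
    (hη : ∀ j, IsMollifier K (e j) (η j)) (hlim : Tendsto e atTop (𝓝 0))
    (hρ : Measurable ρ) (hM : ∀ x, |ρ x| ≤ M)
    (hv : ContDiff ℝ 1 v) (hvc : HasCompactSupport v) :
    ∀ᵐ x, Tendsto (fun j => commutator (η j) ρ v x) atTop
      (𝓝 (- (ρ x * (jac (fderiv ℝ v x)).trace))) := by
  have hlim' : Tendsto e atTop (𝓝[>] 0) :=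
    tendsto_nhdsWithin_iff.2 ⟨hlim, Eventually.of_forall he⟩
  obtain ⟨L, hL⟩ := hv.lipschitzWith_of_hasCompactSupport hvc one_ne_zero
  have hd : Continuous fun x => (jac (fderiv ℝ v x)).trace :=
    traceCLM.continuous.comp (hv.continuous_fderiv one_ne_zero)
  filter_upwards [ae_tendsto_integral_mul_sub (locallyIntegrable_of_bdd hρ hM),
    ae_tendsto_mollify hd.locallyIntegrable hη hlim'] with x hx hx2
  have t1 := hx e (fun j y => fderiv ℝ (η j) (y - x) (v y - v x)) (K * L) hlim'
    (fun j y hy => by simp [(hη j).fderiv_eq_zero hy])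
    (fun j y => by
      have hej := he j
      by_cases hy : e j < ‖y - x‖
      · simp only [(hη j).fderiv_eq_zero hy, zero_apply, abs_zero]
        positivity
      · calc |fderiv ℝ (η j) (y - x) (v y - v x)|
            ≤ ‖fderiv ℝ (η j) (y - x)‖ * ‖v y - v x‖ :=
              (fderiv ℝ (η j) (y - x)).le_opNorm _
          _ ≤ K / e j ^ 4 * (L * e j) := by
              refine mul_le_mul ((hη j).norm_fderiv_le _) ?_ (norm_nonneg _) (by positivity)
              refine (hL.norm_sub_le y x).trans ?_
              rw [not_lt] at hy
              gcongr
          _ = K * L / e j ^ 3 := by field_simp)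
  have t2 := (hx2.const_mul (ρ x)).neg
  have t3 := t1.add t2
  rw [zero_add] at t3
  refine t3.congr fun j => ?_
  have hηx : ContDiff ℝ 1 fun y => η j (y - x) := (hη j).contDiff_one.comp (by fun_prop)
  have hder : ∀ y, fderiv ℝ (fun y => η j (y - x)) y = fderiv ℝ (η j) (y - x) := fun y => by
    exact (((hη j).contDiff_one.differentiable one_ne_zero (y - x)).hasFDerivAt.comp y
      ((hasFDerivAt_id y).sub_const x)).fderiv
  have hibp := integral_fderiv_apply_eq_neg hηx (hv.sub (contDiff_const (c := v x)))
    (Or.inl (HasCompactSupport.comp_sub_right (hη j).hasCompactSupport x))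
  simp_rw [hder, fderiv_sub_const] at hibp
  have hmol : mollify (η j) (fun x => (jac (fderiv ℝ v x)).trace) x =
      ∫ y, η j (y - x) * (jac (fderiv ℝ v y)).trace := by
    refine integral_congr_ae (Eventually.of_forall fun y => ?_)
    simp only
    rw [← neg_sub y x, (hη j).even, mul_comm]
  rw [hmol, ← mul_neg, ← hibp, ← integral_const_mul, ← integral_add]
  · refine integral_congr_ae (Eventually.of_forall fun y => ?_)
    simp only
    ring
  · have i1 := integrable_mul_fderiv_sub (hη j) hρ hM (hv.continuous.sub (continuous_const (y := v x))) x
    have i2 := integrable_mul_fderiv_sub (hη j) (measurable_const (a := ρ x)) (fun _ => le_rfl)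
      (hv.continuous.sub (continuous_const (y := v x))) x
    refine (i1.sub i2).congr (Eventually.of_forall fun y => ?_)
    simp only [Pi.sub_apply]
    ring
  · exact integrable_mul_fderiv_sub (hη j) (measurable_const (a := ρ x)) (fun _ => le_rfl)
      (hv.continuous.sub (continuous_const (y := v x))) x

end Commutator

/-! ### The renormalized continuity equation -/

section Renormalization

/-- Convergence of integrals whose integrands differ by at most a fixed `Lᵖ` function times a
sequence tending to zero in the dual space. -/
theorem tendsto_integral_of_holder {α E F : Type*} [MeasurableSpace α] {ν : Measure α}
    [NormedAddCommGroup E] [NormedAddCommGroup F] (p q : ℝ≥0∞) [ENNReal.HolderConjugate p q]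
    {h : α → E} (hh : MemLp h p ν) {d : ℕ → α → F} (hd : ∀ n, AEStronglyMeasurable (d n) ν)
    (hd0 : Tendsto (fun n => eLpNorm (d n) q ν) atTop (𝓝 0)) {f : α → ℝ} {f' : ℕ → α → ℝ}
    (hf : AEStronglyMeasurable f ν) (hf' : ∀ n, Integrable (f' n) ν)
    (hle : ∀ n, ∀ᵐ x ∂ν, |f' n x - f x| ≤ ‖h x‖ * ‖d n x‖) :
    Tendsto (fun n => ∫ x, f' n x ∂ν) atTop (𝓝 (∫ x, f x ∂ν)) := by
  refine tendsto_integral_of_L1 f hf (Eventually.of_forall hf') ?_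
  have h0 : Tendsto (fun n => eLpNorm h p ν * eLpNorm (d n) q ν) atTop (𝓝 0) := by
    simpa using ENNReal.Tendsto.const_mul hd0 (Or.inr hh.2.ne)
  refine tendsto_of_tendsto_of_tendsto_of_le_of_le tendsto_const_nhds h0 (fun _ => zero_le)
    fun n => ?_
  refine (lintegral_mono_ae ?_).trans (lintegral_enorm_mul_enorm_le p q hh.1 (hd n))
  filter_upwards [hle n] with x hx
  rw [← ofReal_norm, ← ofReal_norm, ← ofReal_norm, ← ENNReal.ofReal_mul (norm_nonneg _)]
  exact ENNReal.ofReal_le_ofReal hx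

instance holderConjugate_six_fifths : ENNReal.HolderConjugate (6 / 5) 6 where
  inv_add_inv_eq_inv := by
    rw [ENNReal.inv_div (Or.inl (by simp)) (Or.inl (by simp)), inv_one,
      ← ENNReal.toReal_eq_toReal_iff' (by finiteness) (by simp),
      ENNReal.toReal_add (by finiteness) (by simp)]
    norm_num

variable {K ε M : ℝ} {η ρ φ : R3 → ℝ} {v : R3 → R3} {b b' : ℝ → ℝ}

theorem trace_jac_fderiv_smul {x : R3} (hφ : DifferentiableAt ℝ φ x)
    (hv : DifferentiableAt ℝ v x) :
    (jac (fderiv ℝ (fun x => φ x • v x) x)).trace =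
      fderiv ℝ φ x (v x) + φ x * (jac (fderiv ℝ v x)).trace := by
  rw [fderiv_fun_smul hφ hv, apply_eq_sum (fderiv ℝ φ x)]
  simp only [jac, Matrix.trace, Matrix.diag, Matrix.of_apply, Finset.mul_sum,
    ← Finset.sum_add_distrib]
  refine Finset.sum_congr rfl fun i _ => ?_
  simp
  ring

/-- The regularized renormalized equation: the flux `ρ v`, tested with the mollification of
`b'(ρ_ε) φ`, equals the renormalized flux of `b(ρ_ε)` plus a commutator. -/
theorem integral_flux_mollify_eq (hη : IsMollifier K ε η) (hρ : Measurable ρ)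
    (hM : ∀ x, |ρ x| ≤ M) (hb' : Continuous b') (hb : ∀ s, HasDerivAt b (b' s) s)
    (hφ : ContDiff ℝ 1 φ) (hφc : HasCompactSupport φ) (hv : ContDiff ℝ 1 v)
    (hvc : HasCompactSupport v) :
    ∫ y, ρ y * fderiv ℝ (mollify η fun x => b' (mollify η ρ x) * φ x) y (v y) =
      (∫ x, b' (mollify η ρ x) * φ x * commutator η ρ v x) +
        ∫ x, b (mollify η ρ x) * (fderiv ℝ φ x (v x) + φ x * (jac (fderiv ℝ v x)).trace) := by
  have hm : ContDiff ℝ 1 (mollify η ρ) :=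
    (contDiff_mollify hη (locallyIntegrable_of_bdd hρ hM)).of_le (by simp)
  have hb1 : ContDiff ℝ 1 b := by
    rw [contDiff_one_iff_deriv]
    refine ⟨fun s => (hb s).differentiableAt, ?_⟩
    rwa [show deriv b = b' from funext fun s => (hb s).deriv]
  have hβc : HasCompactSupport fun x => b' (mollify η ρ x) * φ x :=
    HasCompactSupport.mul_left (f := fun x => b' (mollify η ρ x)) (f' := φ) hφc
  have hwc : HasCompactSupport fun x => φ x • v x :=
    HasCompactSupport.smul_left (f := φ) (f' := v) hvc
  have hbm : ContDiff ℝ 1 fun x => b (mollify η ρ x) := hb1.comp hm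
  have h1 := integral_mul_fderiv_mollify (β := fun x => b' (mollify η ρ x) * φ x) hη hρ hM
    ((hb'.comp hm.continuous).mul hφ.continuous) hβc hv.continuous hvc
  have h2 : ∫ x, fderiv ℝ (fun x => b (mollify η ρ x)) x (φ x • v x) =
      - ∫ x, b (mollify η ρ x) * (jac (fderiv ℝ (fun x => φ x • v x) x)).trace :=
    integral_fderiv_apply_eq_neg hbm (hφ.smul hv) (Or.inr hwc)
  have h3 : ∀ x, fderiv ℝ (fun x => b (mollify η ρ x)) x (φ x • v x) =
      b' (mollify η ρ x) * φ x * fderiv ℝ (mollify η ρ) x (v x) := fun x => by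
    have h4 := (hb (mollify η ρ x)).comp_hasFDerivAt x
      (hm.differentiable one_ne_zero x).hasFDerivAt
    rw [show (fun x => b (mollify η ρ x)) = b ∘ mollify η ρ from rfl, h4.fderiv]
    simp only [smul_apply, map_smul, smul_eq_mul]
    ring
  simp_rw [h3] at h2
  rw [h1, h2, sub_neg_eq_add]
  congr 1
  refine integral_congr_ae (Eventually.of_forall fun x => ?_)
  simp only
  rw [trace_jac_fderiv_smul (hφ.differentiable one_ne_zero x) (hv.differentiable one_ne_zero x)]

theorem exists_bound_on_Icc {f : ℝ → ℝ} (hf : Continuous f) (M : ℝ) :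
    ∃ B : ℝ, 0 ≤ B ∧ ∀ s ∈ Icc 0 M, |f s| ≤ B := by
  obtain ⟨B, hB⟩ := (isCompact_Icc (a := (0 : ℝ)) (b := M)).exists_bound_of_continuousOn
    hf.continuousOn
  exact ⟨max B 0, le_max_right _ _, fun s hs => (hB s hs).trans (le_max_left _ _)⟩

theorem memLp_of_continuous {F : Type*} [NormedAddCommGroup F] {g : R3 → F} (hg : Continuous g)
    (hc : HasCompactSupport g) (p : ℝ≥0∞) : MemLp g p volume :=
  hg.memLp_of_hasCompactSupport hc

/-- The regularized flux functional is bounded in the energy norms of the velocity, uniformly with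
respect to the mollification. -/
theorem exists_enorm_flux_mollify_le (hK : 0 ≤ K) (hρ : Measurable ρ) (h0 : ∀ x, 0 ≤ ρ x)
    (hM : ∀ x, ρ x ≤ M) (hb' : Continuous b') (hb : ∀ s, HasDerivAt b (b' s) s)
    (hφ : ContDiff ℝ 1 φ) (hφc : HasCompactSupport φ) :
    ∃ C : ℝ≥0∞, C ≠ ⊤ ∧ ∀ (ε : ℝ) (η : R3 → ℝ), 0 < ε → IsMollifier K ε η →
      ∀ v : R3 → R3, ContDiff ℝ 1 v → HasCompactSupport v →
      ‖∫ y, ρ y * fderiv ℝ (mollify η fun x => b' (mollify η ρ x) * φ x) y (v y)‖ₑ ≤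
        C * (eLpNorm v 6 volume + eLpNorm (fderiv ℝ v) 2 volume) := by
  have habs : ∀ x, |ρ x| ≤ M := fun x => abs_le.2 ⟨by linarith [h0 x, hM x], hM x⟩
  have hM0 : 0 ≤ M := (h0 0).trans (hM 0)
  have hbc : Continuous b := continuous_iff_continuousAt.2 fun s => (hb s).continuousAt
  obtain ⟨B, hB0, hB⟩ := exists_bound_on_Icc hbc M
  obtain ⟨B', hB'0, hB'⟩ := exists_bound_on_Icc hb' M
  set V := volume (Metric.ball (0 : R3) 1) with hV
  have hV' : V ≠ ⊤ := measure_ball_lt_top.ne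
  have hDφ : Continuous (fderiv ℝ φ) := hφ.continuous_fderiv one_ne_zero
  have n1 := (memLp_of_continuous hφ.continuous hφc 2).2.ne
  have n2 := (memLp_of_continuous hDφ (hφc.fderiv ℝ) (6 / 5)).2.ne
  set C1 := ENNReal.ofReal (M * K) * V * (ENNReal.ofReal B' * eLpNorm φ 2 volume)
  set C2 := ENNReal.ofReal B * eLpNorm (fderiv ℝ φ) (6 / 5) volume
  set C3 := ENNReal.ofReal B * 3 * eLpNorm φ 2 volume
  refine ⟨C1 + C2 + C3, by finiteness, fun ε η hε hη v hv hvc => ?_⟩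
  have hm : ContDiff ℝ 1 (mollify η ρ) :=
    (contDiff_mollify hη (locallyIntegrable_of_bdd hρ habs)).of_le (by simp)
  have hmem := mollify_mem_Icc hη hρ h0 hM
  rw [integral_flux_mollify_eq hη hρ habs hb' hb hφ hφc hv hvc]
  have hDv : Continuous (fderiv ℝ v) := hv.continuous_fderiv one_ne_zero
  have e1 : ‖∫ x, b' (mollify η ρ x) * φ x * commutator η ρ v x‖ₑ ≤
      C1 * eLpNorm (fderiv ℝ v) 2 volume := by
    refine (enorm_integral_mul_commutator_le (β := fun x => b' (mollify η ρ x) * φ x) hε hK hη habs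
      ((hb'.comp hm.continuous).mul hφ.continuous) hv).trans ?_
    rw [mul_assoc, mul_assoc, mul_assoc]
    refine mul_le_mul' le_rfl (mul_le_mul' le_rfl ?_)
    refine mul_le_mul' ?_ le_rfl
    have := eLpNorm_le_mul_eLpNorm_of_ae_le_mul (μ := volume) (p := 2) (c := B')
      (f := fun x => b' (mollify η ρ x) * φ x) (g := φ) (Eventually.of_forall fun x => by
        rw [norm_mul]
        exact mul_le_mul_of_nonneg_right (hB' _ (hmem x)) (norm_nonneg _))
    exact this
  have e2 : ‖∫ x, b (mollify η ρ x) *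
      (fderiv ℝ φ x (v x) + φ x * (jac (fderiv ℝ v x)).trace)‖ₑ ≤
      C2 * eLpNorm v 6 volume + C3 * eLpNorm (fderiv ℝ v) 2 volume := by
    calc _ ≤ ∫⁻ x, ‖b (mollify η ρ x) *
          (fderiv ℝ φ x (v x) + φ x * (jac (fderiv ℝ v x)).trace)‖ₑ :=
          enorm_integral_le_lintegral_enorm _
      _ ≤ ∫⁻ x, (ENNReal.ofReal B * (‖fderiv ℝ φ x‖ₑ * ‖v x‖ₑ) +
            ENNReal.ofReal B * 3 * (‖φ x‖ₑ * ‖fderiv ℝ v x‖ₑ)) := by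
          refine lintegral_mono fun x => ?_
          simp only [← ofReal_norm]
          rw [← ENNReal.ofReal_mul (by positivity), ← ENNReal.ofReal_mul (by positivity),
            ← ENNReal.ofReal_mul (by positivity),
            show (3 : ℝ≥0∞) = ENNReal.ofReal 3 by simp, ← ENNReal.ofReal_mul (by positivity),
            ← ENNReal.ofReal_mul (by positivity), ← ENNReal.ofReal_add (by positivity)
            (by positivity)]
          refine ENNReal.ofReal_le_ofReal ?_
          rw [norm_mul]
          have a1 : ‖fderiv ℝ φ x (v x)‖ ≤ ‖fderiv ℝ φ x‖ * ‖v x‖ :=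
            ContinuousLinearMap.le_opNorm _ _
          have a2 : ‖φ x * (jac (fderiv ℝ v x)).trace‖ ≤ ‖φ x‖ * (3 * ‖fderiv ℝ v x‖) := by
            rw [norm_mul]
            exact mul_le_mul_of_nonneg_left (abs_trace_jac_le _) (norm_nonneg _)
          calc ‖b (mollify η ρ x)‖ * ‖fderiv ℝ φ x (v x) + φ x * (jac (fderiv ℝ v x)).trace‖
              ≤ B * (‖fderiv ℝ φ x‖ * ‖v x‖ + ‖φ x‖ * (3 * ‖fderiv ℝ v x‖)) :=
                mul_le_mul (hB _ (hmem x)) ((norm_add_le _ _).trans (add_le_add a1 a2))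
                  (norm_nonneg _) hB0
            _ = _ := by ring
      _ ≤ _ := by
          have hmeas : Measurable fun x => ENNReal.ofReal B * (‖fderiv ℝ φ x‖ₑ * ‖v x‖ₑ) :=
            measurable_const.mul (hDφ.enorm.measurable.mul hv.continuous.enorm.measurable)
          rw [lintegral_add_left hmeas, lintegral_const_mul' _ _ (by finiteness),
            lintegral_const_mul' _ _ (by finiteness)]
          refine add_le_add ?_ ?_
          · rw [mul_assoc]
            exact mul_le_mul' le_rfl (lintegral_enorm_mul_enorm_le _ _ hDφ.aestronglyMeasurable
              hv.continuous.aestronglyMeasurable)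
          · rw [mul_assoc _ (eLpNorm φ 2 volume)]
            exact mul_le_mul' le_rfl (lintegral_enorm_mul_enorm_le _ _
              hφ.continuous.aestronglyMeasurable hDv.aestronglyMeasurable)
  refine (enorm_add_le _ _).trans ((add_le_add e1 e2).trans ?_)
  rw [mul_add, ← add_assoc, add_comm _ (C2 * _), add_assoc, ← add_mul]
  refine add_le_add (mul_le_mul' ?_ le_rfl) (mul_le_mul' ?_ le_rfl)
  · rw [add_right_comm]; exact le_add_self
  · rw [add_right_comm]; exact le_self_add

theorem stronglyMeasurable_commutator (hη : IsMollifier K ε η) (hρ : Measurable ρ)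
    (hv : Continuous v) : StronglyMeasurable (commutator η ρ v) := by
  refine StronglyMeasurable.integral_prod_right
    (f := fun x y => ρ y * fderiv ℝ η (y - x) (v y - v x)) ?_
  refine Measurable.stronglyMeasurable ?_
  refine (hρ.comp measurable_snd).mul (Continuous.measurable ?_)
  exact (hη.continuous_fderiv.comp (by fun_prop)).clm_apply (by fun_prop)

/-- For a smooth velocity the regularized flux functional converges to the renormalized one. -/
theorem tendsto_flux_mollify (hK : 0 ≤ K) {e : ℕ → ℝ} {η : ℕ → R3 → ℝ} (he : ∀ j, 0 < e j)
    (hη : ∀ j, IsMollifier K (e j) (η j)) (hlim : Tendsto e atTop (𝓝 0))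
    (hρ : Measurable ρ) (h0 : ∀ x, 0 ≤ ρ x) (hM : ∀ x, ρ x ≤ M)
    (hb' : Continuous b') (hb : ∀ s, HasDerivAt b (b' s) s)
    (hφ : ContDiff ℝ 1 φ) (hφc : HasCompactSupport φ)
    (hv : ContDiff ℝ 1 v) (hvc : HasCompactSupport v) :
    Tendsto (fun j => ∫ y, ρ y *
        fderiv ℝ (mollify (η j) fun x => b' (mollify (η j) ρ x) * φ x) y (v y)) atTop
      (𝓝 ((∫ x, b (ρ x) * fderiv ℝ φ x (v x)) +
        ∫ x, (b (ρ x) - b' (ρ x) * ρ x) * φ x * (jac (fderiv ℝ v x)).trace)) := by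
  have habs : ∀ x, |ρ x| ≤ M := fun x => abs_le.2 ⟨by linarith [h0 x, hM x], hM x⟩
  have hρl := locallyIntegrable_of_bdd hρ habs
  have hbc : Continuous b := continuous_iff_continuousAt.2 fun s => (hb s).continuousAt
  obtain ⟨B, hB0, hB⟩ := exists_bound_on_Icc hbc M
  obtain ⟨B', hB'0, hB'⟩ := exists_bound_on_Icc hb' M
  have hmem := fun j => mollify_mem_Icc (hη j) hρ h0 hM
  have hm : ∀ j, Continuous (mollify (η j) ρ) := fun j => (contDiff_mollify (hη j) hρl).continuous
  obtain ⟨L, hL⟩ := hv.lipschitzWith_of_hasCompactSupport hvc one_ne_zero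
  have hDφ : Continuous (fderiv ℝ φ) := hφ.continuous_fderiv one_ne_zero
  have hd : Continuous fun x => (jac (fderiv ℝ v x)).trace :=
    traceCLM.continuous.comp (hv.continuous_fderiv one_ne_zero)
  have hDv : Continuous fun x => fderiv ℝ φ x (v x) := hDφ.clm_apply hv.continuous
  have hDvc : HasCompactSupport fun x => fderiv ℝ φ x (v x) :=
    (hφc.fderiv ℝ).mono fun x hx h => hx (by
      have h : fderiv ℝ φ x = 0 := h
      simp [h])
  have hφd : HasCompactSupport fun x => φ x * (jac (fderiv ℝ v x)).trace := hφc.mul_right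
  have hlim' : Tendsto e atTop (𝓝[>] 0) :=
    tendsto_nhdsWithin_iff.2 ⟨hlim, Eventually.of_forall he⟩
  have hae := ae_tendsto_mollify hρl hη hlim'
  have hφi : Integrable φ := hφ.continuous.integrable_of_hasCompactSupport hφc
  set C := M * K * L * volume.real (Metric.ball (0 : R3) 1)
  have t1 : Tendsto (fun j => ∫ x, b' (mollify (η j) ρ x) * φ x * commutator (η j) ρ v x) atTop
      (𝓝 (∫ x, b' (ρ x) * φ x * (- (ρ x * (jac (fderiv ℝ v x)).trace)))) := by
    refine tendsto_integral_of_dominated_convergence (fun x => B' * ‖φ x‖ * C) (fun j => ?_) ?_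
      (fun j => Eventually.of_forall fun x => ?_) ?_
    · exact (((hb'.comp (hm j)).mul hφ.continuous).aestronglyMeasurable).mul
        (stronglyMeasurable_commutator (hη j) hρ hv.continuous).aestronglyMeasurable
    · exact (hφi.norm.const_mul B').mul_const C
    · rw [norm_mul, norm_mul]
      exact mul_le_mul (mul_le_mul_of_nonneg_right (hB' _ (hmem j x)) (norm_nonneg _))
        (abs_commutator_le (he j) hK (hη j) habs hL x) (norm_nonneg _) (by positivity)
    · filter_upwards [hae, ae_tendsto_commutator hK he hη hlim hρ habs hv hvc] with x h1 h2
      exact (((hb'.tendsto _).comp h1).mul_const _).mul h2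
  have t2 : Tendsto (fun j => ∫ x, b (mollify (η j) ρ x) *
      (fderiv ℝ φ x (v x) + φ x * (jac (fderiv ℝ v x)).trace)) atTop
      (𝓝 (∫ x, b (ρ x) * (fderiv ℝ φ x (v x) + φ x * (jac (fderiv ℝ v x)).trace))) := by
    have hc := hDv.add (hφ.continuous.mul hd)
    refine tendsto_integral_of_dominated_convergence
      (fun x => B * ‖fderiv ℝ φ x (v x) + φ x * (jac (fderiv ℝ v x)).trace‖) (fun j => ?_) ?_
      (fun j => Eventually.of_forall fun x => ?_) ?_
    · exact ((hbc.comp (hm j)).mul hc).aestronglyMeasurable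
    · exact (hc.integrable_of_hasCompactSupport (hDvc.add hφd)).norm.const_mul B
    · rw [norm_mul]
      exact mul_le_mul_of_nonneg_right (hB _ (hmem j x)) (norm_nonneg _)
    · filter_upwards [hae] with x h1
      exact ((hbc.tendsto _).comp h1).mul_const _
  have hmb : ∀ {f : ℝ → ℝ}, Continuous f → Measurable fun x => f (ρ x) := fun hf =>
    hf.measurable.comp hρ
  have i1 : Integrable fun x => b' (ρ x) * φ x * (- (ρ x * (jac (fderiv ℝ v x)).trace)) := by
    have hbd : ∀ x, |b' (ρ x) * ρ x| ≤ B' * M := fun x => by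
      rw [abs_mul]
      exact mul_le_mul (hB' _ ⟨h0 x, hM x⟩) (habs x) (abs_nonneg _) hB'0
    refine (integrable_bdd_mul_of_hasCompactSupport ((hmb hb').mul hρ) hbd
      (hφ.continuous.mul hd) hφd).neg.congr (Eventually.of_forall fun x => ?_)
    simp only [Pi.neg_apply, Pi.mul_apply]
    ring
  have hbB : ∀ x, |b (ρ x)| ≤ B := fun x => hB _ ⟨h0 x, hM x⟩
  have i2 : Integrable fun x => b (ρ x) * (φ x * (jac (fderiv ℝ v x)).trace) :=
    integrable_bdd_mul_of_hasCompactSupport (hmb hbc) hbB (hφ.continuous.mul hd) hφd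
  have i3 : Integrable fun x => b (ρ x) * fderiv ℝ φ x (v x) :=
    integrable_bdd_mul_of_hasCompactSupport (hmb hbc) hbB hDv hDvc
  have heq : (∫ x, b (ρ x) * fderiv ℝ φ x (v x)) +
        ∫ x, (b (ρ x) - b' (ρ x) * ρ x) * φ x * (jac (fderiv ℝ v x)).trace =
      (∫ x, b' (ρ x) * φ x * (- (ρ x * (jac (fderiv ℝ v x)).trace))) +
        ∫ x, b (ρ x) * (fderiv ℝ φ x (v x) + φ x * (jac (fderiv ℝ v x)).trace) := by
    have s1 : ∫ x, (b (ρ x) - b' (ρ x) * ρ x) * φ x * (jac (fderiv ℝ v x)).trace =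
        (∫ x, b (ρ x) * (φ x * (jac (fderiv ℝ v x)).trace)) +
          ∫ x, b' (ρ x) * φ x * (- (ρ x * (jac (fderiv ℝ v x)).trace)) := by
      rw [← integral_add i2 i1]
      refine integral_congr_ae (Eventually.of_forall fun x => ?_)
      simp only
      ring
    simp_rw [mul_add]
    rw [s1, integral_add i3 i2]
    ring
  rw [heq]
  refine (t1.add t2).congr fun j => ?_
  rw [integral_flux_mollify_eq (hη j) hρ habs hb' hb hφ hφc hv hvc]

end Renormalization

section RenormalizedLimit

variable {M : ℝ} {ρ φ : R3 → ℝ} {b b' : ℝ → ℝ} {u : R3 → R3} {A : R3 → R3 →L[ℝ] R3}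
  {w : ℕ → R3 → R3}

/-- The renormalized continuity equation of DiPerna and Lions for a bounded density and a velocity
with square integrable gradient. The uniform estimate of the flux functional reduces it to smooth
velocities, for which the commutator can be computed. -/
theorem integral_renormalized_eq_zero (hρ : Measurable ρ) (h0 : ∀ x, 0 ≤ ρ x)
    (hM : ∀ x, ρ x ≤ M) (hu : AEStronglyMeasurable u) (hA : AEStronglyMeasurable A)
    (hw : ∀ n, IsTestFun ∞ univ (w n))
    (hwu : Tendsto (fun n => eLpNorm (fun x => w n x - u x) 6 volume) atTop (𝓝 0))
    (hwA : Tendsto (fun n => eLpNorm (fun x => fderiv ℝ (w n) x - A x) 2 volume) atTop (𝓝 0))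
    (hmass : ∀ φ : R3 → ℝ, IsTestFun ∞ univ φ → ∫ x, ρ x * fderiv ℝ φ x (u x) = 0)
    (hb' : Continuous b') (hb : ∀ s, HasDerivAt b (b' s) s)
    (hφ : ContDiff ℝ 1 φ) (hφc : HasCompactSupport φ) :
    (∫ x, b (ρ x) * fderiv ℝ φ x (u x)) +
      ∫ x, (b (ρ x) - b' (ρ x) * ρ x) * φ x * (jac (A x)).trace = 0 := by
  have habs : ∀ x, |ρ x| ≤ M := fun x => abs_le.2 ⟨by linarith [h0 x, hM x], hM x⟩
  have hρl := locallyIntegrable_of_bdd hρ habs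
  obtain ⟨K, hK, hmoll⟩ := exists_isMollifier
  set e : ℕ → ℝ := fun j => 1 / ((j : ℝ) + 1) with he_def
  have he : ∀ j, 0 < e j := fun j => by positivity
  have hlim : Tendsto e atTop (𝓝 0) := tendsto_one_div_add_atTop_nhds_zero_nat
  choose η hη using fun j => hmoll (e j) (he j)
  have hw1 : ∀ n, ContDiff ℝ 1 (w n) := fun n => (hw n).contDiff.of_le (by simp)
  have hbc : Continuous b := continuous_iff_continuousAt.2 fun s => (hb s).continuousAt
  obtain ⟨C, hC, hbound⟩ := exists_enorm_flux_mollify_le hK hρ h0 hM hb' hb hφ hφc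
  set ψ : ℕ → R3 → ℝ := fun j => mollify (η j) fun x => b' (mollify (η j) ρ x) * φ x with hψ
  have hβc : ∀ j, HasCompactSupport fun x => b' (mollify (η j) ρ x) * φ x := fun j =>
    HasCompactSupport.mul_left (f := fun x => b' (mollify (η j) ρ x)) (f' := φ) hφc
  have hβ : ∀ j, Continuous fun x => b' (mollify (η j) ρ x) * φ x := fun j =>
    (hb'.comp (contDiff_mollify (hη j) hρl).continuous).mul hφ.continuous
  have hψt : ∀ j, IsTestFun ∞ univ (ψ j) := fun j =>
    ⟨contDiff_mollify (hη j) (hβ j).locallyIntegrable, hasCompactSupport_mollify (hη j) (hβc j),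
      subset_univ _⟩
  have hDψ : ∀ j, Continuous (fderiv ℝ (ψ j)) := fun j =>
    (hψt j).contDiff.continuous_fderiv (by simp)
  have hDψm : ∀ j (p : ℝ≥0∞), MemLp (fun x => M * ‖fderiv ℝ (ψ j) x‖) p := fun j p =>
    ((memLp_of_continuous (hDψ j) ((hψt j).hasCompactSupport.fderiv ℝ) p).norm).const_mul M
  have hM0 : 0 ≤ M := (h0 0).trans (hM 0)
  have hint : ∀ j n, Integrable fun y => ρ y * fderiv ℝ (ψ j) y (w n y) := fun j n => by
    refine integrable_bdd_mul_of_hasCompactSupport hρ habs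
      ((hDψ j).clm_apply (hw n).contDiff.continuous) ?_
    refine ((hψt j).hasCompactSupport.fderiv ℝ).mono fun x hx h => hx ?_
    have h : fderiv ℝ (ψ j) x = 0 := h
    simp [h]
  -- at a fixed scale of mollification, the equation for `u` is the limit of those for `w n`
  have T1 : ∀ j, Tendsto (fun n => ∫ y, ρ y * fderiv ℝ (ψ j) y (w n y)) atTop (𝓝 0) := fun j => by
    rw [← hmass (ψ j) (hψt j)]
    refine tendsto_integral_of_holder (6 / 5) 6 (hDψm j _)
      (fun n => (hw n).contDiff.continuous.aestronglyMeasurable.sub hu) hwu ?_ (hint j) ?_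
    · have : AEStronglyMeasurable (fun x => fderiv ℝ (ψ j) x (u x)) :=
        ((ContinuousLinearMap.id ℝ (R3 →L[ℝ] ℝ)).aestronglyMeasurable_comp₂
          (hDψ j).aestronglyMeasurable hu)
      exact hρ.aestronglyMeasurable.mul this
    · refine fun n => Eventually.of_forall fun x => ?_
      rw [← mul_sub, ← map_sub, abs_mul]
      rw [Real.norm_of_nonneg (mul_nonneg hM0 (norm_nonneg _)), mul_assoc]
      exact mul_le_mul (habs x) ((fderiv ℝ (ψ j) x).le_opNorm (w n x - u x)) (abs_nonneg _) hM0
  set δ : ℕ → ℝ≥0∞ := fun n => eLpNorm (fun x => w n x - u x) 6 volume +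
    eLpNorm (fun x => fderiv ℝ (w n) x - A x) 2 volume with hδ
  have hδ0 : Tendsto δ atTop (𝓝 0) := by simpa using hwu.add hwA
  have hdiff : ∀ n m, eLpNorm (fun x => w n x - w m x) 6 volume +
      eLpNorm (fderiv ℝ fun x => w n x - w m x) 2 volume ≤ δ n + δ m := fun n m => by
    have a1 : eLpNorm (fun x => w n x - w m x) 6 volume ≤
        eLpNorm (fun x => w n x - u x) 6 volume + eLpNorm (fun x => w m x - u x) 6 volume := by
      have := eLpNorm_sub_le (p := 6)
        ((hw n).contDiff.continuous.aestronglyMeasurable.sub hu)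
        ((hw m).contDiff.continuous.aestronglyMeasurable.sub hu) (by norm_num)
      refine le_trans (le_of_eq ?_) this
      congr 1
      ext1 x
      simp
    have a2 : eLpNorm (fderiv ℝ fun x => w n x - w m x) 2 volume ≤
        eLpNorm (fun x => fderiv ℝ (w n) x - A x) 2 volume +
          eLpNorm (fun x => fderiv ℝ (w m) x - A x) 2 volume := by
      have := eLpNorm_sub_le (p := 2)
        (((hw n).contDiff.continuous_fderiv (by simp)).aestronglyMeasurable.sub hA)
        (((hw m).contDiff.continuous_fderiv (by simp)).aestronglyMeasurable.sub hA) (by norm_num)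
      refine le_trans (le_of_eq ?_) this
      congr 1
      ext1 x
      rw [fderiv_fun_sub ((hw1 n).differentiable one_ne_zero x)
        ((hw1 m).differentiable one_ne_zero x)]
      simp
    refine (add_le_add a1 a2).trans (le_of_eq ?_)
    simp only [hδ]
    ring
  have T2 : ∀ j n, ‖∫ y, ρ y * fderiv ℝ (ψ j) y (w n y)‖ₑ ≤ C * δ n := fun j n => by
    have hle : ∀ m, ‖∫ y, ρ y * fderiv ℝ (ψ j) y (w n y)‖ₑ ≤
        C * (δ n + δ m) + ‖∫ y, ρ y * fderiv ℝ (ψ j) y (w m y)‖ₑ := fun m => by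
      have h1 := hbound (e j) (η j) (he j) (hη j) (fun x => w n x - w m x)
        ((hw1 n).sub (hw1 m)) ((hw n).hasCompactSupport.sub (hw m).hasCompactSupport)
      have h2 : ∫ y, ρ y * fderiv ℝ (ψ j) y (w n y) =
          (∫ y, ρ y * fderiv ℝ (ψ j) y (w n y - w m y)) +
            ∫ y, ρ y * fderiv ℝ (ψ j) y (w m y) := by
        simp_rw [map_sub, mul_sub]
        rw [integral_sub (hint j n) (hint j m)]
        ring
      rw [h2]
      refine (enorm_add_le _ _).trans (add_le_add ?_ le_rfl)
      exact h1.trans (mul_le_mul' le_rfl (hdiff n m))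
    have hl : Tendsto (fun m => C * (δ n + δ m) + ‖∫ y, ρ y * fderiv ℝ (ψ j) y (w m y)‖ₑ) atTop
        (𝓝 (C * (δ n + 0) + ‖(0 : ℝ)‖ₑ)) := by
      refine Tendsto.add (ENNReal.Tendsto.const_mul (tendsto_const_nhds.add hδ0) (Or.inr hC)) ?_
      exact (continuous_enorm.tendsto _).comp (T1 j)
    simpa using ge_of_tendsto' hl hle
  set J : ℕ → ℝ := fun n => (∫ x, b (ρ x) * fderiv ℝ φ x (w n x)) +
        ∫ x, (b (ρ x) - b' (ρ x) * ρ x) * φ x * (jac (fderiv ℝ (w n) x)).trace with hJ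
  have T3 : ∀ n, ‖J n‖ₑ ≤ C * δ n := fun n => by
    have := tendsto_flux_mollify hK he hη hlim hρ h0 hM hb' hb hφ hφc (hw1 n)
      (hw n).hasCompactSupport
    exact le_of_tendsto' ((continuous_enorm.tendsto _).comp this) fun j => T2 j n
  have T4 : Tendsto J atTop (𝓝 0) := by
    rw [tendsto_zero_iff_enorm_tendsto_zero]
    refine tendsto_of_tendsto_of_tendsto_of_le_of_le tendsto_const_nhds ?_ (fun _ => zero_le) T3
    simpa using ENNReal.Tendsto.const_mul hδ0 (Or.inr hC)
  have hmb : ∀ {f : ℝ → ℝ}, Continuous f → Measurable fun x => f (ρ x) := fun hf =>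
    hf.measurable.comp hρ
  obtain ⟨B, hB0, hB⟩ := exists_bound_on_Icc hbc M
  obtain ⟨B', hB'0, hB'⟩ := exists_bound_on_Icc (hbc.sub (hb'.mul continuous_id)) M
  have hDφ : Continuous (fderiv ℝ φ) := hφ.continuous_fderiv one_ne_zero
  refine tendsto_nhds_unique ?_ T4
  refine Tendsto.add ?_ ?_
  · refine tendsto_integral_of_holder (6 / 5) 6
      ((memLp_of_continuous hDφ (hφc.fderiv ℝ) (6 / 5)).norm.const_mul B)
      (fun n => (hw n).contDiff.continuous.aestronglyMeasurable.sub hu) hwu ?_ (fun n => ?_) ?_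
    · exact (hmb hbc).aestronglyMeasurable.mul ((ContinuousLinearMap.id ℝ
        (R3 →L[ℝ] ℝ)).aestronglyMeasurable_comp₂ hDφ.aestronglyMeasurable hu)
    · refine integrable_bdd_mul_of_hasCompactSupport (hmb hbc) (fun x => hB _ ⟨h0 x, hM x⟩)
        (hDφ.clm_apply (hw n).contDiff.continuous) ?_
      refine (hφc.fderiv ℝ).mono fun x hx h => hx ?_
      have h : fderiv ℝ φ x = 0 := h
      simp [h]
    · refine fun n => Eventually.of_forall fun x => ?_
      rw [← mul_sub, ← map_sub, abs_mul, Real.norm_of_nonneg (mul_nonneg hB0 (norm_nonneg _)),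
        mul_assoc]
      exact mul_le_mul (hB _ ⟨h0 x, hM x⟩) ((fderiv ℝ φ x).le_opNorm (w n x - u x))
        (abs_nonneg _) hB0
  · refine tendsto_integral_of_holder 2 2
      ((memLp_of_continuous hφ.continuous hφc 2).norm.const_mul (B' * 3))
      (fun n => ((hw n).contDiff.continuous_fderiv (by simp)).aestronglyMeasurable.sub hA) hwA ?_
      (fun n => ?_) ?_
    · refine (((hmb hbc).sub ((hmb hb').mul hρ)).aestronglyMeasurable.mul
        hφ.continuous.aestronglyMeasurable).mul ?_
      exact traceCLM.continuous.comp_aestronglyMeasurable hA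
    · have hd : Continuous fun x => (jac (fderiv ℝ (w n) x)).trace :=
        traceCLM.continuous.comp ((hw1 n).continuous_fderiv one_ne_zero)
      simp_rw [mul_assoc _ (φ _)]
      exact integrable_bdd_mul_of_hasCompactSupport ((hmb hbc).sub ((hmb hb').mul hρ))
        (fun x => hB' _ ⟨h0 x, hM x⟩) (hφ.continuous.mul hd)
        (HasCompactSupport.mul_right (f := φ) hφc)
    · refine fun n => Eventually.of_forall fun x => ?_
      rw [← mul_sub, ← trace_jac_sub, abs_mul, abs_mul,
        Real.norm_of_nonneg (mul_nonneg (by positivity) (norm_nonneg _))]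
      calc |b (ρ x) - b' (ρ x) * ρ x| * |φ x| * |(jac (fderiv ℝ (w n) x - A x)).trace|
          ≤ B' * |φ x| * (3 * ‖fderiv ℝ (w n) x - A x‖) := by
            gcongr
            · exact hB' _ ⟨h0 x, hM x⟩
            · exact abs_trace_jac_le _
        _ = _ := by rw [Real.norm_eq_abs, Pi.sub_apply]; ring

/-- A smooth cutoff function equal to one on larger and larger balls, with gradient of size
`O(1 / R)`. -/
theorem exists_cutoff : ∃ C : ℝ, ∃ χ : ℕ → R3 → ℝ, (∀ n, IsTestFun ∞ univ (χ n)) ∧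
    (∀ n x, |χ n x| ≤ 1) ∧ (∀ x, Tendsto (fun n => χ n x) atTop (𝓝 1)) ∧
    ∀ n x, ‖fderiv ℝ (χ n) x‖ ≤ C / ((n : ℝ) + 1) := by
  let f : ContDiffBump (0 : R3) := ⟨1, 2, by norm_num, by norm_num⟩
  have hsm : ContDiff ℝ ∞ (f : R3 → ℝ) := f.contDiff
  obtain ⟨C, hC⟩ := (hsm.continuous_fderiv (by simp)).bounded_above_of_compact_support
    (f.hasCompactSupport.fderiv ℝ)
  have hr : ∀ n : ℕ, (0 : ℝ) < (n : ℝ) + 1 := fun n => by positivity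
  refine ⟨C, fun n x => f (((n : ℝ) + 1)⁻¹ • x), fun n => ⟨?_, ?_, subset_univ _⟩, fun n x => ?_,
    fun x => ?_, fun n x => ?_⟩
  · exact hsm.comp (contDiff_const_smul _)
  · exact f.hasCompactSupport.comp_smul (inv_ne_zero (hr n).ne')
  · rw [abs_of_nonneg f.nonneg]
    exact f.le_one
  · refine tendsto_const_nhds.congr' ?_
    obtain ⟨N, hN⟩ := exists_nat_ge ‖x‖
    filter_upwards [eventually_ge_atTop N] with n hn
    refine (f.one_of_mem_closedBall ?_).symm
    simp only [mem_closedBall_zero_iff, norm_smul, norm_inv, Real.norm_eq_abs,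
      abs_of_pos (hr n)]
    change _ ≤ (1 : ℝ)
    rw [inv_mul_eq_div, div_le_one (hr n)]
    have : (N : ℝ) ≤ n := by exact_mod_cast hn
    linarith
  · have h1 := (hsm.differentiable (by simp) (((n : ℝ) + 1)⁻¹ • x)).hasFDerivAt
    have h2 : HasFDerivAt (fun z : R3 => ((n : ℝ) + 1)⁻¹ • z)
        (((n : ℝ) + 1)⁻¹ • ContinuousLinearMap.id ℝ R3) x := (hasFDerivAt_id x).const_smul
          (((n : ℝ) + 1)⁻¹)
    have h3 : HasFDerivAt (fun x => f (((n : ℝ) + 1)⁻¹ • x)) _ x := h1.comp x h2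
    rw [h3.fderiv, ContinuousLinearMap.comp_smul, ContinuousLinearMap.comp_id, norm_smul,
      Real.norm_of_nonneg (inv_nonneg.2 (hr n).le), div_eq_inv_mul]
    gcongr
    exact hC _

/-- The pressure does no work: `∫ (b'(ρ) ρ - b(ρ)) div u = 0` as soon as the renormalized flux
`b(ρ) u` and the integrand are integrable. -/
theorem integral_pressure_work_eq_zero (hρ : Measurable ρ) (h0 : ∀ x, 0 ≤ ρ x)
    (hM : ∀ x, ρ x ≤ M) (hu : AEStronglyMeasurable u) (hA : AEStronglyMeasurable A)
    (hw : ∀ n, IsTestFun ∞ univ (w n))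
    (hwu : Tendsto (fun n => eLpNorm (fun x => w n x - u x) 6 volume) atTop (𝓝 0))
    (hwA : Tendsto (fun n => eLpNorm (fun x => fderiv ℝ (w n) x - A x) 2 volume) atTop (𝓝 0))
    (hmass : ∀ φ : R3 → ℝ, IsTestFun ∞ univ φ → ∫ x, ρ x * fderiv ℝ φ x (u x) = 0)
    (hb' : Continuous b') (hb : ∀ s, HasDerivAt b (b' s) s)
    (hflux : Integrable fun x => b (ρ x) • u x)
    (hwork : Integrable fun x => (b' (ρ x) * ρ x - b (ρ x)) * (jac (A x)).trace) :
    ∫ x, (b' (ρ x) * ρ x - b (ρ x)) * (jac (A x)).trace = 0 := by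
  obtain ⟨C, χ, hχ, hχ1, hχlim, hDχ⟩ := exists_cutoff
  have key := fun n => integral_renormalized_eq_zero hρ h0 hM hu hA hw hwu hwA hmass hb' hb
    ((hχ n).contDiff.of_le (by simp)) (hχ n).hasCompactSupport
  have t1 : Tendsto (fun n => ∫ x, b (ρ x) * fderiv ℝ (χ n) x (u x)) atTop (𝓝 0) := by
    have hl : Tendsto (fun n : ℕ => C / ((n : ℝ) + 1) * ∫ x, ‖b (ρ x) • u x‖) atTop (𝓝 0) := by
      have := (tendsto_one_div_add_atTop_nhds_zero_nat (𝕜 := ℝ)).const_mul C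
      simpa [div_eq_mul_inv] using this.mul_const (∫ x, ‖b (ρ x) • u x‖)
    refine squeeze_zero_norm (fun n => ?_) hl
    rw [← integral_const_mul]
    refine norm_integral_le_of_norm_le (hflux.norm.const_mul _) (Eventually.of_forall fun x => ?_)
    rw [← smul_eq_mul, ← map_smul]
    exact (ContinuousLinearMap.le_opNorm _ _).trans
      (mul_le_mul_of_nonneg_right (hDχ n x) (norm_nonneg _))
  have t2 : Tendsto (fun n => ∫ x, (b (ρ x) - b' (ρ x) * ρ x) * χ n x * (jac (A x)).trace) atTop
      (𝓝 (∫ x, -((b' (ρ x) * ρ x - b (ρ x)) * (jac (A x)).trace))) := by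
    have heq : ∀ n x, (b (ρ x) - b' (ρ x) * ρ x) * χ n x * (jac (A x)).trace =
        -((b' (ρ x) * ρ x - b (ρ x)) * (jac (A x)).trace) * χ n x := fun n x => by ring
    simp_rw [heq]
    refine tendsto_integral_of_dominated_convergence
      (fun x => ‖(b' (ρ x) * ρ x - b (ρ x)) * (jac (A x)).trace‖) (fun n => ?_) hwork.norm
      (fun n => Eventually.of_forall fun x => ?_) (Eventually.of_forall fun x => ?_)
    · exact hwork.aestronglyMeasurable.neg.mul (hχ n).contDiff.continuous.aestronglyMeasurable
    · rw [norm_mul, norm_neg]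
      exact mul_le_of_le_one_right (norm_nonneg _) (hχ1 n x)
    · simpa using (hχlim x).const_mul (-((b' (ρ x) * ρ x - b (ρ x)) * (jac (A x)).trace))
  have t3 := t1.add t2
  simp_rw [key] at t3
  have := tendsto_nhds_unique t3 tendsto_const_nhds
  rw [integral_neg] at this
  linarith

end RenormalizedLimit

/-! ### The velocity space -/

section Velocity

/-- The Sobolev inequality `‖w‖₆ ≤ S ‖∇w‖₂` for compactly supported fields on `ℝ³`. -/
theorem exists_sobolev_const : ∃ S : ℝ≥0∞, S ≠ ⊤ ∧ ∀ w : R3 → R3, ContDiff ℝ 1 w →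
    HasCompactSupport w → eLpNorm w 6 volume ≤ S * eLpNorm (fderiv ℝ w) 2 volume := by
  refine ⟨SNormLESNormFDerivOfEqConst R3 (volume : Measure R3) 2, by simp, fun w hw hwc => ?_⟩
  have := eLpNorm_le_eLpNorm_fderiv_of_eq (μ := (volume : Measure R3)) (F := R3) hw hwc (p := 2)
    (p' := 6) (by norm_num) (by simp) (by simp; norm_num)
  simpa using this

theorem memLp_rpow_iff {α E : Type*} [MeasurableSpace α] {ν : Measure α} [NormedAddCommGroup E]
    {f : α → E} (hf : AEStronglyMeasurable f ν) {r : ℝ} (hr : 0 < r) :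
    MemLp f (ENNReal.ofReal r) ν ↔ Integrable (fun x => ‖f x‖ ^ r) ν := by
  rw [← integrable_norm_rpow_iff hf (by simpa using hr) (by simp), ENNReal.toReal_ofReal hr.le]

/-- `Lᵖ ∩ L^q ⊆ Lʳ` for `p ≤ r ≤ q`. -/
theorem memLp_of_memLp_of_memLp {α E : Type*} [MeasurableSpace α] {ν : Measure α}
    [NormedAddCommGroup E] {f : α → E} {p q r : ℝ} (hp : 0 < p) (hpr : p ≤ r) (hrq : r ≤ q)
    (h1 : MemLp f (ENNReal.ofReal p) ν) (h2 : MemLp f (ENNReal.ofReal q) ν) :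
    MemLp f (ENNReal.ofReal r) ν := by
  have hr : 0 < r := hp.trans_le hpr
  have hf := h1.1
  rw [memLp_rpow_iff hf hr]
  rw [memLp_rpow_iff hf hp] at h1
  rw [memLp_rpow_iff hf (hr.trans_le hrq)] at h2
  refine (h1.add h2).mono'
    (((Real.continuous_rpow_const hr.le).comp continuous_norm).comp_aestronglyMeasurable hf)
    (Eventually.of_forall fun x => ?_)
  rw [Real.norm_of_nonneg (by positivity)]
  rcases le_total ‖f x‖ 1 with h | h
  · refine (Real.rpow_le_rpow_of_exponent_ge' (norm_nonneg _) h hp.le hpr).trans ?_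
    exact le_add_of_nonneg_right (by positivity)
  · refine (Real.rpow_le_rpow_of_exponent_le h hrq).trans ?_
    exact le_add_of_nonneg_left (by positivity)

/-- A bounded function in `Lᵖ` belongs to `Lʳ` for `r ≥ p`. -/
theorem memLp_of_memLp_of_bdd {α E : Type*} [MeasurableSpace α] {ν : Measure α}
    [NormedAddCommGroup E] {f : α → E} {p r M : ℝ} (hp : 0 < p) (hpr : p ≤ r)
    (h1 : MemLp f (ENNReal.ofReal p) ν) (hM : ∀ᵐ x ∂ν, ‖f x‖ ≤ M) :
    MemLp f (ENNReal.ofReal r) ν := by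
  have hf := h1.1
  have hr : 0 < r := hp.trans_le hpr
  rw [memLp_rpow_iff hf hr]
  rw [memLp_rpow_iff hf hp] at h1
  refine (h1.const_mul (M ^ (r - p))).mono'
    (((Real.continuous_rpow_const hr.le).comp continuous_norm).comp_aestronglyMeasurable hf) ?_
  filter_upwards [hM] with x hx
  rw [Real.norm_of_nonneg (by positivity)]
  calc ‖f x‖ ^ r = ‖f x‖ ^ (r - p) * ‖f x‖ ^ p := by
        rw [← Real.rpow_add_of_nonneg (norm_nonneg _) (by linarith) hp.le]
        congr 1
        ring
    _ ≤ M ^ (r - p) * ‖f x‖ ^ p := by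
        gcongr

variable {Ω : Set R3}

theorem IsTestFun.fderiv_eq_zero {F : Type*} [NormedAddCommGroup F] [NormedSpace ℝ F]
    {k : WithTop ℕ∞} {φ : R3 → F} (h : IsTestFun k Ω φ) {x : R3} (hx : x ∉ Ω) :
    fderiv ℝ φ x = 0 := by
  by_contra hne
  exact hx (h.tsupport_subset (support_fderiv_subset ℝ (Function.mem_support.2 hne)))

theorem IsTestFun.eq_zero {F : Type*} [NormedAddCommGroup F] [NormedSpace ℝ F]
    {k : WithTop ℕ∞} {φ : R3 → F} (h : IsTestFun k Ω φ) {x : R3} (hx : x ∉ Ω) : φ x = 0 := by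
  by_contra hne
  exact hx (h.tsupport_subset (subset_tsupport _ (Function.mem_support.2 hne)))

theorem IsTestFun.mono {F : Type*} [NormedAddCommGroup F] [NormedSpace ℝ F]
    {k l : WithTop ℕ∞} {Ω' : Set R3} {φ : R3 → F} (h : IsTestFun k Ω φ) (hl : l ≤ k)
    (hΩ : Ω ⊆ Ω') : IsTestFun l Ω' φ :=
  ⟨h.contDiff.of_le hl, h.hasCompactSupport, h.tsupport_subset.trans hΩ⟩

/-- Triangle inequality through an intermediate function. -/
theorem eLpNorm_sub_le_add {α E : Type*} [MeasurableSpace α] {ν : Measure α}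
    [NormedAddCommGroup E] {f g h : α → E} {p : ℝ≥0∞} (hp : 1 ≤ p)
    (hf : AEStronglyMeasurable f ν) (hg : AEStronglyMeasurable g ν)
    (hh : AEStronglyMeasurable h ν) :
    eLpNorm (fun x => f x - g x) p ν ≤
      eLpNorm (fun x => f x - h x) p ν + eLpNorm (fun x => g x - h x) p ν := by
  refine le_trans (le_of_eq ?_) (eLpNorm_sub_le (hf.sub hh) (hg.sub hh) hp)
  congr 1
  ext1 x
  simp

theorem eLpNorm_restrict_eq_of_eq_zero {α E : Type*} [MeasurableSpace α] {ν : Measure α}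
    [NormedAddCommGroup E] {f : α → E} {p : ℝ≥0∞} {s : Set α} (h : ∀ x ∉ s, f x = 0) :
    eLpNorm f p (ν.restrict s) = eLpNorm f p ν :=
  eLpNorm_restrict_eq_of_support_subset fun x hx => by
    by_contra hxs
    exact hx (h x hxs)

/-- The Sobolev norm of a difference of test functions, in terms of the distances of their
gradients to a given field. -/
theorem eLpNorm_six_sub_le {S : ℝ≥0∞}
    (hSob : ∀ w : R3 → R3, ContDiff ℝ 1 w → HasCompactSupport w →
      eLpNorm w 6 volume ≤ S * eLpNorm (fderiv ℝ w) 2 volume)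
    {A : R3 → R3 →L[ℝ] R3} (hA : AEStronglyMeasurable A (volume.restrict Ω)) {v w : R3 → R3}
    (hv : IsTestFun ∞ Ω v) (hw : IsTestFun ∞ Ω w) :
    eLpNorm (fun x => v x - w x) 6 (volume.restrict Ω) ≤
      S * (eLpNorm (fun x => fderiv ℝ v x - A x) 2 (volume.restrict Ω) +
        eLpNorm (fun x => fderiv ℝ w x - A x) 2 (volume.restrict Ω)) := by
  have a0 : (fderiv ℝ fun x => v x - w x) = fun x => fderiv ℝ v x - fderiv ℝ w x := by
    ext1 x
    exact fderiv_fun_sub (hv.contDiff.differentiable (by simp) x)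
      (hw.contDiff.differentiable (by simp) x)
  have a1 : eLpNorm (fun x => fderiv ℝ v x - fderiv ℝ w x) 2 volume =
      eLpNorm (fun x => fderiv ℝ v x - fderiv ℝ w x) 2 (volume.restrict Ω) := by
    refine (eLpNorm_restrict_eq_of_eq_zero fun x hxΩ => ?_).symm
    simp [hv.fderiv_eq_zero hxΩ, hw.fderiv_eq_zero hxΩ]
  have mv : AEStronglyMeasurable (fderiv ℝ v) (volume.restrict Ω) :=
    (hv.contDiff.continuous_fderiv (by simp)).aestronglyMeasurable
  have mw : AEStronglyMeasurable (fderiv ℝ w) (volume.restrict Ω) :=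
    (hw.contDiff.continuous_fderiv (by simp)).aestronglyMeasurable
  have a2 := eLpNorm_sub_le_add (p := 2) (by norm_num) mv mw hA
  have a3 := hSob (fun x => v x - w x)
    ((hv.contDiff.sub hw.contDiff).of_le (by simp)) (hv.hasCompactSupport.sub hw.hasCompactSupport)
  rw [a0, a1] at a3
  exact (eLpNorm_restrict_le _ _ _ _).trans (a3.trans (mul_le_mul' le_rfl a2))

/-- A local `L¹` limit in `Ω` and an `L⁶(Ω)` limit of the same sequence agree. -/
theorem ae_eq_of_tendsto_local (hΩ : IsOpen Ω) {u v : R3 → R3} {w : ℕ → R3 → R3}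
    (hwc : ∀ n, Continuous (w n))
    (hum : AEStronglyMeasurable u (volume.restrict Ω))
    (hvm : AEStronglyMeasurable v (volume.restrict Ω))
    (hv : Tendsto (fun n => eLpNorm (fun x => w n x - v x) 6 (volume.restrict Ω)) atTop (𝓝 0))
    (hu : ∀ K : Set R3, IsCompact K → K ⊆ Ω →
      Tendsto (fun n => eLpNorm (fun x => w n x - u x) 1 (volume.restrict K)) atTop (𝓝 0)) :
    ∀ᵐ x ∂(volume.restrict Ω), u x = v x := by
  have hloc : ∀ K : Set R3, IsCompact K → K ⊆ Ω → ∀ᵐ x ∂(volume.restrict K), u x = v x := by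
    intro K hK hKΩ
    have hle : volume.restrict K ≤ volume.restrict Ω := Measure.restrict_mono hKΩ le_rfl
    have mu : AEStronglyMeasurable u (volume.restrict K) := hum.mono_measure hle
    have mv : AEStronglyMeasurable v (volume.restrict K) := hvm.mono_measure hle
    have : IsFiniteMeasure (volume.restrict K) := isFiniteMeasure_restrict.2 hK.measure_lt_top.ne
    have t1 : Tendsto (fun n => eLpNorm (fun x => w n x - v x) 1 (volume.restrict K)) atTop
        (𝓝 0) := by
      set c := (volume.restrict K) univ ^ (1 / (1 : ℝ≥0∞).toReal - 1 / (6 : ℝ≥0∞).toReal)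
      have hc : c ≠ ⊤ := ENNReal.rpow_ne_top_of_nonneg (by norm_num) (measure_ne_top _ _)
      have h1 := ENNReal.Tendsto.mul_const hv (Or.inr hc)
      rw [zero_mul] at h1
      refine tendsto_of_tendsto_of_tendsto_of_le_of_le tendsto_const_nhds h1 (fun _ => zero_le)
        fun n => ?_
      refine (eLpNorm_le_eLpNorm_mul_rpow_measure_univ (by norm_num : (1 : ℝ≥0∞) ≤ 6)
        ((hwc n).aestronglyMeasurable.sub mv)).trans ?_
      exact mul_le_mul' (eLpNorm_mono_measure _ hle) le_rfl
    have t2 := t1.add (hu K hK hKΩ)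
    rw [add_zero] at t2
    have h0 : eLpNorm (fun x => u x - v x) 1 (volume.restrict K) = 0 := by
      refine le_antisymm (ge_of_tendsto' t2 fun n => ?_) zero_le
      refine (eLpNorm_sub_le_add le_rfl mu mv (hwc n).aestronglyMeasurable).trans (le_of_eq ?_)
      rw [add_comm]
      congr 1 <;> exact eLpNorm_congr_norm_ae (Eventually.of_forall fun x => norm_sub_rev _ _)
    have h1 := (eLpNorm_eq_zero_iff (mu.sub mv) one_ne_zero).1 h0
    filter_upwards [h1] with x hx
    exact sub_eq_zero.1 hx
  rw [ae_restrict_iff' hΩ.measurableSet, ae_iff]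
  refine measure_null_of_locally_null _ fun x hx => ?_
  simp only [mem_ofPred_eq, Classical.not_imp] at hx
  obtain ⟨r, hr, hrΩ⟩ := Metric.nhds_basis_closedBall.mem_iff.1 (hΩ.mem_nhds hx.1)
  refine ⟨{a | ¬(a ∈ Ω → u a = v a)} ∩ Metric.closedBall x r,
    inter_mem_nhdsWithin _ (Metric.closedBall_mem_nhds x hr), ?_⟩
  have := hloc _ (isCompact_closedBall x r) hrΩ
  rw [ae_restrict_iff' Metric.isClosed_closedBall.measurableSet, ae_iff] at this
  refine measure_mono_null (fun y hy => ?_) this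
  simp only [mem_inter_iff, mem_ofPred_eq, Classical.not_imp] at hy ⊢
  exact ⟨hy.2, hy.1.2⟩

/-- Functions of `D₀^{1,2}(Ω)` belong to `L⁶(Ω)`, and the approximating test functions converge in
that space. The limit in `L⁶`, which exists by the Sobolev inequality, is identified on compact
subsets. -/
theorem MemD0.exists_approx (hΩ : IsOpen Ω) {u : R3 → R3}
    (hum : AEStronglyMeasurable u (volume.restrict Ω)) (hu : MemD0 Ω 2 u) :
    MemLp u 6 (volume.restrict Ω) ∧ ∃ w : ℕ → R3 → R3, (∀ n, IsTestFun ∞ Ω (w n)) ∧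
      Tendsto (fun n => eLpNorm (fun x => w n x - u x) 6 (volume.restrict Ω)) atTop (𝓝 0) ∧
      Tendsto (fun n => eLpNorm (fun x => fderiv ℝ (w n) x - weakGrad Ω u x) 2
        (volume.restrict Ω)) atTop (𝓝 0) := by
  obtain ⟨hD, w, hw, hw1, hw2⟩ := hu
  obtain ⟨S, hS, hSob⟩ := exists_sobolev_const
  have hA := hD.memLp_grad.1
  have hwc : ∀ n, Continuous (w n) := fun n => (hw n).contDiff.continuous
  have hLp : ∀ n, MemLp (w n) 6 (volume.restrict Ω) := fun n =>
    (memLp_of_continuous (hwc n) (hw n).hasCompactSupport 6).restrict _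
  have hcau := fun n m => eLpNorm_six_sub_le hSob hA (hw n) (hw m)
  have : Fact ((1 : ℝ≥0∞) ≤ 6) := ⟨by norm_num⟩
  have hC : CauchySeq fun n => (hLp n).toLp (w n) := by
    rw [EMetric.cauchySeq_iff]
    intro ε hε
    have h0 := ENNReal.Tendsto.const_mul (a := S)
      ((hw2.comp tendsto_fst).add (hw2.comp tendsto_snd)) (Or.inr hS)
    rw [add_zero, mul_zero, prod_atTop_atTop_eq] at h0
    obtain ⟨N, hN⟩ := eventually_atTop.1 (h0.eventually (gt_mem_nhds hε))
    refine ⟨max N.1 N.2, fun m hm n hn => ?_⟩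
    rw [Lp.edist_toLp_toLp]
    exact (hcau m n).trans_lt (hN (m, n) ⟨(le_max_left _ _).trans hm, (le_max_right _ _).trans hn⟩)
  obtain ⟨v, hv⟩ := cauchySeq_tendsto_of_complete hC
  rw [Lp.tendsto_Lp_iff_tendsto_eLpNorm'] at hv
  have hv' : Tendsto (fun n => eLpNorm (fun x => w n x - v x) 6 (volume.restrict Ω)) atTop
      (𝓝 0) := by
    refine hv.congr fun n => eLpNorm_congr_ae ?_
    filter_upwards [(hLp n).coeFn_toLp] with x hx
    simp [hx]
  have hae := ae_eq_of_tendsto_local hΩ hwc hum (Lp.memLp v).1 hv' hw1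
  refine ⟨(Lp.memLp v).ae_eq (hae.mono fun x hx => hx.symm), w, hw, ?_, hw2⟩
  refine hv'.congr fun n => eLpNorm_congr_ae ?_
  filter_upwards [hae] with x hx
  rw [hx]

end Velocity

/-! ### Coercivity of the viscous stress -/

section Viscosity

variable {μ η : ℝ}

/-- The viscous dissipation `𝕊(A) : B`. -/
noncomputable def dissipation (μ η : ℝ) (A B : R3 →L[ℝ] R3) : ℝ :=
  contract (stress μ η (jac A)) (jac B)

theorem dissipation_eq (A B : R3 →L[ℝ] R3) : dissipation μ η A B =
    μ * (∑ i, ∑ j, jac A i j * jac B i j) + μ * (∑ i, ∑ j, jac A j i * jac B i j) +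
      (η - 2 / 3 * μ) * ((jac A).trace * (jac B).trace) := by
  simp only [dissipation, contract, stress, Matrix.trace, Fin.sum_univ_three, Matrix.diag,
    Matrix.add_apply, Matrix.smul_apply, Matrix.sub_apply, Matrix.transpose_apply,
    Matrix.one_apply, smul_eq_mul]
  simp
  ring

theorem dissipation_sub_left (A A' B : R3 →L[ℝ] R3) :
    dissipation μ η (A - A') B = dissipation μ η A B - dissipation μ η A' B := by
  simp only [dissipation_eq, trace_jac_sub]
  simp only [jac, Matrix.of_apply, sub_apply, PiLp.sub_apply, sub_mul, Finset.sum_sub_distrib]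
  ring

theorem abs_jac_le (A : R3 →L[ℝ] R3) (i j : Fin 3) : |jac A i j| ≤ ‖A‖ := by
  have h1 := PiLp.norm_apply_le (A (EuclideanSpace.single j (1 : ℝ))) i
  have h2 := A.le_opNorm (EuclideanSpace.single j (1 : ℝ))
  simp at h1 h2
  exact h1.trans h2

theorem exists_abs_dissipation_le (μ η : ℝ) : ∃ C : ℝ, 0 ≤ C ∧ ∀ A B : R3 →L[ℝ] R3,
    |dissipation μ η A B| ≤ C * (‖A‖ * ‖B‖) := by
  refine ⟨18 * |μ| + 9 * |η - 2 / 3 * μ|, by positivity, fun A B => ?_⟩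
  have h1 : |∑ i, ∑ j, jac A i j * jac B i j| ≤ 9 * (‖A‖ * ‖B‖) := by
    refine (Finset.abs_sum_le_sum_abs _ _).trans ?_
    have : ∀ i ∈ Finset.univ, |∑ j, jac A i j * jac B i j| ≤ 3 * (‖A‖ * ‖B‖) := fun i _ => by
      refine (Finset.abs_sum_le_sum_abs _ _).trans ?_
      refine (Finset.sum_le_card_nsmul _ _ (‖A‖ * ‖B‖) fun j _ => ?_).trans (by simp)
      rw [abs_mul]
      exact mul_le_mul (abs_jac_le A i j) (abs_jac_le B i j) (abs_nonneg _) (norm_nonneg _)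
    refine (Finset.sum_le_card_nsmul _ _ _ this).trans (le_of_eq ?_)
    simp
    ring
  have h2 : |∑ i, ∑ j, jac A j i * jac B i j| ≤ 9 * (‖A‖ * ‖B‖) := by
    refine (Finset.abs_sum_le_sum_abs _ _).trans ?_
    have : ∀ i ∈ Finset.univ, |∑ j, jac A j i * jac B i j| ≤ 3 * (‖A‖ * ‖B‖) := fun i _ => by
      refine (Finset.abs_sum_le_sum_abs _ _).trans ?_
      refine (Finset.sum_le_card_nsmul _ _ (‖A‖ * ‖B‖) fun j _ => ?_).trans (by simp)
      rw [abs_mul]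
      exact mul_le_mul (abs_jac_le A j i) (abs_jac_le B i j) (abs_nonneg _) (norm_nonneg _)
    refine (Finset.sum_le_card_nsmul _ _ _ this).trans (le_of_eq ?_)
    simp
    ring
  have h3 : |(jac A).trace * (jac B).trace| ≤ 9 * (‖A‖ * ‖B‖) := by
    rw [abs_mul]
    calc _ ≤ (3 * ‖A‖) * (3 * ‖B‖) :=
          mul_le_mul (abs_trace_jac_le A) (abs_trace_jac_le B) (abs_nonneg _) (by positivity)
      _ = _ := by ring
  rw [dissipation_eq]
  refine (abs_add_le _ _).trans ((add_le_add (abs_add_le _ _) le_rfl).trans ?_)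
  rw [abs_mul, abs_mul, abs_mul]
  nlinarith [mul_le_mul_of_nonneg_left h1 (abs_nonneg μ),
    mul_le_mul_of_nonneg_left h2 (abs_nonneg μ),
    mul_le_mul_of_nonneg_left h3 (abs_nonneg (η - 2 / 3 * μ))]

theorem norm_sq_le_sum_jac (A : R3 →L[ℝ] R3) : ‖A‖ ^ 2 ≤ 3 * ∑ i, ∑ j, jac A i j * jac A i j := by
  set c : Fin 3 → ℝ := fun j => ‖A (EuclideanSpace.single j 1)‖
  have hA : ‖A‖ ≤ ∑ j, c j := by
    refine A.opNorm_le_bound (Finset.sum_nonneg fun j _ => norm_nonneg _) fun x => ?_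
    have hx : A x = ∑ j, x j • A (EuclideanSpace.single j 1) := by
      conv_lhs => rw [← (EuclideanSpace.basisFun (Fin 3) ℝ).sum_repr x]
      simp
    rw [hx, Finset.sum_mul]
    refine (norm_sum_le _ _).trans (Finset.sum_le_sum fun j _ => ?_)
    rw [norm_smul, mul_comm]
    exact mul_le_mul_of_nonneg_left (PiLp.norm_apply_le x j) (norm_nonneg _)
  have hc : ∀ j, c j ^ 2 = ∑ i, jac A i j * jac A i j := fun j => by
    simp only [c, EuclideanSpace.norm_sq_eq, jac, Matrix.of_apply, Real.norm_eq_abs, sq_abs]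
    refine Finset.sum_congr rfl fun i _ => by ring
  rw [Finset.sum_comm, ← Finset.sum_congr rfl fun j _ => hc j]
  have h2 : (∑ j, c j) ^ 2 ≤ 3 * ∑ j, c j ^ 2 := by
    have := sq_sum_le_card_mul_sum_sq (s := Finset.univ) (f := c)
    simpa using this
  exact (pow_le_pow_left₀ (norm_nonneg _) hA 2).trans h2

/-- Two integrations by parts: `∫ ∂ᵢf ∂ⱼg = ∫ ∂ⱼf ∂ᵢg`. -/
theorem integral_fderiv_mul_fderiv_comm {f g : R3 → ℝ} (hf : ContDiff ℝ ∞ f) (hg : ContDiff ℝ ∞ g)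
    (hfc : HasCompactSupport f) (a b : R3) :
    ∫ x, fderiv ℝ f x a * fderiv ℝ g x b = ∫ x, fderiv ℝ f x b * fderiv ℝ g x a := by
  have hD : ∀ c, ContDiff ℝ ∞ fun x => fderiv ℝ g x c := fun c =>
    (hg.fderiv_right (m := ∞) (by simp)).clm_apply contDiff_const
  have key : ∀ c d, ∫ x, fderiv ℝ f x c * fderiv ℝ g x d =
      - ∫ x, f x * fderiv ℝ (fun x => fderiv ℝ g x d) x c := fun c d => by
    have hfd : Continuous fun x => fderiv ℝ f x c :=
      (hf.continuous_fderiv (by simp)).clm_apply continuous_const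
    have hgd : Continuous fun x => fderiv ℝ (fun x => fderiv ℝ g x d) x c :=
      ((hD d).continuous_fderiv (by simp)).clm_apply continuous_const
    suffices h : ∫ x, f x * fderiv ℝ (fun x => fderiv ℝ g x d) x c =
        - ∫ x, fderiv ℝ f x c * fderiv ℝ g x d by rw [h, neg_neg]
    refine integral_mul_fderiv_eq_neg_fderiv_mul_of_integrable ?_ ?_ ?_ ?_ ?_
    · exact (hfd.mul (hD d).continuous).integrable_of_hasCompactSupport
        (hfc.fderiv_apply ℝ c).mul_right
    · exact (hf.continuous.mul hgd).integrable_of_hasCompactSupport hfc.mul_right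
    · exact (hf.continuous.mul (hD d).continuous).integrable_of_hasCompactSupport hfc.mul_right
    · exact fun x _ => hf.differentiable (by simp) x
    · exact fun x _ => (hD d).differentiable (by simp) x
  rw [key, key]
  congr 1
  refine integral_congr_ae (Eventually.of_forall fun x => ?_)
  simp only
  congr 1
  have h2 : DifferentiableAt ℝ (fderiv ℝ g) x :=
    (hg.fderiv_right (m := ∞) (by simp)).differentiable (by simp) x
  have e : ∀ c d, fderiv ℝ (fun x => fderiv ℝ g x d) x c = fderiv ℝ (fderiv ℝ g) x c d :=
    fun c d => by
      rw [fderiv_clm_apply h2 (differentiableAt_const d)]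
      simp
  rw [e, e]
  have h3 : ContDiff ℝ 2 g := hg.of_le (WithTop.coe_le_coe.2 (le_top : (2 : ℕ∞) ≤ ⊤))
  exact (h3.contDiffAt.isSymmSndFDerivAt (by simp)).eq a b

/-- Korn's inequality for test functions: the dissipation controls the full gradient. -/
theorem integral_norm_fderiv_sq_le (hμ : 0 < μ) (hη : 0 ≤ η) {w : R3 → R3}
    (hw : IsTestFun ∞ univ w) :
    ∫ x, ‖fderiv ℝ w x‖ ^ 2 ≤ 3 / μ * ∫ x, dissipation μ η (fderiv ℝ w x) (fderiv ℝ w x) := by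
  have hwi : ∀ i, ContDiff ℝ ∞ fun x => w x i := fun i => ContDiff.coord hw.contDiff i
  have hwc : ∀ i, HasCompactSupport fun x => w x i := fun i =>
    hw.hasCompactSupport.comp_left (g := fun y : R3 => y i) rfl
  have hj : ∀ i j x, jac (fderiv ℝ w x) i j =
      fderiv ℝ (fun x => w x i) x (EuclideanSpace.single j 1) := fun i j x => by
    rw [fderiv_coord (hw.contDiff.differentiable (by simp) x)]
    rfl
  have hjc : ∀ i j, Continuous fun x => jac (fderiv ℝ w x) i j := fun i j => by
    simp_rw [hj]
    exact ((hwi i).continuous_fderiv (by simp)).clm_apply continuous_const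
  have hjs : ∀ i j, HasCompactSupport fun x => jac (fderiv ℝ w x) i j := fun i j => by
    simp_rw [hj]
    exact (hwc i).fderiv_apply ℝ _
  have hint : ∀ i j k l, Integrable fun x => jac (fderiv ℝ w x) i j * jac (fderiv ℝ w x) k l :=
    fun i j k l => ((hjc i j).mul (hjc k l)).integrable_of_hasCompactSupport (hjs i j).mul_right
  set F := ∫ x, ∑ i, ∑ j, jac (fderiv ℝ w x) i j * jac (fderiv ℝ w x) i j
  set T := ∫ x, (jac (fderiv ℝ w x)).trace * (jac (fderiv ℝ w x)).trace
  have i1 : Integrable fun x => ∑ i, ∑ j, jac (fderiv ℝ w x) i j * jac (fderiv ℝ w x) i j :=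
    integrable_finsetSum _ fun i _ => integrable_finsetSum _ fun j _ => hint i j i j
  have i2 : Integrable fun x => ∑ i, ∑ j, jac (fderiv ℝ w x) j i * jac (fderiv ℝ w x) i j :=
    integrable_finsetSum _ fun i _ => integrable_finsetSum _ fun j _ => hint j i i j
  have htr : ∀ x, (jac (fderiv ℝ w x)).trace * (jac (fderiv ℝ w x)).trace =
      ∑ i, ∑ j, jac (fderiv ℝ w x) j j * jac (fderiv ℝ w x) i i := fun x => by
    rw [Matrix.trace, Finset.sum_mul_sum, Finset.sum_comm]
    rfl
  have i3 : Integrable fun x => (jac (fderiv ℝ w x)).trace * (jac (fderiv ℝ w x)).trace := by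
    simp_rw [htr]
    exact integrable_finsetSum _ fun i _ => integrable_finsetSum _ fun j _ => hint j j i i
  have hX : ∫ x, ∑ i, ∑ j, jac (fderiv ℝ w x) j i * jac (fderiv ℝ w x) i j = T := by
    simp_rw [T, htr]
    rw [integral_finsetSum _ fun i _ => integrable_finsetSum _ fun j _ => hint j i i j,
      integral_finsetSum _ fun i _ => integrable_finsetSum _ fun j _ => hint j j i i]
    refine Finset.sum_congr rfl fun i _ => ?_
    rw [integral_finsetSum _ fun j _ => hint j i i j, integral_finsetSum _ fun j _ => hint j j i i]
    refine Finset.sum_congr rfl fun j _ => ?_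
    simp_rw [hj]
    exact integral_fderiv_mul_fderiv_comm (hwi j) (hwi i) (hwc j) _ _
  have hdis : ∫ x, dissipation μ η (fderiv ℝ w x) (fderiv ℝ w x) =
      μ * F + (μ / 3 + η) * T := by
    simp_rw [dissipation_eq]
    have i12 : Integrable fun x =>
        μ * (∑ i, ∑ j, jac (fderiv ℝ w x) i j * jac (fderiv ℝ w x) i j) +
          μ * (∑ i, ∑ j, jac (fderiv ℝ w x) j i * jac (fderiv ℝ w x) i j) :=
      (i1.const_mul μ).add (i2.const_mul μ)
    rw [integral_add i12 (i3.const_mul _),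
      integral_add (i1.const_mul μ) (i2.const_mul μ), integral_const_mul, integral_const_mul,
      integral_const_mul, hX]
    ring
  have hT : 0 ≤ T := integral_nonneg fun x => mul_self_nonneg _
  have hF : ∫ x, ‖fderiv ℝ w x‖ ^ 2 ≤ 3 * F := by
    rw [← integral_const_mul]
    refine integral_mono_of_nonneg (Eventually.of_forall fun x => by positivity) (i1.const_mul 3)
      (Eventually.of_forall fun x => norm_sq_le_sum_jac _)
  calc _ ≤ 3 * F := hF
    _ = 3 / μ * (μ * F) := by field_simp
    _ ≤ _ := by
        rw [hdis]
        gcongr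
        exact le_add_of_nonneg_right (by positivity)

end Viscosity

/-! ### The work of the potential force -/

section Force

variable {Ω : Set R3}

theorem HasWeakGradient.isWeakGradient {F : Type*} [NormedAddCommGroup F] [NormedSpace ℝ F]
    {f : R3 → F} (h : HasWeakGradient Ω f) : IsWeakGradient Ω f (weakGrad Ω f) := by
  rw [weakGrad, dif_pos h]
  exact h.choose_spec

/-- Integrability of a function dominated by the product of functions in dual spaces. -/
theorem integrable_of_holder {α E F : Type*} [MeasurableSpace α] {ν : Measure α}
    [NormedAddCommGroup E] [NormedAddCommGroup F] (p q : ℝ≥0∞) [ENNReal.HolderConjugate p q]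
    {h : α → E} (hh : MemLp h p ν) {k : α → F} (hk : MemLp k q ν) {f : α → ℝ}
    (hf : AEStronglyMeasurable f ν) (hle : ∀ᵐ x ∂ν, |f x| ≤ ‖h x‖ * ‖k x‖) :
    Integrable f ν := by
  refine ⟨hf, ?_⟩
  refine ((lintegral_mono_ae ?_).trans (lintegral_enorm_mul_enorm_le p q hh.1 hk.1)).trans_lt
    (ENNReal.mul_lt_top hh.2 hk.2)
  filter_upwards [hle] with x hx
  rw [← ofReal_norm, ← ofReal_norm, ← ofReal_norm, ← ENNReal.ofReal_mul (norm_nonneg _)]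
  exact ENNReal.ofReal_le_ofReal hx

theorem aestronglyMeasurable_apply {α E F : Type*} [MeasurableSpace α] {ν : Measure α}
    [NormedAddCommGroup E] [NormedSpace ℝ E] [NormedAddCommGroup F] [NormedSpace ℝ F]
    {L : α → E →L[ℝ] F} {v : α → E} (hL : AEStronglyMeasurable L ν)
    (hv : AEStronglyMeasurable v ν) : AEStronglyMeasurable (fun x => L x (v x)) ν :=
  (ContinuousLinearMap.id ℝ (E →L[ℝ] F)).aestronglyMeasurable_comp₂ hL hv

theorem setIntegral_mass_eq_zero_of_testFun {ρ : R3 → ℝ} {u : R3 → R3}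
    (hmass : ∀ φ : R3 → ℝ, IsTestFun ∞ univ φ → ∫ x in Ω, ρ x * fderiv ℝ φ x (u x) = 0)
    {φ : R3 → ℝ} (hφ : IsTestFun ∞ Ω φ) : ∫ x in Ω, ρ x * fderiv ℝ φ x (u x) = 0 :=
  hmass φ (hφ.mono le_rfl (subset_univ _))

/-- A potential in `D₀^{1,q}` does no work along a divergence free flux, and its force is
admissible. The density is only integrable to powers `≥ γ`, and the restriction on `q` says exactly
that `ρ ∈ Lʳ` for the exponent `r` with `1/r + 1/q + 1/6 = 1`. -/
theorem force_of_memD0ModConst {γ q M : ℝ} (hγ : 0 < γ) (hq : 6 / 5 ≤ q)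
    (hγq : 5 / 6 - 1 / q ≤ 1 / γ) {ρ : R3 → ℝ} {u : R3 → R3} {G : R3 → ℝ}
    (hργ : MemLp ρ (ENNReal.ofReal γ) (volume.restrict Ω))
    (hρ : MemLp ρ ⊤ (volume.restrict Ω)) (hM : ∀ᵐ x ∂(volume.restrict Ω), ‖ρ x‖ ≤ M)
    (hu : MemLp u 6 (volume.restrict Ω))
    (hmass : ∀ φ : R3 → ℝ, IsTestFun ∞ univ φ → ∫ x in Ω, ρ x * fderiv ℝ φ x (u x) = 0)
    (hG : MemD0ModConst Ω (ENNReal.ofReal q) G) :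
    MemLp (fun x => ρ x • weakGrad Ω G x) (6 / 5) (volume.restrict Ω) ∧
      ∫ x in Ω, ρ x * weakGrad Ω G x (u x) = 0 := by
  obtain ⟨hD, φ, hφ, hlim⟩ := hG
  have hg := hD.memLp_grad
  have hq0 : 0 < q := by linarith
  set θ := 5 / 6 - 1 / q with hθ
  have hθ0 : 0 ≤ θ := by
    rw [hθ, sub_nonneg, div_le_div_iff₀ hq0 (by norm_num)]
    linarith
  have hρr : MemLp ρ (ENNReal.ofReal θ)⁻¹ (volume.restrict Ω) := by
    rcases hθ0.eq_or_lt with h | h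
    · rw [← h]
      simpa using hρ
    · rw [← ENNReal.ofReal_inv_of_pos h]
      refine memLp_of_memLp_of_bdd hγ ?_ hργ hM
      rw [le_inv_comm₀ hγ h, ← one_div]
      exact hγq
  have h65 : ((6 : ℝ≥0∞) / 5)⁻¹ = ENNReal.ofReal (5 / 6) := by
    rw [ENNReal.inv_div (Or.inl (by simp)) (Or.inl (by simp)),
      ENNReal.ofReal_div_of_pos (by norm_num)]
    simp
  have h6 : (6 : ℝ≥0∞)⁻¹ = ENNReal.ofReal (1 / 6) := by
    rw [ENNReal.ofReal_div_of_pos (by norm_num)]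
    simp
  have hqi : (ENNReal.ofReal q)⁻¹ = ENNReal.ofReal (1 / q) := by
    rw [one_div, ENNReal.ofReal_inv_of_pos hq0]
  have : ENNReal.HolderTriple (ENNReal.ofReal θ)⁻¹ (ENNReal.ofReal q) (6 / 5) := ⟨by
    rw [inv_inv, h65, hqi, ← ENNReal.ofReal_add hθ0 (by positivity)]
    congr 1
    rw [hθ]
    ring⟩
  have : ENNReal.HolderTriple (ENNReal.ofReal θ)⁻¹ 6 (ENNReal.ofReal (θ + 1 / 6))⁻¹ := ⟨by
    rw [inv_inv, inv_inv, h6, ← ENNReal.ofReal_add hθ0 (by positivity)]⟩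
  have : ENNReal.HolderConjugate (ENNReal.ofReal (θ + 1 / 6))⁻¹ (ENNReal.ofReal q) := ⟨by
    rw [inv_inv, hqi, ← ENNReal.ofReal_add (by positivity) (by positivity),
      show θ + 1 / 6 + 1 / q = 1 by rw [hθ]; ring]
    simp⟩
  have hflux : MemLp (fun x => ρ x • u x) (ENNReal.ofReal (θ + 1 / 6))⁻¹ (volume.restrict Ω) :=
    hu.smul hρr
  refine ⟨hg.smul hρr, ?_⟩
  have hDc : ∀ n, Continuous (fderiv ℝ (φ n)) := fun n =>
    (hφ n).contDiff.continuous_fderiv (by simp)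
  have t := tendsto_integral_of_holder _ _ hflux (f := fun x => ρ x * weakGrad Ω G x (u x))
    (f' := fun n x => ρ x * fderiv ℝ (φ n) x (u x))
    (fun n => (hDc n).aestronglyMeasurable.sub hg.1) hlim ?_ ?_ ?_
  · have h0 := fun n => setIntegral_mass_eq_zero_of_testFun hmass (hφ n)
    simp_rw [h0] at t
    exact tendsto_nhds_unique t tendsto_const_nhds
  · exact hρ.1.mul (aestronglyMeasurable_apply hg.1 hu.1)
  · intro n
    refine integrable_of_holder (ENNReal.ofReal (θ + 1 / 6))⁻¹ (ENNReal.ofReal q) hflux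
      (k := fderiv ℝ (φ n))
      ((memLp_of_continuous (hDc n) ((hφ n).hasCompactSupport.fderiv ℝ) _).restrict _)
      (hρ.1.mul (aestronglyMeasurable_apply (hDc n).aestronglyMeasurable hu.1))
      (Eventually.of_forall fun x => ?_)
    rw [abs_mul, norm_smul, mul_assoc, mul_comm ‖u x‖]
    exact mul_le_mul_of_nonneg_left ((fderiv ℝ (φ n) x).le_opNorm _) (abs_nonneg _)
  · refine fun n => Eventually.of_forall fun x => ?_
    rw [← mul_sub, ← sub_apply, abs_mul, norm_smul, mul_assoc, mul_comm ‖u x‖]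
    exact mul_le_mul_of_nonneg_left ((fderiv ℝ (φ n) x - weakGrad Ω G x).le_opNorm _)
      (abs_nonneg _)

theorem abs_mollify_le {K ε N : ℝ} {η f : R3 → ℝ} (hη : IsMollifier K ε η)
    (hN : ∀ᵐ x, |f x| ≤ N) (x : R3) : |mollify η f x| ≤ N := by
  have hi : Integrable fun y => η (x - y) :=
    (hη.contDiff.continuous.comp (by fun_prop)).integrable_of_hasCompactSupport
      (HasCompactSupport.comp_sub_left hη.hasCompactSupport x)
  have h : ‖mollify η f x‖ ≤ ∫ y, N * η (x - y) := by
    refine norm_integral_le_of_norm_le (hi.const_mul N) ?_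
    filter_upwards [hN] with y hy
    rw [norm_mul, Real.norm_of_nonneg (hη.nonneg _)]
    exact mul_le_mul_of_nonneg_right hy (hη.nonneg _)
  rwa [integral_const_mul, integral_sub_left_eq_self η volume x, hη.integral_eq_one, mul_one] at h

/-- The gradient of a mollification is the mollification of the weak gradient. -/
theorem fderiv_mollify_of_weak {K ε : ℝ} {η f : R3 → ℝ} {h : R3 → R3 →L[ℝ] ℝ}
    (hη : IsMollifier K ε η) (hf : LocallyIntegrable f)
    (hweak : ∀ φ : R3 → ℝ, IsTestFun ∞ univ φ → ∀ v : R3,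
      ∫ x, fderiv ℝ φ x v * f x = - ∫ x, φ x * h x v) (x v : R3) :
    fderiv ℝ (mollify η f) x v = mollify η (fun y => h y v) x := by
  have hφ : IsTestFun ∞ univ fun y => η (x - y) :=
    ⟨hη.contDiff.comp (contDiff_const.sub contDiff_id),
      HasCompactSupport.comp_sub_left hη.hasCompactSupport x, subset_univ _⟩
  have hd : ∀ y, fderiv ℝ (fun y => η (x - y)) y v = - fderiv ℝ η (x - y) v := fun y => by
    have h1 : HasFDerivAt (fun y => η (x - y)) _ y :=
      (hη.contDiff_one.differentiable one_ne_zero (x - y)).hasFDerivAt.comp y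
        ((hasFDerivAt_id y).const_sub x)
    rw [h1.fderiv]
    simp
  have h2 := hweak _ hφ v
  simp_rw [hd, neg_mul] at h2
  rw [integral_neg, neg_inj] at h2
  rw [fderiv_mollify hη hf, mollify]
  simp_rw [mul_comm (f _), mul_comm (h _ v)]
  exact h2

variable {M N : ℝ} {ρ : R3 → ℝ} {u : R3 → R3} {G : R3 → ℝ}

/-- Product rule for a localized bounded potential. -/
theorem integral_fderiv_mul_cutoff (hΩ : IsOpen Ω) (hG : IsWeakGradient Ω G (weakGrad Ω G))
    {χ : R3 → ℝ} (hχ : IsTestFun ∞ Ω χ) {φ : R3 → ℝ} (hφ : ContDiff ℝ ∞ φ) (v : R3) :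
    ∫ x in Ω, fderiv ℝ φ x v * (χ x * G x) =
      - ∫ x in Ω, φ x * (χ x * weakGrad Ω G x v + G x * fderiv ℝ χ x v) := by
  have hφχ : IsTestFun ∞ Ω fun x => χ x * φ x :=
    ⟨hχ.contDiff.mul hφ, HasCompactSupport.mul_right (f := χ) hχ.hasCompactSupport,
      (tsupport_mul_subset_left (f := χ) (g := φ)).trans hχ.tsupport_subset⟩
  have hχc := hχ.contDiff.continuous
  have hDφ : Continuous fun x => fderiv ℝ φ x v :=
    (hφ.continuous_fderiv (by simp)).clm_apply continuous_const
  have hDχ : Continuous fun x => fderiv ℝ χ x v :=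
    (hχ.contDiff.continuous_fderiv (by simp)).clm_apply continuous_const
  have hS : IsCompact (tsupport χ) := hχ.hasCompactSupport
  -- products of a locally integrable function with a continuous one vanishing off `supp χ`
  have hint : ∀ {f k : R3 → ℝ}, LocallyIntegrableOn f Ω → Continuous k →
      (∀ x ∉ tsupport χ, k x = 0) → IntegrableOn (fun x => k x * f x) Ω := by
    intro f k hf hk hk0
    have h1 : IntegrableOn (fun x => k x * f x) (tsupport χ) :=
      IntegrableOn.continuousOn_mul hk.continuousOn
        (hf.integrableOn_compact_subset hχ.tsupport_subset hS) hS
    refine IntegrableOn.of_forall_sdiff_eq_zero h1 hΩ.measurableSet fun x hx => ?_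
    rw [hk0 x hx.2, zero_mul]
  have hgv : LocallyIntegrableOn (fun x => weakGrad Ω G x v) Ω := fun x hx =>
    (hG.locallyIntegrableOn_grad x hx).imp fun s hs =>
      ⟨hs.1, (ContinuousLinearMap.apply ℝ ℝ v).integrable_comp hs.2⟩
  have i1 : IntegrableOn (fun x => fderiv ℝ φ x v * χ x * G x) Ω := hint hG.locallyIntegrableOn (hDφ.mul hχc) fun x hx => by
    simp [image_eq_zero_of_notMem_tsupport hx]
  have z : ∀ x ∉ tsupport χ, fderiv ℝ χ x = 0 := fun x hx => by
    by_contra hne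
    exact hx (support_fderiv_subset ℝ (Function.mem_support.2 hne))
  have i2 : IntegrableOn (fun x => φ x * fderiv ℝ χ x v * G x) Ω := hint hG.locallyIntegrableOn (hφ.continuous.mul hDχ) fun x hx => by
    simp [z x hx]
  have i3 : IntegrableOn (fun x => φ x * χ x * weakGrad Ω G x v) Ω := hint hgv (hφ.continuous.mul hχc) fun x hx => by
    simp [image_eq_zero_of_notMem_tsupport hx]
  have key := hG.integral_eq _ hφχ v
  have hd : ∀ x, fderiv ℝ (fun x => χ x * φ x) x v = fderiv ℝ φ x v * χ x + φ x * fderiv ℝ χ x v :=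
    fun x => by
      rw [fderiv_fun_mul (hχ.contDiff.differentiable (by simp) x)
        (hφ.differentiable (by simp) x)]
      simp
      ring
  have k1 : ∫ x in Ω, (fderiv ℝ (fun x => χ x * φ x) x v) • G x =
      (∫ x in Ω, fderiv ℝ φ x v * χ x * G x) + ∫ x in Ω, φ x * fderiv ℝ χ x v * G x := by
    rw [← integral_add i1 i2]
    refine integral_congr_ae (Eventually.of_forall fun x => ?_)
    simp only [hd, smul_eq_mul]
    ring
  have k2 : ∫ x in Ω, φ x * (χ x * weakGrad Ω G x v + G x * fderiv ℝ χ x v) =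
      (∫ x in Ω, φ x * χ x * weakGrad Ω G x v) + ∫ x in Ω, φ x * fderiv ℝ χ x v * G x := by
    rw [← integral_add i3 i2]
    refine integral_congr_ae (Eventually.of_forall fun x => ?_)
    simp only
    ring
  have k3 : ∫ x in Ω, (χ x * φ x) • weakGrad Ω G x v =
      ∫ x in Ω, φ x * χ x * weakGrad Ω G x v := by
    refine integral_congr_ae (Eventually.of_forall fun x => ?_)
    simp only [smul_eq_mul]
    ring
  rw [k1, k3] at key
  rw [k2]
  simp_rw [← mul_assoc]
  linarith

/-- The mass balance may be tested with a localized bounded potential: it is approximated by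
mollification. -/
theorem integral_mass_cutoff_potential (hΩ : IsOpen Ω) (hρu : IntegrableOn (fun x => ρ x • u x) Ω)
    (hρm : AEStronglyMeasurable ρ (volume.restrict Ω))
    (hum : AEStronglyMeasurable u (volume.restrict Ω))
    (hmass : ∀ φ : R3 → ℝ, IsTestFun ∞ univ φ → ∫ x in Ω, ρ x * fderiv ℝ φ x (u x) = 0)
    (hG : IsWeakGradient Ω G (weakGrad Ω G))
    (hGN : ∀ᵐ x ∂(volume.restrict Ω), |G x| ≤ N)
    (hgN : ∀ᵐ x ∂(volume.restrict Ω), ‖weakGrad Ω G x‖ ≤ N)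
    {χ : R3 → ℝ} (hχ : IsTestFun ∞ Ω χ) :
    ∫ x in Ω, ρ x * (χ x * weakGrad Ω G x (u x) + G x * fderiv ℝ χ x (u x)) = 0 := by
  have hΩm := hΩ.measurableSet
  set f : R3 → ℝ := Ω.indicator fun x => χ x * G x with hf
  set h : R3 → R3 →L[ℝ] ℝ := Ω.indicator fun x => χ x • weakGrad Ω G x + G x • fderiv ℝ χ x with hh
  obtain ⟨c, hc⟩ := hχ.contDiff.continuous.bounded_above_of_compact_support hχ.hasCompactSupport
  have hDχ := hχ.contDiff.continuous_fderiv (n := ∞) (by simp)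
  obtain ⟨c', hc'⟩ := hDχ.bounded_above_of_compact_support (hχ.hasCompactSupport.fderiv ℝ)
  have hc0 : 0 ≤ c := (norm_nonneg _).trans (hc 0)
  have hc0' : 0 ≤ c' := (norm_nonneg _).trans (hc' 0)
  have hGm : AEStronglyMeasurable G (volume.restrict Ω) :=
    hG.locallyIntegrableOn.aestronglyMeasurable
  have hgm : AEStronglyMeasurable (weakGrad Ω G) (volume.restrict Ω) :=
    hG.locallyIntegrableOn_grad.aestronglyMeasurable
  have hfm : AEStronglyMeasurable f := by
    rw [hf, aestronglyMeasurable_indicator_iff hΩm]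
    exact hχ.contDiff.continuous.aestronglyMeasurable.mul hGm
  have hhm : AEStronglyMeasurable h := by
    rw [hh, aestronglyMeasurable_indicator_iff hΩm]
    exact (hχ.contDiff.continuous.aestronglyMeasurable.smul hgm).add
      (hGm.smul hDχ.aestronglyMeasurable)
  rw [ae_restrict_iff' hΩm] at hGN hgN
  set B := (c + c') * |N|
  have hfB : ∀ᵐ x, |f x| ≤ B := by
    filter_upwards [hGN] with x hx
    by_cases hxΩ : x ∈ Ω
    · simp only [hf, indicator_of_mem hxΩ, abs_mul]
      refine mul_le_mul ((hc x).trans (by linarith)) ((hx hxΩ).trans (le_abs_self N))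
        (abs_nonneg _) (by positivity)
    · simp only [hf, indicator_of_notMem hxΩ, abs_zero, B]
      positivity
  have hhB : ∀ᵐ x, ‖h x‖ ≤ B := by
    filter_upwards [hGN, hgN] with x hx hx'
    by_cases hxΩ : x ∈ Ω
    · simp only [hh, indicator_of_mem hxΩ]
      refine (norm_add_le _ _).trans ?_
      rw [norm_smul, norm_smul]
      have a1 := mul_le_mul (hc x) ((hx' hxΩ).trans (le_abs_self N)) (norm_nonneg _) hc0
      have a2 := mul_le_mul (hc' x) ((hx hxΩ).trans (le_abs_self N)) (abs_nonneg _) hc0'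
      rw [Real.norm_eq_abs (G x)]
      calc _ ≤ c * |N| + c' * |N| := by linarith
        _ = B := by ring
    · simp only [hh, indicator_of_notMem hxΩ, norm_zero, B]
      positivity
  have hfl : LocallyIntegrable f :=
    (locallyIntegrable_const B).mono hfm (hfB.mono fun x hx => hx.trans (le_abs_self _))
  have hhv : ∀ v, LocallyIntegrable fun x => h x v := fun v => by
    refine (locallyIntegrable_const (B * ‖v‖)).mono
      (aestronglyMeasurable_apply hhm aestronglyMeasurable_const) (hhB.mono fun x hx => ?_)
    refine ((h x).le_opNorm v).trans (le_trans ?_ (le_abs_self _))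
    gcongr
  have hweak : ∀ φ : R3 → ℝ, IsTestFun ∞ univ φ → ∀ v : R3,
      ∫ x, fderiv ℝ φ x v * f x = - ∫ x, φ x * h x v := fun φ hφ v => by
    have := integral_fderiv_mul_cutoff hΩ hG hχ hφ.contDiff v
    rw [← integral_indicator hΩm, ← integral_indicator hΩm] at this
    have e1 : ∀ y, fderiv ℝ φ y v * f y = Ω.indicator (fun x => fderiv ℝ φ x v * (χ x * G x)) y :=
      fun y => by by_cases hy : y ∈ Ω <;> simp [f, hy]
    have e2 : ∀ y, φ y * h y v = Ω.indicator
        (fun x => φ x * (χ x * weakGrad Ω G x v + G x * fderiv ℝ χ x v)) y :=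
      fun y => by by_cases hy : y ∈ Ω <;> simp [h, hy]
    simp_rw [e1, e2]
    exact this
  obtain ⟨K, hK, hmoll⟩ := exists_isMollifier
  set e : ℕ → ℝ := fun j => 1 / ((j : ℝ) + 1)
  have he : ∀ j, 0 < e j := fun j => by positivity
  have hlim : Tendsto e atTop (𝓝 0) := tendsto_one_div_add_atTop_nhds_zero_nat
  have hlim' : Tendsto e atTop (𝓝[>] 0) :=
    tendsto_nhdsWithin_iff.2 ⟨hlim, Eventually.of_forall he⟩
  choose η hη using fun j => hmoll (e j) (he j)
  have hfc : HasCompactSupport f := by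
    refine hχ.hasCompactSupport.mono fun x hx hx0 => hx ?_
    simp only [hf]
    by_cases hxΩ : x ∈ Ω
    · rw [indicator_of_mem hxΩ, hx0, zero_mul]
    · rw [indicator_of_notMem hxΩ]
  have hm : ∀ j, IsTestFun ∞ univ (mollify (η j) f) := fun j =>
    ⟨contDiff_mollify (hη j) hfl, hasCompactSupport_mollify (hη j) hfc, subset_univ _⟩
  have hexp : ∀ j x, fderiv ℝ (mollify (η j) f) x (u x) =
      ∑ i, u x i * mollify (η j) (fun y => h y (EuclideanSpace.single i 1)) x := fun j x => by
    rw [apply_eq_sum]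
    simp_rw [fderiv_mollify_of_weak (hη j) hfl hweak]
  have hae : ∀ᵐ x ∂(volume.restrict Ω), ∀ i : Fin 3,
      Tendsto (fun j => mollify (η j) (fun y => h y (EuclideanSpace.single i 1)) x) atTop
        (𝓝 (h x (EuclideanSpace.single i 1))) :=
    ae_restrict_of_ae (ae_all_iff.2 fun i => ae_tendsto_mollify (hhv _) hη hlim')
  have t : Tendsto (fun j => ∫ x in Ω, ρ x * fderiv ℝ (mollify (η j) f) x (u x)) atTop
      (𝓝 (∫ x in Ω, ρ x * h x (u x))) := by
    refine tendsto_integral_of_dominated_convergence (fun x => 3 * B * ‖ρ x • u x‖) (fun j => ?_)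
      (hρu.norm.const_mul _) (fun j => Eventually.of_forall fun x => ?_) ?_
    · exact hρm.mul (aestronglyMeasurable_apply
        ((hm j).contDiff.continuous_fderiv (by simp)).aestronglyMeasurable hum)
    · have hb : ∀ i : Fin 3, |u x i * mollify (η j) (fun y => h y (EuclideanSpace.single i 1)) x| ≤
          ‖u x‖ * B := fun i => by
        rw [abs_mul]
        refine mul_le_mul (PiLp.norm_apply_le (u x) i) (abs_mollify_le (hη j) ?_ x) (abs_nonneg _)
          (norm_nonneg _)
        filter_upwards [hhB] with y hy
        refine ((h y).le_opNorm _).trans ?_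
        simpa using hy
      rw [norm_mul, hexp, norm_smul]
      have h3 : |∑ i, u x i * mollify (η j) (fun y => h y (EuclideanSpace.single i 1)) x| ≤
          3 * (‖u x‖ * B) := by
        refine (Finset.abs_sum_le_sum_abs _ _).trans ?_
        refine (Finset.sum_le_card_nsmul _ _ _ fun i _ => hb i).trans (by simp)
      calc _ ≤ ‖ρ x‖ * (3 * (‖u x‖ * B)) := mul_le_mul_of_nonneg_left h3 (norm_nonneg _)
        _ = _ := by ring
    · filter_upwards [hae] with x hx
      refine Tendsto.const_mul _ ?_
      simp_rw [hexp]
      rw [apply_eq_sum (h x)]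
      exact tendsto_finsetSum _ fun i _ => (hx i).const_mul _
  simp_rw [fun j => hmass _ (hm j)] at t
  rw [← tendsto_nhds_unique t tendsto_const_nhds]
  refine setIntegral_congr_fun hΩm fun x hx => ?_
  simp [hh, hx]

end Force

/-! ### Potentials that do not vanish on the boundary -/

section BoundedPotential

variable {Ω : Set R3} {ε : ℝ}

/-- The smooth function `|y|² / (|y|² + ε)`, vanishing at the origin and tending to one elsewhere
as `ε → 0`. Composed with a test field it localizes to the set where the field is nonzero. -/
noncomputable def speedCutoff (ε : ℝ) (y : R3) : ℝ := ‖y‖ ^ 2 / (‖y‖ ^ 2 + ε)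

/-- The gradient of `speedCutoff`. -/
noncomputable def speedCutoffGrad (ε : ℝ) (y : R3) : R3 := (2 * ε / (‖y‖ ^ 2 + ε) ^ 2) • y

theorem contDiff_speedCutoff (hε : 0 < ε) : ContDiff ℝ ∞ (speedCutoff ε) := by
  have h : ContDiff ℝ ∞ fun y : R3 => ‖y‖ ^ 2 := contDiff_id.norm_sq ℝ
  exact h.div (h.add contDiff_const) fun y => by positivity

theorem continuous_speedCutoffGrad (hε : 0 < ε) : Continuous (speedCutoffGrad ε) := by
  have h : Continuous fun y : R3 => 2 * ε / (‖y‖ ^ 2 + ε) ^ 2 :=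
    continuous_const.div (by fun_prop) fun y => by positivity
  exact h.smul continuous_id

theorem abs_speedCutoff_le (hε : 0 < ε) (y : R3) : |speedCutoff ε y| ≤ 1 := by
  rw [speedCutoff, abs_of_nonneg (by positivity), div_le_one (by positivity)]
  linarith

theorem norm_speedCutoffGrad_eq (hε : 0 < ε) (y : R3) :
    ‖speedCutoffGrad ε y‖ = 2 * ε * ‖y‖ / (‖y‖ ^ 2 + ε) ^ 2 := by
  rw [speedCutoffGrad, norm_smul, Real.norm_of_nonneg (by positivity)]
  ring

theorem norm_speedCutoffGrad_le (hε : 0 < ε) (hε1 : ε ≤ 1) (y : R3) :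
    ‖speedCutoffGrad ε y‖ ≤ 1 / ε := by
  rw [norm_speedCutoffGrad_eq hε, div_le_div_iff₀ (by positivity) hε]
  set s := ‖y‖
  have h1 : 2 * s ≤ s ^ 2 + 1 := by nlinarith [sq_nonneg (s - 1)]
  have h2 : ε * (s ^ 2 + 1) ≤ s ^ 2 + ε := by nlinarith [sq_nonneg s]
  have h3 : ε * (ε * (s ^ 2 + 1)) ≤ (s ^ 2 + ε) ^ 2 := by
    rw [sq (s ^ 2 + ε)]
    refine mul_le_mul ?_ h2 (by positivity) (by positivity)
    nlinarith [sq_nonneg s]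
  calc 2 * ε * s * ε = ε * (ε * (2 * s)) := by ring
    _ ≤ ε * (ε * (s ^ 2 + 1)) := by gcongr
    _ ≤ 1 * (s ^ 2 + ε) ^ 2 := by linarith

/-- The product of `|y|` and the gradient of `speedCutoff ε` is bounded uniformly in `ε`. -/
theorem norm_mul_norm_speedCutoffGrad_le (hε : 0 < ε) (y : R3) :
    ‖y‖ * ‖speedCutoffGrad ε y‖ ≤ 1 := by
  rw [norm_speedCutoffGrad_eq hε, ← mul_div_assoc, div_le_one (by positivity)]
  nlinarith [sq_nonneg (‖y‖ ^ 2 - ε), sq_nonneg ‖y‖]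

theorem fderiv_speedCutoff_comp (hε : 0 < ε) {w : R3 → R3} {x : R3} (hw : DifferentiableAt ℝ w x)
    (v : R3) :
    fderiv ℝ (fun x => speedCutoff ε (w x)) x v = inner ℝ (speedCutoffGrad ε (w x))
      (fderiv ℝ w x v) := by
  have h1 : HasFDerivAt (fun x => ‖w x‖ ^ 2) _ x := hw.hasFDerivAt.norm_sq
  have h2 : HasDerivAt (fun s : ℝ => s / (s + ε)) (ε / (‖w x‖ ^ 2 + ε) ^ 2) (‖w x‖ ^ 2) := by
    have h := (hasDerivAt_id (‖w x‖ ^ 2)).div ((hasDerivAt_id (‖w x‖ ^ 2)).add_const ε)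
      (by simp only [id]; positivity)
    refine h.congr_deriv ?_
    simp
  have h3 := h2.comp_hasFDerivAt x h1
  rw [show (fun x => speedCutoff ε (w x)) = (fun s : ℝ => s / (s + ε)) ∘ (fun x => ‖w x‖ ^ 2)
    from rfl, h3.fderiv]
  simp [speedCutoffGrad, inner_smul_left]
  ring

theorem IsTestFun.speedCutoff_comp (hε : 0 < ε) {w : R3 → R3} (hw : IsTestFun ∞ Ω w) :
    IsTestFun ∞ Ω fun x => speedCutoff ε (w x) := by
  have hs : tsupport (fun x => speedCutoff ε (w x)) ⊆ tsupport w := by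
    refine closure_mono fun x hx hx0 => hx ?_
    simp only [speedCutoff, hx0]
    simp
  exact ⟨(contDiff_speedCutoff hε).comp hw.contDiff,
    hw.hasCompactSupport.of_isClosed_subset (isClosed_tsupport _) hs,
    hs.trans hw.tsupport_subset⟩

variable {N : ℝ} {ρ : R3 → ℝ} {u : R3 → R3} {G : R3 → ℝ} {A : R3 → R3 →L[ℝ] R3}
  {w : ℕ → R3 → R3}

/-- The mass balance tested with a bounded potential, localized to the set where the velocity is
nonzero. -/
theorem integral_mass_speedCutoff (hε : 0 < ε) (hε1 : ε ≤ 1) (hΩ : IsOpen Ω)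
    (hρm : AEStronglyMeasurable ρ (volume.restrict Ω))
    (hum : AEStronglyMeasurable u (volume.restrict Ω))
    (hρu : IntegrableOn (fun x => ρ x • u x) Ω)
    (hρu2 : MemLp (fun x => ρ x • u x) 2 (volume.restrict Ω))
    (hA : MemLp A 2 (volume.restrict Ω)) (hw : ∀ n, IsTestFun ∞ Ω (w n))
    (hwu : ∀ᵐ x ∂(volume.restrict Ω), Tendsto (fun n => w n x) atTop (𝓝 (u x)))
    (hwA : Tendsto (fun n => eLpNorm (fun x => fderiv ℝ (w n) x - A x) 2 (volume.restrict Ω))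
      atTop (𝓝 0))
    (hmass : ∀ φ : R3 → ℝ, IsTestFun ∞ univ φ → ∫ x in Ω, ρ x * fderiv ℝ φ x (u x) = 0)
    (hG : IsWeakGradient Ω G (weakGrad Ω G))
    (hGN : ∀ᵐ x ∂(volume.restrict Ω), |G x| ≤ N)
    (hgN : ∀ᵐ x ∂(volume.restrict Ω), ‖weakGrad Ω G x‖ ≤ N) :
    (∫ x in Ω, ρ x * (speedCutoff ε (u x) * weakGrad Ω G x (u x))) +
      ∫ x in Ω, ρ x * (G x * inner ℝ (speedCutoffGrad ε (u x)) (A x (u x))) = 0 := by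
  have hGm : AEStronglyMeasurable G (volume.restrict Ω) :=
    hG.locallyIntegrableOn.aestronglyMeasurable
  have hgm : AEStronglyMeasurable (weakGrad Ω G) (volume.restrict Ω) :=
    hG.locallyIntegrableOn_grad.aestronglyMeasurable
  have hgu := aestronglyMeasurable_apply hgm hum
  have hwm : ∀ n, AEStronglyMeasurable (w n) (volume.restrict Ω) := fun n =>
    (hw n).contDiff.continuous.aestronglyMeasurable
  have hDm : ∀ n, AEStronglyMeasurable (fderiv ℝ (w n)) (volume.restrict Ω) := fun n =>
    ((hw n).contDiff.continuous_fderiv (by simp)).aestronglyMeasurable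
  have hD2 : ∀ n, MemLp (fderiv ℝ (w n)) 2 (volume.restrict Ω) := fun n =>
    (memLp_of_continuous ((hw n).contDiff.continuous_fderiv (by simp))
      ((hw n).hasCompactSupport.fderiv ℝ) 2).restrict _
  have hκ : ∀ n, AEStronglyMeasurable (fun x => speedCutoffGrad ε (w n x)) (volume.restrict Ω) :=
    fun n => (continuous_speedCutoffGrad hε).comp_aestronglyMeasurable (hwm n)
  have hq : ∀ n, AEStronglyMeasurable (fun x => speedCutoff ε (w n x)) (volume.restrict Ω) :=
    fun n => (contDiff_speedCutoff hε).continuous.comp_aestronglyMeasurable (hwm n)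
  -- pointwise bounds
  have b1 : ∀ᵐ x ∂(volume.restrict Ω), ∀ y, |ρ x * (speedCutoff ε y * weakGrad Ω G x (u x))| ≤
      N * ‖ρ x • u x‖ := by
    filter_upwards [hgN] with x hx y
    rw [abs_mul, abs_mul, norm_smul]
    have h1 : |weakGrad Ω G x (u x)| ≤ N * ‖u x‖ :=
      ((weakGrad Ω G x).le_opNorm _).trans (mul_le_mul_of_nonneg_right hx (norm_nonneg _))
    calc _ ≤ |ρ x| * (1 * (N * ‖u x‖)) := by
          gcongr
          exact abs_speedCutoff_le hε y
      _ = _ := by rw [Real.norm_eq_abs]; ring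
  have b2 : ∀ᵐ x ∂(volume.restrict Ω), ∀ (y : R3) (B : R3 →L[ℝ] R3),
      |ρ x * (G x * inner ℝ (speedCutoffGrad ε y) (B (u x)))| ≤
        ‖(N * (1 / ε)) • (ρ x • u x)‖ * ‖B‖ := by
    filter_upwards [hGN] with x hx y B
    have hN : 0 ≤ N := (abs_nonneg _).trans hx
    rw [abs_mul, abs_mul, norm_smul, norm_smul, Real.norm_of_nonneg (by positivity)]
    have h1 : |inner ℝ (speedCutoffGrad ε y) (B (u x))| ≤ 1 / ε * (‖B‖ * ‖u x‖) :=
      (abs_real_inner_le_norm _ _).trans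
        (mul_le_mul (norm_speedCutoffGrad_le hε hε1 y) (B.le_opNorm _) (norm_nonneg _)
          (by positivity))
    calc _ ≤ |ρ x| * (N * (1 / ε * (‖B‖ * ‖u x‖))) := by gcongr
      _ = _ := by rw [Real.norm_eq_abs]; ring
  have hh2 := hρu2.const_smul (N * (1 / ε))
  have hcm : ∀ n {B : R3 → R3 →L[ℝ] R3}, AEStronglyMeasurable B (volume.restrict Ω) →
      AEStronglyMeasurable (fun x => ρ x * (G x * inner ℝ (speedCutoffGrad ε (w n x))
        (B x (u x)))) (volume.restrict Ω) := fun n B hB =>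
    hρm.mul (hGm.mul ((hκ n).inner (aestronglyMeasurable_apply hB hum)))
  have hci : ∀ n {B : R3 → R3 →L[ℝ] R3}, MemLp B 2 (volume.restrict Ω) →
      Integrable (fun x => ρ x * (G x * inner ℝ (speedCutoffGrad ε (w n x)) (B x (u x))))
        (volume.restrict Ω) := fun n B hB => by
    refine integrable_of_holder 2 2 hh2 hB (hcm n hB.1) ?_
    filter_upwards [b2] with x hx using hx _ _
  have i1 : ∀ n, Integrable (fun x => ρ x * (speedCutoff ε (w n x) * weakGrad Ω G x (u x)))
      (volume.restrict Ω) := fun n => by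
    refine (hρu.norm.const_mul N).mono' (hρm.mul ((hq n).mul hgu)) ?_
    filter_upwards [b1] with x hx using hx _
  have t1 : Tendsto (fun n => ∫ x in Ω, ρ x * (speedCutoff ε (w n x) * weakGrad Ω G x (u x))) atTop
      (𝓝 (∫ x in Ω, ρ x * (speedCutoff ε (u x) * weakGrad Ω G x (u x)))) := by
    refine tendsto_integral_of_dominated_convergence (fun x => N * ‖ρ x • u x‖)
      (fun n => (i1 n).1) (hρu.norm.const_mul N) (fun n => ?_) ?_
    · filter_upwards [b1] with x hx using hx _
    · filter_upwards [hwu] with x hx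
      exact ((((contDiff_speedCutoff hε).continuous.tendsto _).comp hx).mul_const _).const_mul _
  have t2 : Tendsto (fun n => ∫ x in Ω, ρ x * (G x * inner ℝ (speedCutoffGrad ε (w n x))
      (A x (u x)))) atTop
      (𝓝 (∫ x in Ω, ρ x * (G x * inner ℝ (speedCutoffGrad ε (u x)) (A x (u x))))) := by
    refine tendsto_integral_of_dominated_convergence
      (fun x => ‖(N * (1 / ε)) • (ρ x • u x)‖ * ‖A x‖) (fun n => (hci n hA).1) ?_ (fun n => ?_) ?_
    · refine integrable_of_holder 2 2 hh2 hA (hh2.1.norm.mul hA.1.norm)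
        (Eventually.of_forall fun x => le_of_eq (abs_of_nonneg (by positivity)))
    · filter_upwards [b2] with x hx using hx _ _
    · filter_upwards [hwu] with x hx
      have := ((continuous_speedCutoffGrad hε).tendsto _).comp hx
      exact ((this.inner tendsto_const_nhds).const_mul _).const_mul _
  have t3 : Tendsto (fun n => ∫ x in Ω, ρ x * (G x * inner ℝ (speedCutoffGrad ε (w n x))
      ((fderiv ℝ (w n) x - A x) (u x)))) atTop (𝓝 (∫ _ in Ω, (0 : ℝ))) := by
    refine tendsto_integral_of_holder 2 2 hh2 (fun n => (hDm n).sub hA.1) hwA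
      aestronglyMeasurable_const (fun n => hci n ((hD2 n).sub hA)) (fun n => ?_)
    filter_upwards [b2] with x hx
    rw [sub_zero]
    exact hx _ _
  have hsum := (t1.add t2).add t3
  rw [integral_zero, add_zero] at hsum
  refine tendsto_nhds_unique hsum ?_
  refine tendsto_const_nhds.congr fun n => ?_
  have i12 : Integrable (fun x => ρ x * (speedCutoff ε (w n x) * weakGrad Ω G x (u x)) +
      ρ x * (G x * inner ℝ (speedCutoffGrad ε (w n x)) (A x (u x)))) (volume.restrict Ω) :=
    (i1 n).add (hci n hA)
  have i3 : Integrable (fun x => ρ x * (G x * inner ℝ (speedCutoffGrad ε (w n x))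
      ((fderiv ℝ (w n) x - A x) (u x)))) (volume.restrict Ω) := hci n ((hD2 n).sub hA)
  rw [← integral_mass_cutoff_potential hΩ hρu hρm hum hmass hG hGN hgN
    ((hw n).speedCutoff_comp hε), ← integral_add (i1 n) (hci n hA),
    ← integral_add i12 i3]
  refine integral_congr_ae (Eventually.of_forall fun x => ?_)
  beta_reduce
  rw [fderiv_speedCutoff_comp hε ((hw n).contDiff.differentiable (by simp) x), sub_apply,
    inner_sub_right]
  ring

/-- A bounded Lipschitz potential does no work along a divergence free flux `ρ u` even if it does
not vanish on the boundary, because the velocity does: `∫ ρ u · ∇G |u|² / (|u|² + ε)` is the integral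
of a function that is dominated by `ρ |G| |∇u|` and tends to zero pointwise as `ε → 0`. -/
theorem integral_force_eq_zero_of_bounded (hΩ : IsOpen Ω)
    (hρ2 : MemLp ρ 2 (volume.restrict Ω))
    (hum : AEStronglyMeasurable u (volume.restrict Ω))
    (hρu : IntegrableOn (fun x => ρ x • u x) Ω)
    (hρu2 : MemLp (fun x => ρ x • u x) 2 (volume.restrict Ω))
    (hA : MemLp A 2 (volume.restrict Ω)) (hw : ∀ n, IsTestFun ∞ Ω (w n))
    (hwu : ∀ᵐ x ∂(volume.restrict Ω), Tendsto (fun n => w n x) atTop (𝓝 (u x)))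
    (hwA : Tendsto (fun n => eLpNorm (fun x => fderiv ℝ (w n) x - A x) 2 (volume.restrict Ω))
      atTop (𝓝 0))
    (hmass : ∀ φ : R3 → ℝ, IsTestFun ∞ univ φ → ∫ x in Ω, ρ x * fderiv ℝ φ x (u x) = 0)
    (hG : IsWeakGradient Ω G (weakGrad Ω G))
    (hGN : ∀ᵐ x ∂(volume.restrict Ω), |G x| ≤ N)
    (hgN : ∀ᵐ x ∂(volume.restrict Ω), ‖weakGrad Ω G x‖ ≤ N) :
    ∫ x in Ω, ρ x * weakGrad Ω G x (u x) = 0 := by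
  have hρm := hρ2.1
  have hGm : AEStronglyMeasurable G (volume.restrict Ω) :=
    hG.locallyIntegrableOn.aestronglyMeasurable
  have hgu := aestronglyMeasurable_apply
    (hG.locallyIntegrableOn_grad.aestronglyMeasurable (f := weakGrad Ω G)) hum
  set e : ℕ → ℝ := fun j => 1 / ((j : ℝ) + 1)
  have he : ∀ j, 0 < e j := fun j => by positivity
  have he1 : ∀ j, e j ≤ 1 := fun j => by
    rw [div_le_one (by positivity)]
    have : (0 : ℝ) ≤ j := by positivity
    linarith
  have hlim : Tendsto e atTop (𝓝 0) := tendsto_one_div_add_atTop_nhds_zero_nat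
  have key := fun j => integral_mass_speedCutoff (he j) (he1 j) hΩ hρm hum hρu hρu2 hA hw hwu hwA
    hmass hG hGN hgN
  have t1 : Tendsto (fun j => ∫ x in Ω, ρ x * (speedCutoff (e j) (u x) * weakGrad Ω G x (u x))) atTop
      (𝓝 (∫ x in Ω, ρ x * weakGrad Ω G x (u x))) := by
    refine tendsto_integral_of_dominated_convergence (fun x => N * ‖ρ x • u x‖) (fun j => ?_)
      (hρu.norm.const_mul N) (fun j => ?_) (Eventually.of_forall fun x => ?_)
    · exact hρm.mul (((contDiff_speedCutoff (he j)).continuous.comp_aestronglyMeasurable hum).mul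
        hgu)
    · filter_upwards [hgN] with x hx
      rw [norm_mul, norm_mul, norm_smul]
      have h1 : ‖weakGrad Ω G x (u x)‖ ≤ N * ‖u x‖ :=
        ((weakGrad Ω G x).le_opNorm _).trans (mul_le_mul_of_nonneg_right hx (norm_nonneg _))
      calc _ ≤ ‖ρ x‖ * (1 * (N * ‖u x‖)) := by
            gcongr
            exact abs_speedCutoff_le (he j) (u x)
        _ = _ := by ring
    · refine Tendsto.const_mul _ ?_
      rcases eq_or_ne (u x) 0 with h | h
      · simp [h]
      · have h0 : ‖u x‖ ^ 2 ≠ 0 := by positivity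
        have h1 : Tendsto (fun j => ‖u x‖ ^ 2 / (‖u x‖ ^ 2 + e j)) atTop
            (𝓝 (‖u x‖ ^ 2 / (‖u x‖ ^ 2 + 0))) :=
          tendsto_const_nhds.div (tendsto_const_nhds.add hlim) (by simpa using h0)
        rw [add_zero, div_self h0] at h1
        simpa [speedCutoff] using h1.mul_const (weakGrad Ω G x (u x))
  have t2 : Tendsto (fun j => ∫ x in Ω, ρ x * (G x * inner ℝ (speedCutoffGrad (e j) (u x))
      (A x (u x)))) atTop (𝓝 (∫ _ in Ω, (0 : ℝ))) := by
    refine tendsto_integral_of_dominated_convergence (fun x => ‖N • ρ x‖ * ‖A x‖) (fun j => ?_)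
      ?_ (fun j => ?_) (Eventually.of_forall fun x => ?_)
    · exact hρm.mul (hGm.mul (((continuous_speedCutoffGrad (he j)).comp_aestronglyMeasurable
        hum).inner (aestronglyMeasurable_apply hA.1 hum)))
    · have hN2 : MemLp (fun x => N • ρ x) 2 (volume.restrict Ω) := hρ2.const_smul N
      exact integrable_of_holder 2 2 hN2 hA (hN2.1.norm.mul hA.1.norm)
        (Eventually.of_forall fun x => le_of_eq (abs_of_nonneg (by positivity)))
    · filter_upwards [hGN] with x hx
      have hN : 0 ≤ N := (abs_nonneg _).trans hx
      have h1 : ‖inner ℝ (speedCutoffGrad (e j) (u x)) (A x (u x))‖ ≤ ‖A x‖ := by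
        calc _ ≤ ‖speedCutoffGrad (e j) (u x)‖ * ‖A x (u x)‖ := norm_inner_le_norm _ _
          _ ≤ ‖speedCutoffGrad (e j) (u x)‖ * (‖A x‖ * ‖u x‖) := by
              gcongr
              exact (A x).le_opNorm _
          _ = ‖A x‖ * (‖u x‖ * ‖speedCutoffGrad (e j) (u x)‖) := by ring
          _ ≤ ‖A x‖ * 1 := by
              gcongr
              exact norm_mul_norm_speedCutoffGrad_le (he j) (u x)
          _ = _ := mul_one _
      rw [norm_mul, norm_mul, norm_smul, Real.norm_of_nonneg hN]
      calc _ ≤ ‖ρ x‖ * (N * ‖A x‖) := by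
            gcongr
            exact hx
        _ = _ := by ring
    · have h1 : Tendsto (fun j => speedCutoffGrad (e j) (u x)) atTop (𝓝 0) := by
        rcases eq_or_ne (u x) 0 with h | h
        · simp [speedCutoffGrad, h]
        · have h0 : ‖u x‖ ^ 2 ≠ 0 := by positivity
          have h2 : Tendsto (fun j => 2 * e j / (‖u x‖ ^ 2 + e j) ^ 2) atTop
              (𝓝 (2 * 0 / (‖u x‖ ^ 2 + 0) ^ 2)) :=
            (hlim.const_mul 2).div ((tendsto_const_nhds.add hlim).pow 2) (by simpa using h0)
          have h3 := h2.smul_const (u x)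
          simpa [speedCutoffGrad] using h3
      have h2 := ((h1.inner (tendsto_const_nhds (x := A x (u x)))).const_mul (G x)).const_mul (ρ x)
      simpa using h2
  have t3 := t1.add t2
  simp_rw [key] at t3
  rw [integral_zero, add_zero] at t3
  exact tendsto_nhds_unique t3 tendsto_const_nhds

end BoundedPotential

/-! ### Integrability from finite energy -/

section Energy

theorem integrable_of_energy {α : Type*} [MeasurableSpace α] {ν : Measure α} {P b : ℝ → ℝ}
    (hb : Continuous b) (hbP : ∀ s, 0 ≤ s → b s = P s) {ρ : α → ℝ} {u : α → R3}
    (hρ : AEStronglyMeasurable ρ ν) (hu : AEStronglyMeasurable u ν) (h0 : ∀ᵐ x ∂ν, 0 ≤ ρ x)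
    (hP0 : ∀ᵐ x ∂ν, 0 ≤ P (ρ x)) (hE : Integrable (fun x => energy P (ρ x) (u x)) ν) :
    Integrable (fun x => ρ x * ‖u x‖ ^ 2) ν ∧ Integrable (fun x => P (ρ x)) ν := by
  have hPm : AEStronglyMeasurable (fun x => P (ρ x)) ν := by
    refine (hb.comp_aestronglyMeasurable hρ).congr ?_
    filter_upwards [h0] with x hx using hbP _ hx
  constructor
  · refine (hE.const_mul 2).mono' (hρ.mul (hu.norm.pow 2)) ?_
    filter_upwards [h0, hP0] with x h1 h2
    rw [Real.norm_of_nonneg (by positivity), energy]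
    linarith
  · refine hE.mono' hPm ?_
    filter_upwards [h0, hP0] with x h1 h2
    rw [Real.norm_of_nonneg h2, energy]
    have : 0 ≤ ρ x * ‖u x‖ ^ 2 := by positivity
    linarith

theorem memLp_two_of_integrable_of_le {α : Type*} [MeasurableSpace α] {ν : Measure α} {E : Type*}
    [NormedAddCommGroup E] {f : α → E} {g : α → ℝ} (hf : AEStronglyMeasurable f ν)
    (hg : Integrable g ν) (h : ∀ᵐ x ∂ν, ‖f x‖ ^ 2 ≤ g x) : MemLp f 2 ν := by
  rw [memLp_two_iff_integrable_sq_norm hf]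
  refine hg.mono' (hf.norm.pow 2) ?_
  filter_upwards [h] with x hx
  rwa [Real.norm_of_nonneg (by positivity)]

end Energy

section Limits

variable {Ω : Set R3} {M μ η : ℝ} {ρ : R3 → ℝ} {u : R3 → R3} {A : R3 → R3 →L[ℝ] R3}
  {w : ℕ → R3 → R3} {b b' : ℝ → ℝ}

/-! ### The work of the pressure -/

theorem tendsto_eLpNorm_indicator {α F : Type*} [MeasurableSpace α] {ν : Measure α}
    [NormedAddCommGroup F] {s : Set α} (hs : MeasurableSet s) {p : ℝ≥0∞} {f : ℕ → α → F} {g : α → F}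
    (hf : ∀ n, ∀ x ∉ s, f n x = 0)
    (h : Tendsto (fun n => eLpNorm (fun x => f n x - g x) p (ν.restrict s)) atTop (𝓝 0)) :
    Tendsto (fun n => eLpNorm (fun x => f n x - s.indicator g x) p ν) atTop (𝓝 0) := by
  refine h.congr fun n => ?_
  rw [← eLpNorm_indicator_eq_eLpNorm_restrict hs]
  congr 1
  ext x
  by_cases hx : x ∈ s
  · simp [hx]
  · simp [hx, hf n x hx]

/-- The pressure does no work: `integral_pressure_work_eq_zero` for fields extended by zero outside
`Ω`. -/
theorem setIntegral_pressure_work_eq_zero (hΩ : MeasurableSet Ω)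
    (hρ : AEMeasurable ρ (volume.restrict Ω)) (h0 : ∀ᵐ x ∂(volume.restrict Ω), 0 ≤ ρ x)
    (hM : ∀ᵐ x ∂(volume.restrict Ω), ρ x ≤ M)
    (hu : AEStronglyMeasurable u (volume.restrict Ω))
    (hA : AEStronglyMeasurable A (volume.restrict Ω)) (hw : ∀ n, IsTestFun ∞ Ω (w n))
    (hwu : Tendsto (fun n => eLpNorm (fun x => w n x - u x) 6 (volume.restrict Ω)) atTop (𝓝 0))
    (hwA : Tendsto (fun n => eLpNorm (fun x => fderiv ℝ (w n) x - A x) 2 (volume.restrict Ω))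
      atTop (𝓝 0))
    (hmass : ∀ φ : R3 → ℝ, IsTestFun ∞ univ φ → ∫ x in Ω, ρ x * fderiv ℝ φ x (u x) = 0)
    (hb' : Continuous b') (hb : ∀ s, HasDerivAt b (b' s) s)
    (hflux : IntegrableOn (fun x => b (ρ x) • u x) Ω)
    (hwork : IntegrableOn (fun x => (b' (ρ x) * ρ x - b (ρ x)) * (jac (A x)).trace) Ω) :
    ∫ x in Ω, (b' (ρ x) * ρ x - b (ρ x)) * (jac (A x)).trace = 0 := by
  -- a measurable representative of the density with values in `[0, max M 0]`
  set r : R3 → ℝ := fun x => min (max (hρ.mk ρ x) 0) (max M 0) with hr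
  have hrm : Measurable r := (hρ.measurable_mk.max measurable_const).min measurable_const
  have hρr : ∀ᵐ x ∂(volume.restrict Ω), ρ x = r x := by
    filter_upwards [hρ.ae_eq_mk, h0, hM] with x h1 h2 h3
    simp only [hr, ← h1]
    rw [max_eq_left h2, min_eq_left (h3.trans (le_max_left _ _))]
  have htr : (jac 0).trace = 0 := by simp [jac, Matrix.trace]
  have e1 : ∀ φ : R3 → ℝ, (fun x => r x * fderiv ℝ φ x (Ω.indicator u x)) =
      Ω.indicator fun x => r x * fderiv ℝ φ x (u x) := fun φ => by
    ext x
    by_cases hx : x ∈ Ω <;> simp [hx]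
  have e2 : (fun x => b (r x) • Ω.indicator u x) = Ω.indicator fun x => b (r x) • u x := by
    ext x
    by_cases hx : x ∈ Ω <;> simp [hx]
  have e3 : (fun x => (b' (r x) * r x - b (r x)) * (jac (Ω.indicator A x)).trace) =
      Ω.indicator fun x => (b' (r x) * r x - b (r x)) * (jac (A x)).trace := by
    ext x
    by_cases hx : x ∈ Ω <;> simp [hx, htr]
  have key := integral_pressure_work_eq_zero (M := max M 0) (u := Ω.indicator u)
    (A := Ω.indicator A) (w := w) hrm (fun x => le_min (le_max_right _ _) (le_max_right _ _))
    (fun x => min_le_right _ _) ((aestronglyMeasurable_indicator_iff hΩ).2 hu)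
    ((aestronglyMeasurable_indicator_iff hΩ).2 hA) (fun n => (hw n).mono le_rfl (subset_univ _))
    (tendsto_eLpNorm_indicator hΩ (fun n x hx => (hw n).eq_zero hx) hwu)
    (tendsto_eLpNorm_indicator hΩ (fun n x hx => (hw n).fderiv_eq_zero hx) hwA)
    (fun φ hφ => by
      rw [e1, integral_indicator hΩ, ← hmass φ hφ]
      refine integral_congr_ae ?_
      filter_upwards [hρr] with x hx
      rw [hx]) hb' hb
    (by
      rw [e2, integrable_indicator_iff hΩ]
      refine hflux.congr ?_
      filter_upwards [hρr] with x hx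
      rw [hx])
    (by
      rw [e3, integrable_indicator_iff hΩ]
      refine hwork.congr ?_
      filter_upwards [hρr] with x hx
      rw [hx])
  rw [e3, integral_indicator hΩ] at key
  rw [← key]
  refine integral_congr_ae ?_
  filter_upwards [hρr] with x hx
  rw [hx]

/-! ### The convective term -/

theorem contract_tensor_jac (a : R3) (D : R3 →L[ℝ] R3) :
    contract (tensor a a) (jac D) = inner ℝ a (D a) := by
  have h : ∀ i, D a i = ∑ j, a j * D (EuclideanSpace.single j 1) i := fun i =>
    apply_eq_sum ((EuclideanSpace.proj i : R3 →L[ℝ] ℝ).comp D) a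
  simp only [contract, tensor, jac, Matrix.of_apply, PiLp.inner_apply, RCLike.inner_apply,
    conj_trivial, h, Finset.sum_mul]
  refine Finset.sum_congr rfl fun i _ => Finset.sum_congr rfl fun j _ => ?_
  ring

/-- Testing the mass balance with `|w|² / 2`. -/
theorem integral_mass_kinetic {v : R3 → R3} (hv : IsTestFun ∞ Ω v)
    (hmass : ∀ φ : R3 → ℝ, IsTestFun ∞ univ φ → ∫ x in Ω, ρ x * fderiv ℝ φ x (u x) = 0) :
    ∫ x in Ω, ρ x * inner ℝ (v x) (fderiv ℝ v x (u x)) = 0 := by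
  have h1 : IsTestFun ∞ univ fun x => ‖v x‖ ^ 2 := by
    refine ⟨hv.contDiff.norm_sq ℝ, hv.hasCompactSupport.mono fun x hx hx0 => hx ?_, subset_univ _⟩
    simp [hx0]
  have h2 := hmass _ h1
  have h3 : ∀ x, ρ x * fderiv ℝ (fun x => ‖v x‖ ^ 2) x (u x) =
      2 * (ρ x * inner ℝ (v x) (fderiv ℝ v x (u x))) := fun x => by
    have h := ((hv.contDiff.differentiable (by simp) x).hasFDerivAt.norm_sq).fderiv
    rw [h]
    simp
    ring
  simp_rw [h3] at h2
  rw [integral_const_mul] at h2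
  linarith

instance holderConjugate_three_three_halves : ENNReal.HolderConjugate 3 (3 / 2) where
  inv_add_inv_eq_inv := by
    rw [inv_one, ENNReal.inv_div (by simp) (by simp), ← one_div, ← ENNReal.add_div]
    norm_num
    exact ENNReal.div_self (by simp) (by simp)

instance holderTriple_six_two : ENNReal.HolderTriple 6 2 (3 / 2) where
  inv_add_inv_eq_inv := by
    have h6 : (6 : ℝ≥0∞)⁻¹ = ENNReal.ofReal (1 / 6) := by
      rw [ENNReal.ofReal_div_of_pos (by norm_num)]; simp
    have h2 : (2 : ℝ≥0∞)⁻¹ = ENNReal.ofReal (1 / 2) := by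
      rw [ENNReal.ofReal_div_of_pos (by norm_num)]; simp
    rw [ENNReal.inv_div (by simp) (by simp), h6, h2, ← ENNReal.ofReal_add (by norm_num)
      (by norm_num), show (1 / 6 + 1 / 2 : ℝ) = 2 / 3 by norm_num,
      ENNReal.ofReal_div_of_pos (by norm_num)]
    simp

theorem tendsto_convective_zero (hρm : AEStronglyMeasurable ρ (volume.restrict Ω))
    (hu6 : MemLp u 6 (volume.restrict Ω))
    (hkin : Integrable (fun x => ρ x * ‖u x‖ ^ 2) (volume.restrict Ω))
    (hρu2 : MemLp (fun x => ρ x • u x) 2 (volume.restrict Ω))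
    (hρu3 : MemLp (fun x => ρ x • u x) 3 (volume.restrict Ω)) (hw : ∀ n, IsTestFun ∞ Ω (w n))
    (hwu : Tendsto (fun n => eLpNorm (fun x => w n x - u x) 6 (volume.restrict Ω)) atTop (𝓝 0))
    {B : ℝ≥0∞} (hB : B ≠ ⊤)
    (hwB : ∀ n, eLpNorm (fderiv ℝ (w n)) 2 (volume.restrict Ω) ≤ B)
    (hmass : ∀ φ : R3 → ℝ, IsTestFun ∞ univ φ → ∫ x in Ω, ρ x * fderiv ℝ φ x (u x) = 0) :
    (∀ n, Integrable (fun x => ρ x * inner ℝ (u x) (fderiv ℝ (w n) x (u x)))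
      (volume.restrict Ω)) ∧
    Tendsto (fun n => ∫ x in Ω, ρ x * inner ℝ (u x) (fderiv ℝ (w n) x (u x))) atTop (𝓝 0) := by
  have hum := hu6.1
  have hwc : ∀ n, Continuous (w n) := fun n => (hw n).contDiff.continuous
  have hDc : ∀ n, Continuous (fderiv ℝ (w n)) := fun n => (hw n).contDiff.continuous_fderiv (by simp)
  have hwm : ∀ n, AEStronglyMeasurable (w n) (volume.restrict Ω) := fun n =>
    (hwc n).aestronglyMeasurable
  have hDm : ∀ n, AEStronglyMeasurable (fderiv ℝ (w n)) (volume.restrict Ω) := fun n =>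
    (hDc n).aestronglyMeasurable
  have i1 : ∀ n, Integrable (fun x => ρ x * inner ℝ (u x) (fderiv ℝ (w n) x (u x)))
      (volume.restrict Ω) := fun n => by
    obtain ⟨C, hC⟩ := (hDc n).bounded_above_of_compact_support
      ((hw n).hasCompactSupport.fderiv ℝ)
    refine (hkin.norm.const_mul C).mono' (hρm.mul (hum.inner (aestronglyMeasurable_apply (hDm n)
      hum))) (Eventually.of_forall fun x => ?_)
    rw [norm_mul, norm_mul, norm_pow, norm_norm]
    calc _ ≤ ‖ρ x‖ * (‖u x‖ * (C * ‖u x‖)) := by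
          refine mul_le_mul_of_nonneg_left ((norm_inner_le_norm _ _).trans ?_) (norm_nonneg _)
          refine mul_le_mul_of_nonneg_left (((fderiv ℝ (w n) x).le_opNorm _).trans ?_)
            (norm_nonneg _)
          exact mul_le_mul_of_nonneg_right (hC x) (norm_nonneg _)
      _ = _ := by ring
  have i2 : ∀ n, Integrable (fun x => ρ x * inner ℝ (w n x) (fderiv ℝ (w n) x (u x)))
      (volume.restrict Ω) := fun n => by
    have hk : MemLp (fun x => ‖w n x‖ * ‖fderiv ℝ (w n) x‖) 2 (volume.restrict Ω) :=
      (memLp_of_continuous ((hwc n).norm.mul (hDc n).norm)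
        ((hw n).hasCompactSupport.norm.mul_right) 2).restrict _
    refine integrable_of_holder 2 2 hρu2 hk (hρm.mul ((hwm n).inner (aestronglyMeasurable_apply
      (hDm n) hum))) (Eventually.of_forall fun x => ?_)
    rw [abs_mul, norm_smul, Real.norm_of_nonneg (r := ‖w n x‖ * _) (by positivity)]
    calc _ ≤ |ρ x| * (‖w n x‖ * (‖fderiv ℝ (w n) x‖ * ‖u x‖)) := by
          refine mul_le_mul_of_nonneg_left ((abs_real_inner_le_norm _ _).trans ?_) (abs_nonneg _)
          exact mul_le_mul_of_nonneg_left ((fderiv ℝ (w n) x).le_opNorm _) (norm_nonneg _)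
      _ = _ := by rw [Real.norm_eq_abs]; ring
  refine ⟨i1, ?_⟩
  -- `∫ ρ w · ∇w u = 0`, so `u` may be replaced by `u - w` in the first slot
  have e1 : ∀ n, ∫ x in Ω, ρ x * inner ℝ (u x) (fderiv ℝ (w n) x (u x)) =
      ∫ x in Ω, (ρ x * inner ℝ (u x) (fderiv ℝ (w n) x (u x)) -
        ρ x * inner ℝ (w n x) (fderiv ℝ (w n) x (u x))) := fun n => by
    rw [integral_sub (i1 n) (i2 n), integral_mass_kinetic (hw n) hmass, sub_zero]
  simp_rw [e1]
  have hd0 : Tendsto (fun n => eLpNorm (fun x => ‖w n x - u x‖ • fderiv ℝ (w n) x) (3 / 2)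
      (volume.restrict Ω)) atTop (𝓝 0) := by
    have h : Tendsto (fun n => eLpNorm (fun x => w n x - u x) 6 (volume.restrict Ω) * B) atTop
        (𝓝 0) := by
      have := ENNReal.Tendsto.mul_const hwu (Or.inr hB)
      rwa [zero_mul] at this
    refine tendsto_of_tendsto_of_tendsto_of_le_of_le tendsto_const_nhds h (fun _ => zero_le)
      fun n => ?_
    refine (eLpNorm_smul_le_mul_eLpNorm (p := 6) (q := 2) (r := 3 / 2) (hDm n)
      ((hwm n).sub hum).norm).trans ?_
    gcongr
    · exact le_of_eq (eLpNorm_norm _)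
    · exact hwB n
  have := tendsto_integral_of_holder 3 (3 / 2) hρu3
    (fun n => ((hwm n).sub hum).norm.smul (hDm n)) hd0
    (f := fun _ => (0 : ℝ)) aestronglyMeasurable_const (fun n => (i1 n).sub (i2 n))
    (fun n => Eventually.of_forall fun x => ?_)
  · simpa using this
  · simp only [Pi.sub_apply, Pi.smul_apply', sub_zero]
    rw [← mul_sub, ← inner_sub_left, abs_mul, norm_smul, norm_smul, norm_norm]
    calc _ ≤ |ρ x| * (‖u x - w n x‖ * (‖fderiv ℝ (w n) x‖ * ‖u x‖)) := by
          refine mul_le_mul_of_nonneg_left ((abs_real_inner_le_norm _ _).trans ?_) (abs_nonneg _)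
          exact mul_le_mul_of_nonneg_left ((fderiv ℝ (w n) x).le_opNorm _) (norm_nonneg _)
      _ = _ := by rw [Real.norm_eq_abs, norm_sub_rev]; ring

/-! ### Vanishing of the velocity -/

theorem exists_eLpNorm_fderiv_le (hA : MemLp A 2 (volume.restrict Ω))
    (hw : ∀ n, IsTestFun ∞ Ω (w n))
    (hwA : Tendsto (fun n => eLpNorm (fun x => fderiv ℝ (w n) x - A x) 2 (volume.restrict Ω))
      atTop (𝓝 0)) :
    ∃ B : ℝ≥0∞, B ≠ ⊤ ∧ ∀ n, eLpNorm (fderiv ℝ (w n)) 2 (volume.restrict Ω) ≤ B := by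
  have hD : ∀ n, MemLp (fderiv ℝ (w n)) 2 (volume.restrict Ω) := fun n =>
    (memLp_of_continuous ((hw n).contDiff.continuous_fderiv (by simp))
      ((hw n).hasCompactSupport.fderiv ℝ) 2).restrict _
  have hfin : ∀ n, eLpNorm (fun x => fderiv ℝ (w n) x - A x) 2 (volume.restrict Ω) ≠ ⊤ := fun n =>
    ((hD n).sub hA).2.ne
  obtain ⟨c, hc⟩ := ((ENNReal.tendsto_toReal ENNReal.zero_ne_top).comp hwA).bddAbove_range
  refine ⟨ENNReal.ofReal c + eLpNorm A 2 (volume.restrict Ω),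
    ENNReal.add_ne_top.2 ⟨ENNReal.ofReal_ne_top, hA.2.ne⟩, fun n => ?_⟩
  have h1 := eLpNorm_add_le ((hD n).1.sub hA.1) hA.1 one_le_two
  rw [sub_add_cancel] at h1
  refine h1.trans (add_le_add_left ?_ _)
  exact (ENNReal.le_ofReal_iff_toReal_le (hfin n) ((ENNReal.toReal_nonneg).trans
    (hc ⟨n, rfl⟩))).2 (hc ⟨n, rfl⟩)

theorem aestronglyMeasurable_dissipation {B : R3 → R3 →L[ℝ] R3} {ν : Measure R3}
    (hA : AEStronglyMeasurable A ν) (hB : AEStronglyMeasurable B ν) :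
    AEStronglyMeasurable (fun x => dissipation μ η (A x) (B x)) ν := by
  have hj : ∀ i j, Continuous fun D : R3 →L[ℝ] R3 => jac D i j := fun i j => by
    simp only [jac, Matrix.of_apply]
    fun_prop
  have ht : Continuous fun D : R3 →L[ℝ] R3 => (jac D).trace := traceCLM.continuous
  have h : Continuous fun D : (R3 →L[ℝ] R3) × (R3 →L[ℝ] R3) => dissipation μ η D.1 D.2 := by
    simp only [dissipation_eq]
    have h1 := fun i j => (hj i j).comp (continuous_fst (X := R3 →L[ℝ] R3) (Y := R3 →L[ℝ] R3))
    have h2 := fun i j => (hj i j).comp (continuous_snd (X := R3 →L[ℝ] R3) (Y := R3 →L[ℝ] R3))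
    have h3 := ht.comp (continuous_fst (X := R3 →L[ℝ] R3) (Y := R3 →L[ℝ] R3))
    have h4 := ht.comp (continuous_snd (X := R3 →L[ℝ] R3) (Y := R3 →L[ℝ] R3))
    refine ((continuous_const.mul ?_).add (continuous_const.mul ?_)).add
      (continuous_const.mul (h3.mul h4))
    · exact continuous_finsetSum _ fun i _ => continuous_finsetSum _ fun j _ =>
        (h1 i j).mul (h2 i j)
    · exact continuous_finsetSum _ fun i _ => continuous_finsetSum _ fun j _ =>
        (h1 j i).mul (h2 i j)
  exact Continuous.comp_aestronglyMeasurable₂ (g := dissipation μ η) h hA hB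

theorem integrable_dissipation {B : R3 → R3 →L[ℝ] R3} {ν : Measure R3} (hA : MemLp A 2 ν)
    (hB : MemLp B 2 ν) : Integrable (fun x => dissipation μ η (A x) (B x)) ν := by
  obtain ⟨C, hC0, hC⟩ := exists_abs_dissipation_le μ η
  have h : Integrable (fun x => ‖A x‖ * ‖B x‖) ν :=
    integrable_of_holder 2 2 hA hB (hA.1.norm.mul hB.1.norm)
      (Eventually.of_forall fun x => (abs_of_nonneg (by positivity)).le)
  exact (h.const_mul C).mono' (aestronglyMeasurable_dissipation hA.1 hB.1)
    (Eventually.of_forall fun x => hC _ _)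

theorem tendsto_dissipation_sub (hA : MemLp A 2 (volume.restrict Ω))
    (hw : ∀ n, IsTestFun ∞ Ω (w n))
    (hwA : Tendsto (fun n => eLpNorm (fun x => fderiv ℝ (w n) x - A x) 2 (volume.restrict Ω))
      atTop (𝓝 0)) :
    Tendsto (fun n => ∫ x in Ω, dissipation μ η (fderiv ℝ (w n) x - A x) (fderiv ℝ (w n) x)) atTop
      (𝓝 0) := by
  obtain ⟨B, hB, hwB⟩ := exists_eLpNorm_fderiv_le hA hw hwA
  obtain ⟨C, hC0, hC⟩ := exists_abs_dissipation_le μ η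
  have hDm : ∀ n, AEStronglyMeasurable (fderiv ℝ (w n)) (volume.restrict Ω) := fun n =>
    ((hw n).contDiff.continuous_fderiv (by simp)).aestronglyMeasurable
  have h : Tendsto (fun n => ‖C‖ₑ * (eLpNorm (fun x => fderiv ℝ (w n) x - A x) 2
      (volume.restrict Ω) * B)) atTop (𝓝 0) := by
    have h1 := ENNReal.Tendsto.mul_const hwA (Or.inr hB)
    have h2 := ENNReal.Tendsto.const_mul h1 (Or.inr (enorm_ne_top (x := C)))
    rwa [zero_mul, mul_zero] at h2
  rw [tendsto_zero_iff_enorm_tendsto_zero]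
  refine tendsto_of_tendsto_of_tendsto_of_le_of_le tendsto_const_nhds h (fun _ => zero_le)
    fun n => (enorm_integral_le_lintegral_enorm _).trans ?_
  have hle : ∀ x, ‖dissipation μ η (fderiv ℝ (w n) x - A x) (fderiv ℝ (w n) x)‖ₑ ≤
      ‖C‖ₑ * (‖fderiv ℝ (w n) x - A x‖ₑ * ‖fderiv ℝ (w n) x‖ₑ) := fun x => by
    have h1 := hC (fderiv ℝ (w n) x - A x) (fderiv ℝ (w n) x)
    rw [← Real.norm_eq_abs] at h1
    calc _ ≤ ENNReal.ofReal (C * (‖fderiv ℝ (w n) x - A x‖ * ‖fderiv ℝ (w n) x‖)) := by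
          rw [← ofReal_norm]
          exact ENNReal.ofReal_le_ofReal h1
      _ = _ := by
          rw [ENNReal.ofReal_mul hC0, ENNReal.ofReal_mul (norm_nonneg _), ofReal_norm, ofReal_norm,
            ← ofReal_norm C, Real.norm_of_nonneg hC0]
  calc _ ≤ ∫⁻ x in Ω, ‖C‖ₑ * (‖fderiv ℝ (w n) x - A x‖ₑ * ‖fderiv ℝ (w n) x‖ₑ) :=
        lintegral_mono hle
    _ = ‖C‖ₑ * ∫⁻ x in Ω, ‖fderiv ℝ (w n) x - A x‖ₑ * ‖fderiv ℝ (w n) x‖ₑ :=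
        lintegral_const_mul' _ _ enorm_ne_top
    _ ≤ _ := by
        gcongr
        exact (lintegral_enorm_mul_enorm_le 2 2 ((hDm n).sub hA.1) (hDm n)).trans
          (mul_le_mul_right (hwB n) _)

/-- If the dissipation of `A` against the approximating gradients tends to zero, then so does the
`L²` norm of these gradients, and the velocity vanishes by the Sobolev inequality. -/
theorem ae_eq_zero_of_tendsto_dissipation (hμ : 0 < μ) (hη : 0 ≤ η)
    (hum : AEStronglyMeasurable u (volume.restrict Ω))
    (hA : MemLp A 2 (volume.restrict Ω)) (hw : ∀ n, IsTestFun ∞ Ω (w n))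
    (hwu : Tendsto (fun n => eLpNorm (fun x => w n x - u x) 6 (volume.restrict Ω)) atTop (𝓝 0))
    (hwA : Tendsto (fun n => eLpNorm (fun x => fderiv ℝ (w n) x - A x) 2 (volume.restrict Ω))
      atTop (𝓝 0))
    (hdis : Tendsto (fun n => ∫ x in Ω, dissipation μ η (A x) (fderiv ℝ (w n) x)) atTop (𝓝 0)) :
    ∀ᵐ x ∂(volume.restrict Ω), u x = 0 := by
  have hD : ∀ n, MemLp (fderiv ℝ (w n)) 2 volume := fun n =>
    memLp_of_continuous ((hw n).contDiff.continuous_fderiv (by simp))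
      ((hw n).hasCompactSupport.fderiv ℝ) 2
  have hDΩ : ∀ n, MemLp (fderiv ℝ (w n)) 2 (volume.restrict Ω) := fun n => (hD n).restrict _
  have h1 := hdis.add (tendsto_dissipation_sub (μ := μ) (η := η) hA hw hwA)
  have e1 : ∀ n, (∫ x in Ω, dissipation μ η (A x) (fderiv ℝ (w n) x)) +
      ∫ x in Ω, dissipation μ η (fderiv ℝ (w n) x - A x) (fderiv ℝ (w n) x) =
      ∫ x, dissipation μ η (fderiv ℝ (w n) x) (fderiv ℝ (w n) x) := fun n => by
    have i1 : Integrable (fun x => dissipation μ η (A x) (fderiv ℝ (w n) x))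
      (volume.restrict Ω) := integrable_dissipation hA (hDΩ n)
    have i2 : Integrable (fun x => dissipation μ η (fderiv ℝ (w n) x - A x) (fderiv ℝ (w n) x))
      (volume.restrict Ω) := integrable_dissipation ((hDΩ n).sub hA) (hDΩ n)
    have e : ∫ x in Ω, dissipation μ η (fderiv ℝ (w n) x) (fderiv ℝ (w n) x) =
        ∫ x, dissipation μ η (fderiv ℝ (w n) x) (fderiv ℝ (w n) x) :=
      setIntegral_eq_integral_of_forall_compl_eq_zero fun x hx => by
        rw [(hw n).fderiv_eq_zero hx]
        simp [dissipation_eq, jac, Matrix.trace]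
    rw [← integral_add i1 i2, ← e]
    refine integral_congr_ae (Eventually.of_forall fun x => ?_)
    beta_reduce
    rw [dissipation_sub_left]
    ring
  simp_rw [e1] at h1
  rw [add_zero] at h1
  have h2 : Tendsto (fun n => ∫ x, ‖fderiv ℝ (w n) x‖ ^ 2) atTop (𝓝 0) := by
    have h := h1.const_mul (3 / μ)
    rw [mul_zero] at h
    exact squeeze_zero (fun n => integral_nonneg fun x => by positivity)
      (fun n => integral_norm_fderiv_sq_le hμ hη ((hw n).mono le_rfl (subset_univ _))) h
  have h3 : Tendsto (fun n => eLpNorm (fderiv ℝ (w n)) 2 volume) atTop (𝓝 0) := by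
    have e : ∀ n, eLpNorm (fderiv ℝ (w n)) 2 volume =
        ENNReal.ofReal ((∫ x, ‖fderiv ℝ (w n) x‖ ^ 2) ^ (2⁻¹ : ℝ)) := fun n => by
      rw [(hD n).eLpNorm_eq_integral_rpow_norm (by simp) (by simp)]
      simp
    simp_rw [e]
    have h := ENNReal.tendsto_ofReal (h2.rpow_const (p := (2⁻¹ : ℝ)) (Or.inr (by norm_num)))
    rwa [Real.zero_rpow (by norm_num), ENNReal.ofReal_zero] at h
  obtain ⟨S, hS, hSob⟩ := exists_sobolev_const
  have h4 : Tendsto (fun n => S * eLpNorm (fderiv ℝ (w n)) 2 volume +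
      eLpNorm (fun x => w n x - u x) 6 (volume.restrict Ω)) atTop (𝓝 0) := by
    have h := (ENNReal.Tendsto.const_mul h3 (Or.inr hS)).add hwu
    rwa [mul_zero, add_zero] at h
  have h5 : eLpNorm u 6 (volume.restrict Ω) ≤ 0 := by
    refine ge_of_tendsto' h4 fun n => ?_
    have hwm : AEStronglyMeasurable (w n) (volume.restrict Ω) :=
      (hw n).contDiff.continuous.aestronglyMeasurable
    have h := eLpNorm_sub_le hwm (hwm.sub hum) (p := 6) (by norm_num)
    rw [sub_sub_cancel] at h
    refine h.trans (add_le_add_left ?_ _)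
    exact (eLpNorm_restrict_le _ _ _ _).trans
      (hSob _ ((hw n).contDiff.of_le (by simp)) (hw n).hasCompactSupport)
  exact (eLpNorm_eq_zero_iff hum (by norm_num)).1 (le_antisymm h5 zero_le)

end Limits

/-! ### The momentum balance tested with the velocity -/

section Momentum

variable {Ω : Set R3} {M μ η : ℝ} {p : ℝ → ℝ} {G ρ : R3 → ℝ} {u : R3 → R3} {w : ℕ → R3 → R3}

theorem tendsto_pressure_work (hp2 : MemLp (fun x => p (ρ x)) 2 (volume.restrict Ω))
    {A : R3 → R3 →L[ℝ] R3} (hA : MemLp A 2 (volume.restrict Ω))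
    (hw : ∀ n, IsTestFun ∞ Ω (w n))
    (hwA : Tendsto (fun n => eLpNorm (fun x => fderiv ℝ (w n) x - A x) 2 (volume.restrict Ω))
      atTop (𝓝 0)) :
    (∀ n, Integrable (fun x => p (ρ x) * (jac (fderiv ℝ (w n) x)).trace) (volume.restrict Ω)) ∧
    Tendsto (fun n => ∫ x in Ω, p (ρ x) * (jac (fderiv ℝ (w n) x)).trace) atTop
      (𝓝 (∫ x in Ω, p (ρ x) * (jac (A x)).trace)) := by
  have hD : ∀ n, MemLp (fderiv ℝ (w n)) 2 (volume.restrict Ω) := fun n =>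
    (memLp_of_continuous ((hw n).contDiff.continuous_fderiv (by simp))
      ((hw n).hasCompactSupport.fderiv ℝ) 2).restrict _
  have hp3 : MemLp (fun x => 3 * p (ρ x)) 2 (volume.restrict Ω) := hp2.const_mul 3
  have hm : ∀ {B : R3 → R3 →L[ℝ] R3}, AEStronglyMeasurable B (volume.restrict Ω) →
      AEStronglyMeasurable (fun x => p (ρ x) * (jac (B x)).trace) (volume.restrict Ω) :=
    fun hB => hp2.1.mul (traceCLM.continuous.comp_aestronglyMeasurable hB)
  have hle : ∀ x (B : R3 →L[ℝ] R3), |p (ρ x) * (jac B).trace| ≤ ‖3 * p (ρ x)‖ * ‖B‖ := fun x B => by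
    rw [abs_mul, norm_mul, Real.norm_eq_abs (p (ρ x))]
    have h := mul_le_mul_of_nonneg_left (abs_trace_jac_le B) (abs_nonneg (p (ρ x)))
    calc _ ≤ _ := h
      _ = _ := by norm_num; ring
  have hi : ∀ n, Integrable (fun x => p (ρ x) * (jac (fderiv ℝ (w n) x)).trace)
      (volume.restrict Ω) := fun n =>
    integrable_of_holder 2 2 hp3 (hD n) (hm (hD n).1) (Eventually.of_forall fun x => hle x _)
  refine ⟨hi, tendsto_integral_of_holder 2 2 hp3 (fun n => (hD n).1.sub hA.1) hwA (hm hA.1) hi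
    fun n => Eventually.of_forall fun x => ?_⟩
  rw [← mul_sub, ← trace_jac_sub]
  exact hle x _

theorem tendsto_force_work {g : R3 → R3 →L[ℝ] ℝ}
    (hF : MemLp (fun x => ρ x • g x) (6 / 5) (volume.restrict Ω))
    (hu6 : MemLp u 6 (volume.restrict Ω)) (hw : ∀ n, IsTestFun ∞ Ω (w n))
    (hwu : Tendsto (fun n => eLpNorm (fun x => w n x - u x) 6 (volume.restrict Ω)) atTop (𝓝 0)) :
    Tendsto (fun n => ∫ x in Ω, ρ x * g x (w n x)) atTop (𝓝 (∫ x in Ω, ρ x * g x (u x))) := by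
  have hw6 : ∀ n, MemLp (w n) 6 (volume.restrict Ω) := fun n =>
    (memLp_of_continuous (hw n).contDiff.continuous (hw n).hasCompactSupport 6).restrict _
  have hm : ∀ {v : R3 → R3}, AEStronglyMeasurable v (volume.restrict Ω) →
      AEStronglyMeasurable (fun x => ρ x * g x (v x)) (volume.restrict Ω) := fun hv =>
    aestronglyMeasurable_apply hF.1 hv
  have hle : ∀ x (v : R3), |ρ x * g x v| ≤ ‖ρ x • g x‖ * ‖v‖ := fun x v =>
    (ρ x • g x).le_opNorm v
  refine tendsto_integral_of_holder (6 / 5) 6 hF (fun n => (hw6 n).1.sub hu6.1) hwu (hm hu6.1)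
    (fun n => integrable_of_holder (6 / 5) 6 hF (hw6 n) (hm (hw6 n).1)
      (Eventually.of_forall fun x => hle x _)) fun n => Eventually.of_forall fun x => ?_
  rw [← mul_sub, ← map_sub]
  exact hle x _

/-- The energy argument: if pressure and force do no work on the velocity, then the momentum balance
tested with approximations of the velocity shows that its dissipation vanishes. -/
theorem IsWeakSolution.velocity_eq_zero (hsol : IsWeakSolution Ω p μ η G ρ u) (hμ : 0 < μ)
    (hη : 0 ≤ η) (hu6 : MemLp u 6 (volume.restrict Ω)) (hw : ∀ n, IsTestFun ∞ Ω (w n))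
    (hwu : Tendsto (fun n => eLpNorm (fun x => w n x - u x) 6 (volume.restrict Ω)) atTop (𝓝 0))
    (hwA : Tendsto (fun n => eLpNorm (fun x => fderiv ℝ (w n) x - weakGrad Ω u x) 2
      (volume.restrict Ω)) atTop (𝓝 0))
    (hkin : Integrable (fun x => ρ x * ‖u x‖ ^ 2) (volume.restrict Ω))
    (hρu2 : MemLp (fun x => ρ x • u x) 2 (volume.restrict Ω))
    (hρu3 : MemLp (fun x => ρ x • u x) 3 (volume.restrict Ω))
    (hp2 : MemLp (fun x => p (ρ x)) 2 (volume.restrict Ω))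
    (hpu : ∫ x in Ω, p (ρ x) * (jac (weakGrad Ω u x)).trace = 0)
    (hF : MemLp (fun x => ρ x • weakGrad Ω G x) (6 / 5) (volume.restrict Ω))
    (hFu : ∫ x in Ω, ρ x * weakGrad Ω G x (u x) = 0) :
    ∀ᵐ x ∂(volume.restrict Ω), u x = 0 := by
  have hA : MemLp (weakGrad Ω u) 2 (volume.restrict Ω) := hsol.memD0_velocity.1.memLp_grad
  have hρm : AEStronglyMeasurable ρ (volume.restrict Ω) :=
    hsol.aemeasurable_density.aestronglyMeasurable
  obtain ⟨B, hB, hwB⟩ := exists_eLpNorm_fderiv_le hA hw hwA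
  obtain ⟨i1, t1⟩ := tendsto_convective_zero hρm hu6 hkin hρu2 hρu3 hw hwu hB hwB hsol.mass
  obtain ⟨i2, t2⟩ := tendsto_pressure_work hp2 hA hw hwA
  have t3 := tendsto_force_work hF hu6 hw hwu
  rw [hpu] at t2
  rw [hFu] at t3
  refine ae_eq_zero_of_tendsto_dissipation hμ hη hu6.1 hA hw hwu hwA ?_
  have t := (t1.add t2).add t3
  rw [add_zero, add_zero] at t
  refine t.congr fun n => ?_
  have h := hsol.momentum (w n) ((hw n).mono (by simp) subset_rfl)
  simp_rw [contract_tensor_jac] at h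
  rw [integral_add (i1 n) (i2 n)] at h
  rw [h]
  simp only [dissipation]
  ring

end Momentum

/-! ### Bounded densities and the triviality of the velocity -/

section Main

variable {Ω : Set R3} {γ : ℝ} {G ρ : R3 → ℝ} {u : R3 → R3} {w : ℕ → R3 → R3}

theorem ofReal_six_fifths : ENNReal.ofReal (6 / 5) = 6 / 5 := by
  rw [ENNReal.ofReal_div_of_pos (by norm_num)]
  simp

theorem MemLp.exists_ae_norm_le {α E : Type*} [MeasurableSpace α] {ν : Measure α}
    [NormedAddCommGroup E] {f : α → E} (hf : MemLp f ⊤ ν) : ∃ N : ℝ, ∀ᵐ x ∂ν, ‖f x‖ ≤ N := by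
  have h : eLpNormEssSup f ν ≠ ⊤ := by
    rw [← eLpNorm_exponent_top]
    exact hf.2.ne
  refine ⟨(eLpNormEssSup f ν).toReal, ?_⟩
  filter_upwards [ae_le_eLpNormEssSup (f := f) (μ := ν)] with x hx
  rw [← toReal_enorm]
  exact ENNReal.toReal_mono h hx

theorem integrable_smul_of_memLp {α E : Type*} [MeasurableSpace α] {ν : Measure α}
    [NormedAddCommGroup E] [NormedSpace ℝ E] (p q : ℝ≥0∞) [ENNReal.HolderConjugate p q]
    {f : α → ℝ} {v : α → E} (hf : MemLp f p ν) (hv : MemLp v q ν) :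
    Integrable (fun x => f x • v x) ν :=
  memLp_one_iff_integrable.1 (hv.smul (r := 1) hf)

/-- The force due to a potential in `W^{1,∞}`, for a density in `L^γ ∩ L^∞` with `γ ≤ 6/5`. -/
theorem force_of_memW1Infty {M : ℝ} (hγ0 : 0 < γ) (hγ : γ ≤ 6 / 5) (hΩ : IsOpen Ω)
    (hργ : MemLp ρ (ENNReal.ofReal γ) (volume.restrict Ω))
    (hM : ∀ᵐ x ∂(volume.restrict Ω), ‖ρ x‖ ≤ M) (hu6 : MemLp u 6 (volume.restrict Ω))
    (hρu2 : MemLp (fun x => ρ x • u x) 2 (volume.restrict Ω))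
    {A : R3 → R3 →L[ℝ] R3} (hA : MemLp A 2 (volume.restrict Ω))
    (hw : ∀ n, IsTestFun ∞ Ω (w n))
    (hwu : Tendsto (fun n => eLpNorm (fun x => w n x - u x) 6 (volume.restrict Ω)) atTop (𝓝 0))
    (hwA : Tendsto (fun n => eLpNorm (fun x => fderiv ℝ (w n) x - A x) 2 (volume.restrict Ω))
      atTop (𝓝 0))
    (hmass : ∀ φ : R3 → ℝ, IsTestFun ∞ univ φ → ∫ x in Ω, ρ x * fderiv ℝ φ x (u x) = 0)
    (hG : MemW1Infty Ω G) :
    MemLp (fun x => ρ x • weakGrad Ω G x) (6 / 5) (volume.restrict Ω) ∧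
      ∫ x in Ω, ρ x * weakGrad Ω G x (u x) = 0 := by
  have h65 : MemLp ρ (6 / 5) (volume.restrict Ω) := by
    have h := memLp_of_memLp_of_bdd hγ0 hγ hργ hM
    rwa [ofReal_six_fifths] at h
  have h2 : MemLp ρ 2 (volume.restrict Ω) := by
    have h := memLp_of_memLp_of_bdd hγ0 (hγ.trans (by norm_num : (6 / 5 : ℝ) ≤ 2)) hργ hM
    rwa [ENNReal.ofReal_ofNat] at h
  obtain ⟨N₁, hN₁⟩ := MemLp.exists_ae_norm_le hG.memLp
  obtain ⟨N₂, hN₂⟩ := MemLp.exists_ae_norm_le hG.memLp_grad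
  refine ⟨?_, ?_⟩
  · refine h65.of_le_mul (c := N₂) (h65.1.smul hG.memLp_grad.1) ?_
    filter_upwards [hN₂] with x hx
    rw [norm_smul, mul_comm]
    exact mul_le_mul_of_nonneg_right hx (norm_nonneg _)
  · have hwm : ∀ n, AEStronglyMeasurable (w n) (volume.restrict Ω) := fun n =>
      (hw n).contDiff.continuous.aestronglyMeasurable
    obtain ⟨k, hk, hku⟩ := (tendstoInMeasure_of_tendsto_eLpNorm (p := 6) (by norm_num) hwm hu6.1
      hwu).exists_seq_tendsto_ae
    exact integral_force_eq_zero_of_bounded (N := max N₁ N₂) hΩ h2 hu6.1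
      (integrable_smul_of_memLp (6 / 5) 6 h65 hu6) hρu2 hA (fun n => hw (k n)) hku
      (hwA.comp hk.tendsto_atTop) hmass hG.hasWeakGradient.isWeakGradient
      (hN₁.mono fun x hx => hx.trans (le_max_left _ _))
      (hN₂.mono fun x hx => hx.trans (le_max_right _ _))

end Main
end BarotropicNS

theorem theorem2
    (Ω : Set R3) (hΩ_open : IsOpen Ω) (hΩ_conn : IsConnected Ω)
    (μ η : ℝ) (hμ : 0 < μ) (hη : 0 ≤ η)
    (p P : ℝ → ℝ)
    (hp_cont : ContinuousOn p (Ici 0)) (hp_zero : p 0 = 0) (hp_nonneg : ∀ s : ℝ, 0 ≤ s → 0 ≤ p s)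
    (hp_C1 : ContDiffOn ℝ 1 p (Ioi 0)) (hp_mono : ∀ s : ℝ, 0 < s → 0 ≤ deriv p s)
    (hP : IsPressurePotential p P)
    (γ : ℝ) (hγ : 1 < γ)
    (hPp : 0 < liminf (fun s : ℝ => ((P s / p s : ℝ) : EReal)) (𝓝[>] 0))
    (hpγ : 0 < liminf (fun s : ℝ => ((p s / s ^ γ : ℝ) : EReal)) (𝓝[>] 0))
    (G : R3 → ℝ) (ρ : R3 → ℝ) (u : R3 → R3)
    (hsol : IsWeakSolution Ω p μ η G ρ u)
    (hρ : MemLp ρ ∞ (volume.restrict Ω))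
    (hE : IntegrableOn (fun x => energy P (ρ x) (u x)) Ω)
    (hG : (6 / 5 < γ ∧ ∃ q : ℝ, 6 / 5 ≤ q ∧ q ≤ 6 * γ / (5 * γ - 6) ∧
              MemD0ModConst Ω (ENNReal.ofReal q) G) ∨
          (γ ≤ 6 / 5 ∧ ((∃ q : ℝ, 6 / 5 ≤ q ∧ MemD0ModConst Ω (ENNReal.ofReal q) G) ∨
              MemW1Infty Ω G))) :
    ∀ᵐ x ∂(volume.restrict Ω), u x = 0 := by
  have hρm : AEStronglyMeasurable ρ (volume.restrict Ω) :=
    hsol.aemeasurable_density.aestronglyMeasurable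
  have hum : AEStronglyMeasurable u (volume.restrict Ω) :=
    hsol.aemeasurable_velocity.aestronglyMeasurable
  have h0 := hsol.density_nonneg
  obtain ⟨M, hM⟩ := MemLp.exists_ae_norm_le hρ
  have hM' : ∀ᵐ x ∂(volume.restrict Ω), ρ x ≤ M := hM.mono fun x hx => (le_abs_self _).trans hx
  obtain ⟨C, hC⟩ := hP.exists_bounds hp_cont hp_zero hp_nonneg hγ hPp hpγ M
  obtain ⟨b, b', hb'c, hb, hbP, hbp⟩ :=
    hP.exists_extension hp_cont hp_zero hp_nonneg hPp hpγ
  have hbc : Continuous b := continuous_iff_continuousAt.2 fun s => (hb s).continuousAt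
  have hbd : ∀ᵐ x ∂(volume.restrict Ω), 0 ≤ P (ρ x) ∧ p (ρ x) ≤ C * P (ρ x) ∧
      ρ x ^ γ ≤ C * P (ρ x) ∧ P (ρ x) ≤ C * ρ x ∧ p (ρ x) ≤ C := by
    filter_upwards [h0, hM'] with x h1 h2 using hC _ h1 h2
  obtain ⟨hkin, hPi⟩ := integrable_of_energy hbc hbP hρm hum h0 (hbd.mono fun x hx => hx.1) hE
  have hbi : Integrable (fun x => b (ρ x)) (volume.restrict Ω) := by
    refine hPi.congr ?_
    filter_upwards [h0] with x hx using (hbP _ hx).symm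
  -- integrability of the density and of the pressure
  have hργ : MemLp ρ (ENNReal.ofReal γ) (volume.restrict Ω) := by
    rw [memLp_rpow_iff hρm (by linarith)]
    refine (hPi.const_mul C).mono' ((hρm.norm.aemeasurable.pow_const γ).aestronglyMeasurable) ?_
    filter_upwards [h0, hbd] with x h1 h2
    rw [Real.norm_of_nonneg (by positivity), Real.norm_of_nonneg h1]
    exact h2.2.2.1
  have hpm : AEStronglyMeasurable (fun x => p (ρ x)) (volume.restrict Ω) := by
    refine (((hb'c.comp_aestronglyMeasurable hρm).mul hρm).sub
      (hbc.comp_aestronglyMeasurable hρm)).congr ?_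
    filter_upwards [h0] with x hx using hbp _ hx
  have hp2 : MemLp (fun x => p (ρ x)) 2 (volume.restrict Ω) := by
    refine memLp_two_of_integrable_of_le hpm ((hPi.const_mul C).const_mul C) ?_
    filter_upwards [h0, hbd] with x h1 h2
    have h3 := hp_nonneg _ h1
    rw [Real.norm_of_nonneg h3, sq]
    exact mul_le_mul h2.2.2.2.2 h2.2.1 h3 (h3.trans h2.2.2.2.2)
  -- integrability of the mass flux
  have hρum : AEStronglyMeasurable (fun x => ρ x • u x) (volume.restrict Ω) := hρm.smul hum
  have hρu2 : MemLp (fun x => ρ x • u x) 2 (volume.restrict Ω) := by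
    refine memLp_two_of_integrable_of_le hρum (hkin.const_mul M) ?_
    filter_upwards [h0, hM'] with x h1 h2
    rw [norm_smul, Real.norm_of_nonneg h1, mul_pow, sq (ρ x), mul_assoc]
    exact mul_le_mul_of_nonneg_right h2 (by positivity)
  obtain ⟨hu6, w, hw, hwu, hwA⟩ := hsol.memD0_velocity.exists_approx hΩ_open hum
  have hρu6 : MemLp (fun x => ρ x • u x) 6 (volume.restrict Ω) := by
    refine hu6.of_le_mul (c := M) hρum ?_
    filter_upwards [hM] with x hx
    rw [norm_smul]
    exact mul_le_mul_of_nonneg_right hx (norm_nonneg _)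
  have hρu3 : MemLp (fun x => ρ x • u x) 3 (volume.restrict Ω) := by
    have h := memLp_of_memLp_of_memLp (p := 2) (q := 6) (r := 3) (by norm_num) (by norm_num)
      (by norm_num) (by rwa [ENNReal.ofReal_ofNat]) (by rwa [ENNReal.ofReal_ofNat])
    rwa [ENNReal.ofReal_ofNat] at h
  have hA : MemLp (weakGrad Ω u) 2 (volume.restrict Ω) := hsol.memD0_velocity.1.memLp_grad
  -- the pressure does no work
  have hpb : ∀ᵐ x ∂(volume.restrict Ω), b' (ρ x) * ρ x - b (ρ x) = p (ρ x) := by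
    filter_upwards [h0] with x hx using hbp _ hx
  have hbpt : (fun x => (b' (ρ x) * ρ x - b (ρ x)) * (jac (weakGrad Ω u x)).trace)
      =ᵐ[volume.restrict Ω] fun x => p (ρ x) * (jac (weakGrad Ω u x)).trace := by
    filter_upwards [hpb] with x hx
    rw [hx]
  have hflux : IntegrableOn (fun x => b (ρ x) • u x) Ω := by
    have hb65 : MemLp (fun x => b (ρ x)) (6 / 5) (volume.restrict Ω) := by
      have h1 : MemLp (fun x => b (ρ x)) (ENNReal.ofReal 1) (volume.restrict Ω) := by
        rw [ENNReal.ofReal_one]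
        exact memLp_one_iff_integrable.2 hbi
      have h2 := memLp_of_memLp_of_bdd (r := 6 / 5) (M := |C| * M) one_pos (by norm_num) h1 (by
        filter_upwards [h0, hM', hbd] with x h1 h2 h3
        rw [hbP _ h1, Real.norm_of_nonneg h3.1]
        exact h3.2.2.2.1.trans (mul_le_mul (le_abs_self C) h2 h1 (abs_nonneg C)))
      rwa [ofReal_six_fifths] at h2
    exact integrable_smul_of_memLp (6 / 5) 6 hb65 hu6
  have hwork : IntegrableOn (fun x => p (ρ x) * (jac (weakGrad Ω u x)).trace) Ω := by
    have h3 : MemLp (fun x => traceCLM (weakGrad Ω u x)) 2 (volume.restrict Ω) := by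
      refine hA.of_le_mul (c := 3) (traceCLM.continuous.comp_aestronglyMeasurable hA.1)
        (Eventually.of_forall fun x => abs_trace_jac_le _)
    exact integrable_smul_of_memLp 2 2 hp2 h3
  have hpu : ∫ x in Ω, p (ρ x) * (jac (weakGrad Ω u x)).trace = 0 := by
    rw [← integral_congr_ae hbpt]
    exact setIntegral_pressure_work_eq_zero hΩ_open.measurableSet hsol.aemeasurable_density h0 hM'
      hum hA.1 hw hwu hwA hsol.mass hb'c hb hflux (hwork.congr hbpt.symm)
  -- the force does no work
  have hF : MemLp (fun x => ρ x • weakGrad Ω G x) (6 / 5) (volume.restrict Ω) ∧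
      ∫ x in Ω, ρ x * weakGrad Ω G x (u x) = 0 := by
    rcases hG with ⟨hγ', q, hq, hq', hG⟩ | ⟨hγ', ⟨q, hq, hG⟩ | hG⟩
    · refine force_of_memD0ModConst (by linarith) hq ?_ hργ hρ hM hu6 hsol.mass hG
      have h5 : 0 < 5 * γ - 6 := by linarith
      have h6 : (5 * γ - 6) / (6 * γ) ≤ 1 / q := by
        rw [div_le_div_iff₀ (by linarith) (by linarith)]
        rw [le_div_iff₀ h5] at hq'
        linarith
      have h7 : (5 * γ - 6) / (6 * γ) = 5 / 6 - 1 / γ := by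
        field_simp
      linarith
    · refine force_of_memD0ModConst (by linarith) hq ?_ hργ hρ hM hu6 hsol.mass hG
      have h5 : 5 / 6 ≤ 1 / γ := by
        rw [div_le_div_iff₀ (by norm_num) (by linarith)]
        linarith
      have h6 : 0 < 1 / q := by
        have : 0 < q := by linarith
        positivity
      linarith
    · exact force_of_memW1Infty (by linarith) hγ' hΩ_open hργ hM hu6 hρu2 hA hw hwu hwA hsol.mass
        hG
  exact hsol.velocity_eq_zero hμ hη hu6 hw hwu hwA hkin hρu2 hρu3 hp2 hpu hF.1 hF.2
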